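/- Let $J$ be a Jacobi matrix with diagonal entries $b_n\in\mathbb R$ and off-diagonal entries $a_n>0$ $(n\ge 1)$ such that the series $\sum_n b_n$ and $\sum_n (a_n^2-1)$ converge (possibly only conditionally). Regard $J$ as a bounded self-adjoint operator on $\ell^2(\mathbb N)$, let $d\nu$ be the spectral measure of the pair $(J,\delta_1)$, where $\delta_1=(1,0,0,\dots)$, and put $$m(z)=\langle\delta_1,(J-z)^{-1}\delta_1\rangle=\int\frac{d\nu(x)}{x-z},\qquad M(z)=-m(z+z^{-1})\quad(|z|<1).$$ For real $p,s$ let $\ell^p_s=\{\beta:\mathbb Z\to\mathbb C \;:\; \sum_n|n|^s|\beta_n|^p<\infty\}$ and $\ell^p=\ell^p_0$. Let $\widehat{\mathfrak A}$ be either $\ell^2_1\cap\ell^1$ or $\ell^1_s$ for some $s\ge1$, and let $\mathfrak A$ be the set of continuous functions $\partial\mathbb D\to\mathbb C$ whose Fourier coefficients lie in $\widehat{\mathfrak A}$. For a function $f$ on $[-2,2]$ write $f\in\mathfrak A$ if $\theta\mapsto f(2\cos\theta)$ is in $\mathfrak A$. A function $f$ on the circle is in $\mathfrak A_{loc}(\theta_0)$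 if there is a smooth bump function $\chi$ on $\partial\mathbb D$, equal to one in a neighbourhood of $\theta_0$, with $\chi f\in\mathfrak A$; for an open arc $I$, $f\in\mathfrak A_{loc}(I)$ means $f\in\mathfrak A_{loc}(\theta_0)$ for all $\theta_0\in I$. Write $d\nu\in\mathcal V$ if 1. $J$ has finitely many eigenvalues and they all lie in $\mathbb R\setminus[-2,2]$; and 2. on $[-2,2]$ the measure $d\nu$ is equal to $(\sqrt{2+x})^{l}(\sqrt{2-x})^{r}v_0(x)\,dx$ for some $l,r\in\{1,-1\}$ and some $v_0>0$ with $\log v_0\in\mathfrak A$. Write $M(\theta)=\lim_{t\uparrow1}M(te^{i\theta})$ for $e^{i\theta}\ne\pm1$. Write $M\in\mathcal M$ if these limits exist and 1. for every open arc $I\subseteq\partial\mathbb D$ avoiding $\pm1$, $M\in\mathfrak A_{loc}(I)$ and $\operatorname{Im}M\ne0$ on $I$; and 2. for each $z_0\in\{1,-1\}$ there are an open arc $I\ni z_0$ of $\partial\mathbb D$, a smooth bump function $\chi$ supported on $I$ and equal to one near $z_0$, and a function $G\in\mathfrak A$ with $\operatorname{Im}G\ne0$ on $I$, such that either $$\chi(\theta)M(\theta)=\chi(\theta)\frac{G(\theta)}{\sin\theta}\quad\text{for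 all } e^{i\theta}\neq\pm1,$$ or, for some $c\in\mathbb R$, $$\chi(\theta)M(\theta)=\chi(\theta)\bigl(c+\sin(\theta)\,G(\theta)\bigr)\quad\text{for all } e^{i\theta}\neq\pm1.$$ Then $d\nu\in\mathcal V$ if and only if $J$ has only finitely many eigenvalues outside $[-2,2]$ and $M\in\mathcal M$. -/

import Mathlib

open Filter Topology MeasureTheory Set
open scoped ContDiff CompactlySupported InnerProductSpace

noncomputable section

/-! ### Jacobi matrices and their operators -/

/-- A Jacobi matrix with diagonal `b` and off-diagonal `a > 0` (indexed from `0`), whose parameter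
sequences `b n` and `a n ^ 2 - 1` are conditionally summable. -/
structure JacobiMatrix where
  /-- off-diagonal entries -/
  a : ℕ → ℝ
  /-- diagonal entries -/
  b : ℕ → ℝ
  a_pos : ∀ n, 0 < a n
  b_condSummable : ∃ L : ℝ, Tendsto (fun N => ∑ k ∈ Finset.range N, b k) atTop (𝓝 L)
  a_condSummable : ∃ L : ℝ, Tendsto (fun N => ∑ k ∈ Finset.range N, (a k ^ 2 - 1)) atTop (𝓝 L)

/-- The Hilbert space `ℓ²(ℕ)`. -/
abbrev EllTwo : Type := lp (fun _ : ℕ => ℂ) 2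

theorem tendsto_zero_of_partialSums {f : ℕ → ℝ} {L : ℝ}
    (h : Tendsto (fun N => ∑ k ∈ Finset.range N, f k) atTop (𝓝 L)) :
    Tendsto f atTop (𝓝 0) := by
  have h1 := (h.comp (tendsto_add_atTop_nat 1)).sub h
  simpa [Finset.sum_range_succ, Function.comp_def] using h1

theorem JacobiMatrix.exists_bound (J : JacobiMatrix) :
    ∃ C : ℝ, 0 ≤ C ∧ (∀ n, |J.a n| ≤ C) ∧ ∀ n, |J.b n| ≤ C := by
  obtain ⟨L, hL⟩ := J.b_condSummable
  obtain ⟨L', hL'⟩ := J.a_condSummable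
  obtain ⟨B, hB⟩ := (tendsto_zero_of_partialSums hL).abs.bddAbove_range
  obtain ⟨A, hA⟩ := (tendsto_zero_of_partialSums hL').bddAbove_range
  have hB' : ∀ n, |J.b n| ≤ B := fun n => hB ⟨n, rfl⟩
  have hA' : ∀ n, J.a n ^ 2 - 1 ≤ A := fun n => hA ⟨n, rfl⟩
  refine ⟨max B (A + 2), ?_, fun n => ?_, fun n => (hB' n).trans (le_max_left _ _)⟩
  · exact (abs_nonneg _).trans ((hB' 0).trans (le_max_left _ _))
  · refine le_trans ?_ (le_max_right _ _)
    rw [abs_of_pos (J.a_pos n)]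
    nlinarith [hA' n, sq_nonneg (J.a n - 1), J.a_pos n]

/-- The action of the tridiagonal matrix on a sequence. -/
def JacobiMatrix.act (J : JacobiMatrix) (u : ℕ → ℂ) : ℕ → ℂ
  | 0 => J.b 0 * u 0 + J.a 0 * u 1
  | n + 1 => J.a n * u n + J.b (n + 1) * u (n + 1) + J.a (n + 1) * u (n + 2)

theorem JacobiMatrix.act_add (J : JacobiMatrix) (u v : ℕ → ℂ) :
    J.act (u + v) = J.act u + J.act v := by
  funext n
  cases n <;> simp only [JacobiMatrix.act, Pi.add_apply] <;> ring

theorem JacobiMatrix.act_smul (J : JacobiMatrix) (c : ℂ) (u : ℕ → ℂ) :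
    J.act (c • u) = c • J.act u := by
  funext n
  cases n <;> simp only [JacobiMatrix.act, Pi.smul_apply, smul_eq_mul] <;> ring

theorem memlp_two_mul_of_bounded {c : ℕ → ℝ} {C : ℝ} (hc : ∀ n, |c n| ≤ C) {u : ℕ → ℂ}
    (hu : Memℓp u 2) : Memℓp (fun n => (c n : ℂ) * u n) 2 := by
  have h2 : 0 < (2 : ENNReal).toReal := by norm_num
  refine memℓp_gen ?_
  have hs := (hu.summable h2).mul_left (C ^ (2 : ENNReal).toReal)
  refine Summable.of_nonneg_of_le (fun n => by positivity) (fun n => ?_) hs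
  have hC : 0 ≤ C := (abs_nonneg _).trans (hc n)
  rw [← Real.mul_rpow hC (norm_nonneg _), norm_mul, Complex.norm_real, Real.norm_eq_abs]
  gcongr
  exact hc n

theorem JacobiMatrix.act_mem (J : JacobiMatrix) {u : ℕ → ℂ} (hu : Memℓp u 2) :
    Memℓp (J.act u) 2 := by
  have h2 : 0 < (2 : ENNReal).toReal := by norm_num
  obtain ⟨C, -, ha, hb⟩ := J.exists_bound
  have hD := memlp_two_mul_of_bounded hb hu
  have hshift : Memℓp (fun n => u (n + 1)) 2 :=
    memℓp_gen ((summable_nat_add_iff 1).2 (hu.summable h2))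
  have hU := memlp_two_mul_of_bounded ha hshift
  have hL : Memℓp (fun n => match n with
      | 0 => (0 : ℂ)
      | n + 1 => (J.a n : ℂ) * u n) 2 :=
    memℓp_gen ((summable_nat_add_iff 1).1 ((memlp_two_mul_of_bounded ha hu).summable h2))
  convert (hL.add hD).add hU using 1
  funext n
  cases n with
  | zero => simp [JacobiMatrix.act]
  | succ n => simp [JacobiMatrix.act]

/-- The bounded operator on `ℓ²(ℕ)` given by a Jacobi matrix. -/
def JacobiMatrix.op (J : JacobiMatrix) : EllTwo →L[ℂ] EllTwo :=
  ContinuousLinearMap.ofSeqClosedGraph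
    (g :=
      { toFun := fun u => ⟨J.act u, J.act_mem (lp.memℓp u)⟩
        map_add' := fun u v => Subtype.ext (J.act_add u v)
        map_smul' := fun c u => Subtype.ext (J.act_smul c u) })
    (by
      intro u x y hx hy
      have hev : ∀ (w : ℕ → EllTwo) (z : EllTwo), Tendsto w atTop (𝓝 z) →
          ∀ n, Tendsto (fun k => (w k : ℕ → ℂ) n) atTop (𝓝 ((z : ℕ → ℂ) n)) := by
        intro w z hw n
        exact (lp.evalCLM ℂ (fun _ : ℕ => ℂ) 2 n).continuous.continuousAt.tendsto.comp hw
      ext n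
      refine tendsto_nhds_unique (hev _ _ hy n) ?_
      cases n with
      | zero =>
        exact ((hev _ _ hx 0).const_mul _).add ((hev _ _ hx 1).const_mul _)
      | succ n =>
        exact (((hev _ _ hx n).const_mul _).add ((hev _ _ hx (n + 1)).const_mul _)).add
          ((hev _ _ hx (n + 2)).const_mul _))

theorem JacobiMatrix.op_apply (J : JacobiMatrix) (u : EllTwo) (n : ℕ) :
    (J.op u : ℕ → ℂ) n = J.act u n := rfl

theorem JacobiMatrix.op_isSelfAdjoint (J : JacobiMatrix) : IsSelfAdjoint J.op := by
  rw [ContinuousLinearMap.isSelfAdjoint_iff_isSymmetric]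
  intro u v
  have h1 := (lp.hasSum_inner (𝕜 := ℂ) (J.op u) v).tendsto_sum_nat
  have h2 := (lp.hasSum_inner (𝕜 := ℂ) u (J.op v)).tendsto_sum_nat
  have hz : ∀ w : EllTwo, Tendsto (fun n => (w : ℕ → ℂ) n) atTop (𝓝 0) := by
    intro w
    have := ((lp.memℓp w).summable (by norm_num)).tendsto_atTop_zero
    simp only [ENNReal.toReal_ofNat, Real.rpow_two] at this
    have := this.sqrt
    simp at this
    exact tendsto_zero_iff_norm_tendsto_zero.2 this
  obtain ⟨C, hC, ha, -⟩ := J.exists_bound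
  have hd : ∀ N, ∑ n ∈ Finset.range (N+1), ⟪(J.op u : ℕ → ℂ) n, (v : ℕ → ℂ) n⟫_ℂ
     = ∑ n ∈ Finset.range (N+1), ⟪(u : ℕ → ℂ) n, (J.op v : ℕ → ℂ) n⟫_ℂ
      + J.a N * (starRingEnd ℂ ((u : ℕ → ℂ) (N+1)) * (v : ℕ → ℂ) N -
        starRingEnd ℂ ((u : ℕ → ℂ) N) * (v : ℕ → ℂ) (N+1)) := by
    intro N
    induction N with
    | zero => simp [JacobiMatrix.op_apply, JacobiMatrix.act]; ring
    | succ N ih =>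
      rw [Finset.sum_range_succ, ih, Finset.sum_range_succ _ (N+1)]
      simp [JacobiMatrix.op_apply, JacobiMatrix.act]; ring
  have h3 : Tendsto (fun N => (J.a N : ℂ) *
      (starRingEnd ℂ ((u : ℕ → ℂ) (N+1)) * (v : ℕ → ℂ) N -
        starRingEnd ℂ ((u : ℕ → ℂ) N) * (v : ℕ → ℂ) (N+1))) atTop (𝓝 0) := by
    have hs : ∀ w : EllTwo, Tendsto (fun n => (w : ℕ → ℂ) (n+1)) atTop (𝓝 0) :=
      fun w => (hz w).comp (tendsto_add_atTop_nat 1)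
    have hc : ∀ g : ℕ → ℂ, Tendsto g atTop (𝓝 0) → Tendsto (fun n => starRingEnd ℂ (g n)) atTop (𝓝 0) := by
      intro g hg
      have := (Complex.continuous_conj.tendsto 0).comp hg
      rw [map_zero] at this
      exact this
    have h4 := ((hc _ (hs u)).mul (hz v)).sub ((hc _ (hz u)).mul (hs v))
    simp only [mul_zero, sub_zero] at h4
    refine squeeze_zero_norm (fun n => ?_) (by simpa using (h4.norm).const_mul C)
    rw [norm_mul, Complex.norm_real, Real.norm_eq_abs]
    exact mul_le_mul_of_nonneg_right (ha n) (norm_nonneg _)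
  have h1' := h1.comp (tendsto_add_atTop_nat 1)
  have h2' := (h2.comp (tendsto_add_atTop_nat 1)).add h3
  rw [add_zero] at h2'
  refine tendsto_nhds_unique h1' (h2'.congr fun N => (hd N).symm)

/-- The first basis vector `δ₁ = (1, 0, 0, …)`. -/
def deltaOne : EllTwo := lp.single 2 0 1

/-! ### The spectral measure -/

/-- For a bounded self-adjoint operator `T` on a complex Hilbert space and a vector `v`, the positive
functional `f ↦ ⟨v, f(T) v⟩` on `C_c(ℝ)`, where `f(T)` is the continuous functional calculus. -/
def spectralFunctional {H : Type} [NormedAddCommGroup H] [InnerProductSpace ℂ H] [CompleteSpace H]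
    (T : H →L[ℂ] H) (v : H) : C_c(ℝ, ℝ) →ₚ[ℝ] ℝ :=
  PositiveLinearMap.mk₀
    { toFun := fun f => (⟪v, cfc (fun x => f x) T v⟫_ℂ).re
      map_add' := fun f g => by
        have h := cfc_add (a := T) f g f.continuous.continuousOn g.continuous.continuousOn
        simp only [CompactlySupportedContinuousMap.add_apply, h, add_apply,
          inner_add_right, Complex.add_re]
      map_smul' := fun c f => by
        have h := cfc_smul (a := T) c f f.continuous.continuousOn
        simp only [CompactlySupportedContinuousMap.smul_apply]
        rw [h, smul_apply, ← Complex.coe_smul, inner_smul_right, Complex.re_ofReal_mul]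
        rfl }
    (fun f hf => by
      have h : 0 ≤ cfc (f : ℝ → ℝ) T := cfc_nonneg (fun x _ => hf x)
      have h' := (ContinuousLinearMap.nonneg_iff_isPositive _).1 h
      exact (Complex.nonneg_iff.1 (h'.inner_nonneg_right v)).1)

/-- The spectral measure of the pair `(T, v)`: the measure `ν` on `ℝ` with
`∫ f dν = ⟨v, f(T) v⟩`, obtained from the Riesz–Markov–Kakutani theorem. -/
def vectorSpectralMeasure {H : Type} [NormedAddCommGroup H] [InnerProductSpace ℂ H]
    [CompleteSpace H] (T : H →L[ℂ] H) (v : H) : Measure ℝ :=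
  RealRMK.rieszMeasure (spectralFunctional T v)

theorem integral_vectorSpectralMeasure {H : Type} [NormedAddCommGroup H] [InnerProductSpace ℂ H]
    [CompleteSpace H] (T : H →L[ℂ] H) (v : H) (f : C_c(ℝ, ℝ)) :
    ∫ x, f x ∂vectorSpectralMeasure T v = (⟪v, cfc (f : ℝ → ℝ) T v⟫_ℂ).re :=
  RealRMK.integral_rieszMeasure (spectralFunctional T v) f

/-- The spectral measure of the pair `(J, δ₁)`. -/
def JacobiMatrix.spectralMeasure (J : JacobiMatrix) : Measure ℝ :=
  vectorSpectralMeasure J.op deltaOne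

/-- The `m`-function `m(z) = ⟨δ₁, (J - z)⁻¹ δ₁⟩`. -/
def JacobiMatrix.mFunction (J : JacobiMatrix) (z : ℂ) : ℂ :=
  ⟪deltaOne, Ring.inverse (J.op - algebraMap ℂ (EllTwo →L[ℂ] EllTwo) z) deltaOne⟫_ℂ

/-- The `M`-function `M(z) = -m(z + 1/z)`, considered for `0 < |z| < 1`. -/
def JacobiMatrix.MFunction (J : JacobiMatrix) (z : ℂ) : ℂ :=
  -J.mFunction (z + z⁻¹)

/-- The set of eigenvalues of `J`. -/
def JacobiMatrix.eigenvalues (J : JacobiMatrix) : Set ℂ :=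
  {z | Module.End.HasEigenvalue (J.op : EllTwo →ₗ[ℂ] EllTwo) z}

/-- The interval `[-2, 2]` as a set of complex numbers. -/
def bandSet : Set ℂ := (fun x : ℝ => (x : ℂ)) '' Icc (-2) 2

/-! ### The algebras

A function on the unit circle is a function of `θ ∈ ℝ` that is `2π`-periodic. -/

/-- The weighted sequence space `l^p_s` on `ℤ`: all `β` with `∑ |n|^s |β n|^p < ∞`. -/
def weightedEll (p s : ℝ) : Set (ℤ → ℂ) :=
  {β | Summable fun n : ℤ => |(n : ℝ)| ^ s * ‖β n‖ ^ p}

/-- `Â` is one of the admissible sequence algebras: `l²_1 ∩ l¹`, or `l¹_s` with `s ≥ 1`. -/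
def IsAdmissibleAlgebra (Ahat : Set (ℤ → ℂ)) : Prop :=
  Ahat = weightedEll 2 1 ∩ weightedEll 1 0 ∨ ∃ s : ℝ, 1 ≤ s ∧ Ahat = weightedEll 1 s

/-- The class `𝔄` of (continuous) functions on the circle with Fourier coefficients in `Â`. -/
def InAlg (Ahat : Set (ℤ → ℂ)) (f : ℝ → ℂ) : Prop :=
  Continuous f ∧ Function.Periodic f (2 * Real.pi) ∧ fourierCoeffOn Real.two_pi_pos f ∈ Ahat

/-- A smooth bump function on the circle. -/
def IsCircleBump (χ : ℝ → ℝ) : Prop :=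
  ContDiff ℝ ∞ χ ∧ Function.Periodic χ (2 * Real.pi) ∧ ∀ θ, χ θ ∈ Icc (0 : ℝ) 1

/-- `f` is locally in `𝔄` at `θ₀`: `χ f ∈ 𝔄` for a smooth bump `χ` equal to one near `θ₀`. -/
def InAlgLoc (Ahat : Set (ℤ → ℂ)) (f : ℝ → ℂ) (θ₀ : ℝ) : Prop :=
  ∃ χ : ℝ → ℝ, IsCircleBump χ ∧ (∀ᶠ θ in 𝓝 θ₀, χ θ = 1) ∧ InAlg Ahat fun θ => χ θ * f θ

/-! ### The two classes -/

/-- The class `𝒱`. The eigenvalues of `J` are finite in number and lie in `ℝ ∖ [-2, 2]`, and on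
`[-2, 2]` the spectral measure is `√(2+x)^l √(2-x)^r v₀(x) dx` with `l, r ∈ {1, -1}`, `v₀ > 0` and
`log v₀ ∈ 𝔄`, that is, `θ ↦ log v₀(2 cos θ)` is in `𝔄`. -/
def JacobiMatrix.MemV (J : JacobiMatrix) (Ahat : Set (ℤ → ℂ)) : Prop :=
  (J.eigenvalues.Finite ∧ ∀ z ∈ J.eigenvalues, ∃ x : ℝ, z = x ∧ x ∉ Icc (-2 : ℝ) 2) ∧
  ∃ (l r : ℤ) (v₀ : ℝ → ℝ), (l = 1 ∨ l = -1) ∧ (r = 1 ∨ r = -1) ∧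
    (∀ x ∈ Icc (-2 : ℝ) 2, 0 < v₀ x) ∧
    InAlg Ahat (fun θ => (Real.log (v₀ (2 * Real.cos θ)) : ℂ)) ∧
    J.spectralMeasure.restrict (Icc (-2) 2) =
      (volume.restrict (Icc (-2) 2)).withDensity fun x =>
        ENNReal.ofReal (Real.sqrt (2 + x) ^ l * Real.sqrt (2 - x) ^ r * v₀ x)

/-- `F(θ)` is the radial boundary value of `M` at `e^{iθ}`, for every `e^{iθ} ≠ ±1`. -/
def IsBoundaryFunction (M : ℂ → ℂ) (F : ℝ → ℂ) : Prop :=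
  ∀ θ : ℝ, Real.sin θ ≠ 0 →
    Tendsto (fun t : ℝ => M (t * Complex.exp (θ * Complex.I))) (𝓝[<] 1) (𝓝 (F θ))

/-- The first condition for `ℳ`, on the arc `{e^{iθ} : α < θ < β}`. -/
def RegularOnArc (Ahat : Set (ℤ → ℂ)) (F : ℝ → ℂ) (α β : ℝ) : Prop :=
  ∀ θ ∈ Ioo α β, InAlgLoc Ahat F θ ∧ (F θ).im ≠ 0

/-- The second condition for `ℳ`, at the point `e^{iθ₀} ∈ {1, -1}`; the arc is
`I = {e^{iθ} : α < θ < β}`. -/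
def EdgeForm (Ahat : Set (ℤ → ℂ)) (F : ℝ → ℂ) (θ₀ : ℝ) : Prop :=
  ∃ (α β : ℝ) (χ : ℝ → ℝ), θ₀ ∈ Ioo α β ∧ IsCircleBump χ ∧ (∀ᶠ θ in 𝓝 θ₀, χ θ = 1) ∧
    (∀ θ, χ θ ≠ 0 → ∃ k : ℤ, θ + k * (2 * Real.pi) ∈ Ioo α β) ∧
    ∃ G : ℝ → ℂ, InAlg Ahat G ∧ (∀ θ ∈ Ioo α β, (G θ).im ≠ 0) ∧
      ((∀ θ, Real.sin θ ≠ 0 → χ θ * F θ = χ θ * (G θ / (Real.sin θ : ℂ))) ∨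
        ∃ c : ℝ, ∀ θ, Real.sin θ ≠ 0 → χ θ * F θ = χ θ * (c + (Real.sin θ : ℂ) * G θ))

/-- The class `ℳ`; `M(θ)` stands for the boundary value of `M` at `e^{iθ}`. -/
def MemM (Ahat : Set (ℤ → ℂ)) (M : ℂ → ℂ) : Prop :=
  ∃ F : ℝ → ℂ, IsBoundaryFunction M F ∧
    (∀ α β : ℝ, (∀ θ ∈ Ioo α β, Real.sin θ ≠ 0) → RegularOnArc Ahat F α β) ∧
    EdgeForm Ahat F 0 ∧ EdgeForm Ahat F Real.pi

end

open scoped ENNReal NNReal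

noncomputable section

/-! ### Absolutely convergent Fourier series -/

/-! Write `y = z + z⁻¹` and `x = 2 cos φ`. The Cauchy transform of `√(4 - x²) w(φ) dx` over the band
is `z - z⁻¹` times the analytic half of the Fourier series of `w`, plus a real affine function of
`y` (`HasFourier.integral_sq_sin_mul_inv`). The norm of the algebra depends monotonically on the
moduli of the coefficients, so dropping the negative frequencies stays inside `𝔄`. The boundary
values `C` of the half series are therefore in `𝔄`, and `Re C = π w`.

Consequently, if a measure has density `√(4 - x²) w / q` on the band, with `q` a quadratic
polynomial, and finitely many atoms outside it (`BandModel`), then `q(y) ∫ dν(x)/(y - x)` is a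
rational function with real coefficients plus `z - z⁻¹` times the half series
(`BandModel.cauchy_eq`). On the circle this gives `M = (r(2 cos θ) + 2i sin θ C(θ)) / q(2 cos θ)`.
The exponents `l`, `r` of the class `𝒱` decide at which edges `q` vanishes. At an edge where `q ≠ 0`
the quotient is `c + sin θ G`, since `r` and `q` differ from their edge values by multiples of `sin²
θ`. At an edge where `q = 0`, the value of `r` is `q'` times the mass of the edge
(`BandModel.r_edge`); without an atom `r` vanishes as well, and the quotient is `G / sin θ`.

Conversely, `Im M` is a Poisson integral of the spectral measure. If Poisson integrals converge to
finite limits at every point of a set, the measure is absolutely continuous there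
(`restrict_eq_withDensity_of_tendsto_poisson`), which rules out singular parts inside the band. The
local forms of `M` glue to one weight `W > 0` in `𝔄` (`exists_weight_of_edgeForm`). Atoms at `±2`
are excluded by `sin² θ M → 0` (`BandModel.edge_atom_eq_zero`), and an eigenvalue in the band would
be an atom.

Two general facts complete the argument. Passing between `v₀` and `log v₀` needs `𝔄` to be closed
under `exp` and under `log` of positive functions; the latter is a Wiener–Lévy theorem and rests on
the growth rate of powers being the supremum norm (`IsAlgNorm.exists_pow_bound`). The summability of
the parameters enters through `a n → 1` and `b n → 0`: up to a finite-rank operator `J` has norm as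
close to `2` as desired, so by the Fredholm alternative its spectrum outside `[-2, 2]` consists of
eigenvalues (`JacobiMatrix.hasEigenvalue_or_isUnit`). -/

/-- The exponential monomial `θ ↦ e^{inθ}`. -/
def expMono (n : ℤ) (θ : ℝ) : ℂ := Complex.exp (n * θ * Complex.I)

theorem norm_expMono (n : ℤ) (θ : ℝ) : ‖expMono n θ‖ = 1 := by
  rw [expMono, ← Complex.norm_exp_ofReal_mul_I (n * θ)]
  push_cast
  rfl

theorem expMono_add (m n : ℤ) (θ : ℝ) : expMono (m + n) θ = expMono m θ * expMono n θ := by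
  simp only [expMono, ← Complex.exp_add]
  congr 1
  push_cast
  ring

theorem expMono_zero (θ : ℝ) : expMono 0 θ = 1 := by simp [expMono]

theorem continuous_expMono (n : ℤ) : Continuous (expMono n) := by
  unfold expMono
  fun_prop

theorem periodic_expMono (n : ℤ) : Function.Periodic (expMono n) (2 * Real.pi) := by
  intro θ
  simp only [expMono]
  rw [Complex.exp_eq_exp_iff_exists_int]
  exact ⟨n, by push_cast; ring⟩

/-- `f` is the sum of the absolutely convergent Fourier series with coefficients `β`. -/
def HasFourier (β : ℤ → ℂ) (f : ℝ → ℂ) : Prop :=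
  (Summable fun n => ‖β n‖) ∧ ∀ θ, HasSum (fun n => β n * expMono n θ) (f θ)

theorem fourier_coe_eq_expMono (n : ℤ) (θ : ℝ) :
    fourier n (θ : AddCircle (2 * Real.pi)) = expMono n θ := by
  rw [fourier_coe_apply, expMono]
  congr 1
  have : (Real.pi : ℂ) ≠ 0 := by exact_mod_cast Real.pi_ne_zero
  push_cast
  field_simp

theorem fourierCoeffOn_two_pi (f : ℝ → ℂ) (n : ℤ) :
    fourierCoeffOn Real.two_pi_pos f n =
      (1 / (2 * Real.pi)) • ∫ θ in (0 : ℝ)..2 * Real.pi, expMono (-n) θ * f θ := by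
  have h0 : (2 * Real.pi - 0 : ℝ) = 2 * Real.pi := sub_zero _
  rw [fourierCoeffOn_eq_integral, h0]
  simp only [fourier_coe_eq_expMono, smul_eq_mul]

theorem HasFourier.continuous {β : ℤ → ℂ} {f : ℝ → ℂ} (h : HasFourier β f) : Continuous f := by
  have : f = fun θ => ∑' n, β n * expMono n θ := funext fun θ => (h.2 θ).tsum_eq.symm
  rw [this]
  refine continuous_tsum (fun n => continuous_const.mul (continuous_expMono n)) h.1 fun n θ => ?_
  rw [norm_mul, norm_expMono, mul_one]

theorem HasFourier.periodic {β : ℤ → ℂ} {f : ℝ → ℂ} (h : HasFourier β f) :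
    Function.Periodic f (2 * Real.pi) := by
  intro θ
  refine (h.2 (θ + 2 * Real.pi)).unique ?_
  simpa only [periodic_expMono _ θ] using h.2 θ

/-- The series converges uniformly, hence in `L²`, so its inner product with a basis exponential can
be computed term by term. This makes the coefficients unique, and any convenient representation
decides membership in the algebra. -/
theorem HasFourier.fourierCoeffOn_eq {β : ℤ → ℂ} {f : ℝ → ℂ} (h : HasFourier β f) :
    fourierCoeffOn Real.two_pi_pos f = β := by
  have : Fact (0 < 2 * Real.pi) := ⟨Real.two_pi_pos⟩
  let g : C(AddCircle (2 * Real.pi), ℂ) := ∑' n, β n • fourier n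
  have hs : Summable fun n => β n • (fourier n : C(AddCircle (2 * Real.pi), ℂ)) := by
    refine Summable.of_norm ?_
    simpa only [norm_smul, fourier_norm, mul_one] using h.1
  have hg : ∀ θ : ℝ, g θ = f θ := by
    intro θ
    have := (ContinuousMap.evalCLM ℂ (θ : AddCircle (2 * Real.pi))).hasSum hs.hasSum
    refine this.unique ?_
    convert h.2 θ using 2 with n
    simp [fourier_coe_eq_expMono, -fourier_apply]
  funext n
  have h1 : fourierCoeffOn Real.two_pi_pos f n = fourierCoeff g n := by
    rw [fourierCoeffOn_two_pi, fourierCoeff_eq_intervalIntegral _ _ 0, zero_add]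
    simp only [fourier_coe_eq_expMono, smul_eq_mul, hg]
  rw [h1]
  have h2 : HasSum (fun k => β k • fourierCoeff (fourier k : C(AddCircle (2 * Real.pi), ℂ)) n)
      (fourierCoeff g n) := by
    have hL2 := (ContinuousMap.toLp (E := ℂ) 2 (AddCircle.haarAddCircle (T := 2 * Real.pi))
      ℂ).hasSum hs.hasSum
    have h3 := (innerSL ℂ (fourierBasis (T := 2 * Real.pi) n)).hasSum hL2
    have key : ∀ u : C(AddCircle (2 * Real.pi), ℂ),
        innerSL ℂ (fourierBasis (T := 2 * Real.pi) n) (ContinuousMap.toLp (E := ℂ) 2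
          (AddCircle.haarAddCircle (T := 2 * Real.pi)) ℂ u) = fourierCoeff u n := by
      intro u
      rw [innerSL_apply_apply, ← HilbertBasis.repr_apply_apply, fourierBasis_repr, fourierCoeff_toLp]
    rw [← key]
    refine HasSum.congr_fun h3 fun k => ?_
    rw [ContinuousLinearMap.map_smul, ContinuousLinearMap.map_smul, key]
  refine h2.unique ?_
  simp only [fourierCoeff_fourier]
  convert hasSum_ite_eq n (β n) using 2 with k
  by_cases hk : k = n
  · subst hk; simp
  · simp [hk, Ne.symm hk]

theorem hasFourier_of_summable {f : ℝ → ℂ} (hc : Continuous f)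
    (hp : Function.Periodic f (2 * Real.pi))
    (hs : Summable fun n => ‖fourierCoeffOn Real.two_pi_pos f n‖) :
    HasFourier (fourierCoeffOn Real.two_pi_pos f) f := by
  have : Fact (0 < 2 * Real.pi) := ⟨Real.two_pi_pos⟩
  let g : C(AddCircle (2 * Real.pi), ℂ) := ⟨hp.lift, by
    exact continuous_coinduced_dom.mpr hc⟩
  have hg : ∀ θ : ℝ, g θ = f θ := fun θ => hp.lift_coe θ
  have h1 : ∀ n, fourierCoeffOn Real.two_pi_pos f n = fourierCoeff g n := by
    intro n
    rw [fourierCoeffOn_two_pi, fourierCoeff_eq_intervalIntegral _ _ 0, zero_add]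
    simp only [fourier_coe_eq_expMono, smul_eq_mul, hg]
  refine ⟨hs, fun θ => ?_⟩
  have hs' : Summable (fourierCoeff g) := by
    refine Summable.of_norm ?_
    simpa only [h1] using hs
  have := has_pointwise_sum_fourier_series_of_summable hs' (θ : AddCircle (2 * Real.pi))
  simpa only [fourier_coe_eq_expMono, smul_eq_mul, hg, ← h1] using this

/-- Convolution of sequences on `ℤ`. -/
def conv (β γ : ℤ → ℂ) (n : ℤ) : ℂ := ∑' k, β k * γ (n - k)

theorem HasFourier.mul {β γ : ℤ → ℂ} {f g : ℝ → ℂ} (hf : HasFourier β f) (hg : HasFourier γ g) :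
    HasFourier (conv β γ) (fun θ => f θ * g θ) := by
  -- The pair (total frequency, frequency of `f`) is sent to the two individual frequencies; summing
  -- over fibres of the first component collects the convolution.
  let e : ℤ × ℤ ≃ ℤ × ℤ :=
    { toFun := fun p => (p.2, p.1 - p.2)
      invFun := fun p => (p.1 + p.2, p.1)
      left_inv := fun p => by simp
      right_inv := fun p => by simp }
  have hN : Summable fun p : ℤ × ℤ => ‖β p.2 * γ (p.1 - p.2)‖ := by
    have := (summable_mul_of_summable_norm hf.1.norm hg.1.norm).norm
    refine (e.summable_iff.2 this).congr fun p => ?_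
    simp [e]
  refine ⟨?_, fun θ => ?_⟩
  · have h1 := hN.prod
    refine Summable.of_nonneg_of_le (fun n => norm_nonneg _) (fun n => ?_) h1
    exact norm_tsum_le_tsum_norm (hN.prod_factor n)
  · have hs : Summable fun p : ℤ × ℤ =>
        (β p.1 * expMono p.1 θ) * (γ p.2 * expMono p.2 θ) := by
      refine Summable.of_norm ?_
      refine (summable_mul_of_summable_norm hf.1.norm hg.1.norm).norm.congr fun p => ?_
      simp [norm_expMono]
    have h1 := (hf.2 θ).mul (hg.2 θ) hs
    rw [← e.hasSum_iff] at h1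
    refine h1.prod_fiberwise fun n => ?_
    have h2 := ((hN.prod_factor n).of_norm.hasSum).mul_right (expMono n θ)
    refine h2.congr_fun fun k => ?_
    have : expMono n θ = expMono k θ * expMono (n - k) θ := by
      rw [← expMono_add]; congr 1; ring
    simp only [e, Function.comp_apply, Equiv.coe_fn_mk]
    rw [this]; ring

theorem HasFourier.add {β γ : ℤ → ℂ} {f g : ℝ → ℂ} (hf : HasFourier β f) (hg : HasFourier γ g) :
    HasFourier (β + γ) (fun θ => f θ + g θ) := by
  refine ⟨Summable.of_nonneg_of_le (fun n => norm_nonneg _) (fun n => norm_add_le _ _)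
    (hf.1.add hg.1), fun θ => ?_⟩
  simpa only [Pi.add_apply, add_mul] using (hf.2 θ).add (hg.2 θ)

theorem HasFourier.const_mul {β : ℤ → ℂ} {f : ℝ → ℂ} (c : ℂ) (hf : HasFourier β f) :
    HasFourier (fun n => c * β n) (fun θ => c * f θ) := by
  refine ⟨by simpa only [norm_mul] using hf.1.mul_left ‖c‖, fun θ => ?_⟩
  simpa only [mul_assoc] using (hf.2 θ).mul_left c

theorem HasFourier.conj {β : ℤ → ℂ} {f : ℝ → ℂ} (hf : HasFourier β f) :
    HasFourier (fun n => starRingEnd ℂ (β (-n))) (fun θ => starRingEnd ℂ (f θ)) := by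
  refine ⟨?_, fun θ => ?_⟩
  · have := (Equiv.neg ℤ).summable_iff.2 hf.1
    exact this.congr fun n => by simp
  · have h1 := (Complex.hasSum_conj'.2 (hf.2 θ))
    have h2 := (Equiv.neg ℤ).hasSum_iff.2 h1
    convert h2 using 2 with n
    simp only [Function.comp_apply, Equiv.neg_apply, map_mul, expMono, ← Complex.exp_conj]
    simp

theorem hasFourier_expMono (k : ℤ) : HasFourier (Pi.single k 1) (expMono k) := by
  refine ⟨?_, fun θ => ?_⟩
  · refine summable_of_ne_finset_zero (s := {k}) fun n hn => ?_
    simp at hn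
    simp [hn]
  · convert hasSum_ite_eq k (expMono k θ) using 2 with n
    by_cases h : n = k
    · subst h; simp
    · simp [h]

theorem HasFourier.norm_coeff_le {β : ℤ → ℂ} {f : ℝ → ℂ} (hf : HasFourier β f) {C : ℝ}
    (hC : ∀ θ, ‖f θ‖ ≤ C) (n : ℤ) : ‖β n‖ ≤ C := by
  rw [← hf.fourierCoeffOn_eq, fourierCoeffOn_two_pi, norm_smul]
  have h1 : ‖∫ θ in (0 : ℝ)..2 * Real.pi, expMono (-n) θ * f θ‖ ≤ C * |2 * Real.pi - 0| := by
    refine intervalIntegral.norm_integral_le_of_norm_le_const fun θ _ => ?_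
    rw [norm_mul, norm_expMono, one_mul]
    exact hC θ
  have hpi := Real.two_pi_pos
  rw [sub_zero, abs_of_pos hpi] at h1
  rw [Real.norm_of_nonneg (by positivity)]
  calc 1 / (2 * Real.pi) * _ ≤ 1 / (2 * Real.pi) * (C * (2 * Real.pi)) := by gcongr
    _ = C := by field_simp


/-! ### Weighted sequence norms -/

/-- The `ℓ^p` norm of a sequence of extended nonnegative numbers. -/
def seqLp (p : ℝ) (f : ℤ → ℝ≥0∞) : ℝ≥0∞ := (∑' n, f n ^ p) ^ (1 / p)

theorem seqLp_mono {p : ℝ} (hp : 1 ≤ p) {f g : ℤ → ℝ≥0∞} (h : ∀ n, f n ≤ g n) :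
    seqLp p f ≤ seqLp p g := by
  have hp0 : 0 ≤ p := by linarith
  exact ENNReal.rpow_le_rpow (ENNReal.tsum_le_tsum fun n => ENNReal.rpow_le_rpow (h n) hp0)
    (by positivity)

theorem seqLp_add_le {p : ℝ} (hp : 1 ≤ p) (f g : ℤ → ℝ≥0∞) :
    seqLp p (fun n => f n + g n) ≤ seqLp p f + seqLp p g := by
  have := ENNReal.lintegral_Lp_add_le (μ := Measure.count) (f := f) (g := g)
    (measurable_of_countable f).aemeasurable (measurable_of_countable g).aemeasurable hp
  simpa only [lintegral_count, Pi.add_apply, seqLp] using this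

theorem seqLp_zero {p : ℝ} (hp : 1 ≤ p) : seqLp p (fun _ => 0) = 0 := by
  have hp0 : 0 < p := by linarith
  simp [seqLp, ENNReal.zero_rpow_of_pos hp0, hp0]

theorem seqLp_const_mul {p : ℝ} (hp : 1 ≤ p) (c : ℝ≥0∞) (f : ℤ → ℝ≥0∞) :
    seqLp p (fun n => c * f n) = c * seqLp p f := by
  have hp0 : 0 < p := by linarith
  simp only [seqLp, ENNReal.mul_rpow_of_nonneg _ _ hp0.le, ENNReal.tsum_mul_left]
  rw [ENNReal.mul_rpow_of_nonneg _ _ (by positivity), ← ENNReal.rpow_mul, mul_one_div_cancel hp0.ne',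
    ENNReal.rpow_one]

theorem seqLp_sum_le {p : ℝ} (hp : 1 ≤ p) {ι : Type*} (s : Finset ι) (f : ι → ℤ → ℝ≥0∞) :
    seqLp p (fun n => ∑ i ∈ s, f i n) ≤ ∑ i ∈ s, seqLp p (f i) := by
  classical
  induction s using Finset.induction_on with
  | empty => simp [seqLp_zero hp]
  | insert a s ha ih =>
    simp only [Finset.sum_insert ha]
    exact (seqLp_add_le hp _ _).trans (by gcongr)

/-- Minkowski for infinitely many summands: on each finite set of indices `n` the finite inequality
passes to the limit. -/
theorem seqLp_tsum_le {p : ℝ} (hp : 1 ≤ p) {ι : Type*} (f : ι → ℤ → ℝ≥0∞) :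
    seqLp p (fun n => ∑' i, f i n) ≤ ∑' i, seqLp p (f i) := by
  have hp0 : 0 < p := by linarith
  set c := ∑' i, seqLp p (f i)
  suffices h : ∑' n, (∑' i, f i n) ^ p ≤ c ^ p by
    have := ENNReal.rpow_le_rpow h (z := 1 / p) (by positivity)
    rwa [← ENNReal.rpow_mul, mul_one_div_cancel hp0.ne', ENNReal.rpow_one] at this
  rw [ENNReal.tsum_eq_iSup_sum]
  refine iSup_le fun t => ?_
  have hlim : Tendsto (fun s : Finset ι => ∑ n ∈ t, (∑ i ∈ s, f i n) ^ p) atTop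
      (𝓝 (∑ n ∈ t, (∑' i, f i n) ^ p)) :=
    tendsto_finsetSum _ fun n _ =>
      ((ENNReal.continuous_rpow_const (y := p)).tendsto _).comp ENNReal.summable.hasSum
  refine le_of_tendsto' hlim fun s => ?_
  calc ∑ n ∈ t, (∑ i ∈ s, f i n) ^ p ≤ ∑' n, (∑ i ∈ s, f i n) ^ p := ENNReal.sum_le_tsum t
    _ = (seqLp p fun n => ∑ i ∈ s, f i n) ^ p := by
        rw [seqLp, ← ENNReal.rpow_mul, one_div_mul_cancel hp0.ne', ENNReal.rpow_one]
    _ ≤ c ^ p := by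
        gcongr
        exact (seqLp_sum_le hp s f).trans (ENNReal.sum_le_tsum s)

theorem seqLp_one (f : ℤ → ℝ≥0∞) : seqLp 1 f = ∑' n, f n := by simp [seqLp]

theorem seqLp_shift (p : ℝ) (f : ℤ → ℝ≥0∞) (k : ℤ) : seqLp p (fun n => f (n - k)) = seqLp p f := by
  simp only [seqLp]
  congr 1
  exact (Equiv.subRight k).tsum_eq fun n => f n ^ p

/-- Young's inequality: the convolution is a superposition of translates of `g` with weights `f k`,
and translates have the same norm. -/
theorem seqLp_conv_le {p : ℝ} (hp : 1 ≤ p) (f g : ℤ → ℝ≥0∞) :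
    seqLp p (fun n => ∑' k, f k * g (n - k)) ≤ seqLp 1 f * seqLp p g := by
  refine (seqLp_tsum_le hp _).trans ?_
  simp only [seqLp_const_mul hp, seqLp_shift, ENNReal.tsum_mul_right, seqLp_one, le_refl]

theorem seqLp_conv_le' {p : ℝ} (hp : 1 ≤ p) (f g : ℤ → ℝ≥0∞) :
    seqLp p (fun n => ∑' k, f k * g (n - k)) ≤ seqLp p f * seqLp 1 g := by
  have : ∀ n, ∑' k, f k * g (n - k) = ∑' k, g k * f (n - k) := by
    intro n
    rw [← (Equiv.subLeft n).tsum_eq]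
    refine tsum_congr fun k => ?_
    simp [mul_comm]
  simp only [this]
  rw [mul_comm]
  exact seqLp_conv_le hp g f

theorem seqLp_tail {p : ℝ} (hp : 1 ≤ p) {f : ℤ → ℝ≥0∞} (hf : seqLp p f ≠ ⊤) {ε : ℝ≥0∞}
    (hε : ε ≠ 0) : ∃ D₀ : ℕ, ∀ D : ℕ, D₀ ≤ D →
      seqLp p (fun n => if |n| ≤ (D : ℤ) then 0 else f n) ≤ ε := by
  have hp0 : 0 < p := by linarith
  have hfin : ∑' n, f n ^ p ≠ ⊤ := by
    intro h
    rw [seqLp, h, ENNReal.top_rpow_of_pos (by positivity)] at hf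
    exact hf rfl
  have h1 := ENNReal.tendsto_tsum_compl_atTop_zero hfin
  have h2 := (ENNReal.continuous_rpow_const (y := 1 / p)).tendsto 0 |>.comp h1
  rw [ENNReal.zero_rpow_of_pos (by positivity)] at h2
  obtain ⟨s, hs⟩ := (h2.eventually (ge_mem_nhds (pos_iff_ne_zero.2 hε))).exists
  refine ⟨s.sup Int.natAbs, fun D hD => le_trans ?_ hs⟩
  simp only [seqLp, Function.comp_apply]
  refine ENNReal.rpow_le_rpow ?_ (by positivity)
  have hout : ∀ n, n ∈ s → (if |n| ≤ (D : ℤ) then 0 else f n) ^ p = 0 := by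
    intro n hn
    have : |n| ≤ (D : ℤ) := by
      have : n.natAbs ≤ D := (Finset.le_sup (f := Int.natAbs) hn).trans hD
      rw [Int.abs_eq_natAbs]
      exact_mod_cast this
    simp [this, ENNReal.zero_rpow_of_pos hp0]
  rw [← Function.Injective.tsum_eq (g := ((↑) : {x // x ∉ s} → ℤ)) Subtype.val_injective]
  · refine ENNReal.tsum_le_tsum fun n => ?_
    split_ifs
    · simp [ENNReal.zero_rpow_of_pos hp0]
    · exact le_rfl
  · intro n hn
    exact ⟨⟨n, fun h => hn (hout n h)⟩, rfl⟩

/-- A submultiplicative complete norm on two-sided sequences, finite exactly on `Ahat`. -/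
structure IsAlgNorm (Ahat : Set (ℤ → ℂ)) (N : (ℤ → ℂ) → ℝ≥0∞) : Prop where
  mem_iff : ∀ β, β ∈ Ahat ↔ N β ≠ ⊤
  l1_le : ∀ β, ∑' n, ‖β n‖ₑ ≤ N β
  -- One clause yields monotonicity in the moduli, the triangle inequality and countable
  -- subadditivity.
  le_tsum : ∀ {ι : Type} (β : ℤ → ℂ) (γ : ι → ℤ → ℂ), (∀ n, ‖β n‖ₑ ≤ ∑' i, ‖γ i n‖ₑ) →
    N β ≤ ∑' i, N (γ i)
  conv_le : ∀ β γ, N (conv β γ) ≤ N β * N γ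
  smul_le : ∀ (c : ℂ) β, N (fun n => c * β n) ≤ ‖c‖ₑ * N β
  neg_le : ∀ β, N (fun n => β (-n)) ≤ N β
  -- Polynomial growth on exponentials brings smooth functions into the algebra, and the next clause
  -- makes trigonometric polynomials dense.
  single_le : ∃ C d : ℕ, ∀ k : ℤ, N (Pi.single k 1) ≤ C * (1 + k.natAbs : ℕ) ^ d
  tail_le : ∀ β, N β ≠ ⊤ → ∀ ε : ℝ≥0∞, ε ≠ 0 → ∃ D : ℕ,
    N (fun n => if |n| ≤ (D : ℤ) then 0 else β n) ≤ ε

/-- The weight `|n|^σ`. -/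
def seqWeight (σ : ℝ) (n : ℤ) : ℝ≥0∞ := (n.natAbs : ℝ≥0∞) ^ σ

/-- The norm `2^σ (‖β‖_{ℓ¹} + ‖|n|^σ β‖_{ℓ^p})`. -/
def weightedNorm (p σ : ℝ) (β : ℤ → ℂ) : ℝ≥0∞ :=
  2 ^ σ * (seqLp 1 (fun n => ‖β n‖ₑ) + seqLp p (fun n => seqWeight σ n * ‖β n‖ₑ))

/-- The larger of `|k|` and `|n - k|` is at least `|n| / 2`. -/
theorem seqWeight_add_le {σ : ℝ} (hσ : 0 ≤ σ) (k n : ℤ) :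
    seqWeight σ n ≤ 2 ^ σ * (seqWeight σ k + seqWeight σ (n - k)) := by
  have h1 : (n.natAbs : ℝ≥0∞) ≤ 2 * max (k.natAbs : ℝ≥0∞) ((n - k).natAbs : ℝ≥0∞) := by
    have : n.natAbs ≤ 2 * max k.natAbs (n - k).natAbs := by omega
    rw [← Nat.mono_cast.map_max]
    exact_mod_cast this
  calc seqWeight σ n ≤ (2 * max (k.natAbs : ℝ≥0∞) ((n - k).natAbs : ℝ≥0∞)) ^ σ :=
        ENNReal.rpow_le_rpow h1 hσ
    _ = 2 ^ σ * (max (k.natAbs : ℝ≥0∞) ((n - k).natAbs : ℝ≥0∞)) ^ σ :=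
        ENNReal.mul_rpow_of_nonneg _ _ hσ
    _ ≤ 2 ^ σ * (seqWeight σ k + seqWeight σ (n - k)) := by
        gcongr
        rcases le_total (k.natAbs : ℝ≥0∞) ((n - k).natAbs : ℝ≥0∞) with h | h
        · rw [max_eq_right h]; exact le_add_self
        · rw [max_eq_left h]; exact le_self_add

theorem enorm_conv_le (β γ : ℤ → ℂ) (n : ℤ) :
    ‖conv β γ n‖ₑ ≤ ∑' k, ‖β k‖ₑ * ‖γ (n - k)‖ₑ := by
  simp only [← enorm_mul]
  exact enorm_tsum_le_tsum_enorm

theorem one_le_two_rpow {σ : ℝ} (hσ : 0 ≤ σ) : (1 : ℝ≥0∞) ≤ 2 ^ σ := by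
  simpa using ENNReal.rpow_le_rpow (one_le_two : (1 : ℝ≥0∞) ≤ 2) hσ

/-- The weight at `n` is shared between the weights at `k` and `n - k`, and Young's inequality
treats each product with the unweighted factor in `ℓ¹`. The prefactor `2 ^ σ` in the norm absorbs
the constant, so submultiplicativity holds with constant one. -/
theorem weightedNorm_conv_le {p σ : ℝ} (hp : 1 ≤ p) (hσ : 0 ≤ σ) (β γ : ℤ → ℂ) :
    weightedNorm p σ (conv β γ) ≤ weightedNorm p σ β * weightedNorm p σ γ := by
  set B := fun n => ‖β n‖ₑ
  set G := fun n => ‖γ n‖ₑ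
  set K : ℝ≥0∞ := 2 ^ σ
  have h1 : seqLp 1 (fun n => ‖conv β γ n‖ₑ) ≤ seqLp 1 B * seqLp 1 G :=
    (seqLp_mono le_rfl (enorm_conv_le β γ)).trans (seqLp_conv_le le_rfl B G)
  have h2 : seqLp p (fun n => seqWeight σ n * ‖conv β γ n‖ₑ) ≤
      K * (seqLp p (fun n => seqWeight σ n * B n) * seqLp 1 G +
        seqLp 1 B * seqLp p (fun n => seqWeight σ n * G n)) := by
    have hpt : ∀ n, seqWeight σ n * ‖conv β γ n‖ₑ ≤
        K * (∑' k, (seqWeight σ k * B k) * G (n - k) +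
          ∑' k, B k * (seqWeight σ (n - k) * G (n - k))) := by
      intro n
      calc seqWeight σ n * ‖conv β γ n‖ₑ ≤ seqWeight σ n * ∑' k, B k * G (n - k) := by
            gcongr; exact enorm_conv_le β γ n
        _ = ∑' k, seqWeight σ n * (B k * G (n - k)) := ENNReal.tsum_mul_left.symm
        _ ≤ ∑' k, K * ((seqWeight σ k * B k) * G (n - k) +
              B k * (seqWeight σ (n - k) * G (n - k))) := by
            refine ENNReal.tsum_le_tsum fun k => ?_
            calc seqWeight σ n * (B k * G (n - k))
                ≤ (K * (seqWeight σ k + seqWeight σ (n - k))) * (B k * G (n - k)) := by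
                  gcongr; exact seqWeight_add_le hσ k n
              _ = _ := by ring
        _ = _ := by rw [ENNReal.tsum_mul_left, ENNReal.tsum_add]
    refine (seqLp_mono hp hpt).trans ?_
    rw [seqLp_const_mul hp]
    gcongr
    refine (seqLp_add_le hp _ _).trans ?_
    gcongr
    · exact seqLp_conv_le' hp (fun n => seqWeight σ n * B n) G
    · exact seqLp_conv_le hp B (fun n => seqWeight σ n * G n)
  have hK : 1 ≤ K := one_le_two_rpow hσ
  simp only [weightedNorm]
  set a := seqLp 1 B
  set b := seqLp 1 G
  set a' := seqLp p (fun n => seqWeight σ n * B n)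
  set b' := seqLp p (fun n => seqWeight σ n * G n)
  calc K * (_ + _) ≤ K * (a * b + K * (a' * b + a * b')) := by gcongr
    -- Adding the missing term `a' * b'` completes the product of the two norms.
    _ ≤ K * (K * (a * b) + K * (a' * b + a * b' + a' * b')) := by
        refine mul_le_mul_right (add_le_add (le_mul_of_one_le_left' hK) ?_) K
        exact mul_le_mul_right le_self_add K
    _ = K * (a + a') * (K * (b + b')) := by ring

theorem two_rpow_ne_top {σ : ℝ} (hσ : 0 ≤ σ) : (2 : ℝ≥0∞) ^ σ ≠ ⊤ :=
  ENNReal.rpow_ne_top_of_nonneg hσ (by simp)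

theorem seqLp_single {p : ℝ} (hp : 1 ≤ p) (k : ℤ) (c : ℤ → ℝ≥0∞) :
    seqLp p (fun n => c n * ‖(Pi.single k 1 : ℤ → ℂ) n‖ₑ) = c k := by
  have hp0 : 0 < p := by linarith
  rw [seqLp, tsum_eq_single k]
  · simp [← ENNReal.rpow_mul, hp0.ne']
  · intro n hn
    simp [hn, hp0]

theorem isAlgNorm_weightedNorm {p σ : ℝ} (hp : 1 ≤ p) (hσ : 0 ≤ σ) (Ahat : Set (ℤ → ℂ))
    (hmem : ∀ β, β ∈ Ahat ↔ seqLp 1 (fun n => ‖β n‖ₑ) ≠ ⊤ ∧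
      seqLp p (fun n => seqWeight σ n * ‖β n‖ₑ) ≠ ⊤) : IsAlgNorm Ahat (weightedNorm p σ) where
  mem_iff β := by
    rw [hmem, weightedNorm]
    have h2 : (2 : ℝ≥0∞) ^ σ ≠ 0 := (lt_of_lt_of_le zero_lt_one (one_le_two_rpow hσ)).ne'
    simp [ENNReal.mul_eq_top, h2, two_rpow_ne_top hσ]
  l1_le β := by
    rw [← seqLp_one]
    exact le_self_add.trans (le_mul_of_one_le_left' (one_le_two_rpow hσ))
  le_tsum β γ h := by
    simp only [weightedNorm]
    rw [ENNReal.tsum_mul_left, ENNReal.tsum_add]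
    gcongr
    · exact (seqLp_mono le_rfl h).trans (seqLp_tsum_le le_rfl _)
    · refine (seqLp_mono hp fun n => ?_).trans (seqLp_tsum_le hp _)
      rw [ENNReal.tsum_mul_left]
      gcongr
      exact h n
  conv_le := weightedNorm_conv_le hp hσ
  smul_le c β := by
    have : ∀ n, seqWeight σ n * (‖c‖ₑ * ‖β n‖ₑ) = ‖c‖ₑ * (seqWeight σ n * ‖β n‖ₑ) :=
      fun n => by ring
    simp only [weightedNorm, enorm_mul, this]
    rw [seqLp_const_mul le_rfl, seqLp_const_mul hp]
    exact le_of_eq (by ring)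
  neg_le β := by
    refine le_of_eq ?_
    simp only [weightedNorm, seqLp]
    congr 3
    · exact (Equiv.neg ℤ).tsum_eq fun n => ‖β n‖ₑ ^ (1 : ℝ)
    · rw [← (Equiv.neg ℤ).tsum_eq fun n => (seqWeight σ n * ‖β n‖ₑ) ^ p]
      simp [seqWeight]
  single_le := by
    have h2 := two_rpow_ne_top hσ
    obtain ⟨C, hC⟩ := ENNReal.exists_nat_gt h2
    refine ⟨2 * C, ⌈σ⌉₊, fun k => ?_⟩
    have e1 := seqLp_single le_rfl k (fun _ => 1)
    simp only [one_mul] at e1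
    rw [weightedNorm, seqLp_single hp, e1]
    have h3 : (1 : ℝ≥0∞) ≤ ((1 + k.natAbs : ℕ) : ℝ≥0∞) ^ ⌈σ⌉₊ :=
      one_le_pow₀ (by norm_cast; omega)
    have h4 : seqWeight σ k ≤ ((1 + k.natAbs : ℕ) : ℝ≥0∞) ^ ⌈σ⌉₊ := by
      rw [seqWeight, ← ENNReal.rpow_natCast]
      calc (k.natAbs : ℝ≥0∞) ^ σ ≤ ((1 + k.natAbs : ℕ) : ℝ≥0∞) ^ σ := by
            refine ENNReal.rpow_le_rpow ?_ hσ
            norm_cast; omega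
        _ ≤ _ := by
            refine ENNReal.rpow_le_rpow_of_exponent_le ?_ (Nat.le_ceil σ)
            norm_cast; omega
    calc (2 : ℝ≥0∞) ^ σ * (1 + seqWeight σ k)
        ≤ C * (((1 + k.natAbs : ℕ) : ℝ≥0∞) ^ ⌈σ⌉₊ + ((1 + k.natAbs : ℕ) : ℝ≥0∞) ^ ⌈σ⌉₊) := by
          gcongr
      _ = _ := by push_cast; ring
  tail_le β hβ ε hε := by
    have h2 := two_rpow_ne_top hσ
    have h2' : (2 : ℝ≥0∞) ^ σ ≠ 0 := (lt_of_lt_of_le zero_lt_one (one_le_two_rpow hσ)).ne'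
    obtain ⟨h3, h4⟩ : seqLp 1 (fun n => ‖β n‖ₑ) ≠ ⊤ ∧
        seqLp p (fun n => seqWeight σ n * ‖β n‖ₑ) ≠ ⊤ := by
      rw [weightedNorm] at hβ
      simpa [ENNReal.mul_eq_top, h2, h2'] using hβ
    have hε' : ε / 2 ^ σ / 2 ≠ 0 := by simp [hε, h2]
    obtain ⟨D₁, hD₁⟩ := seqLp_tail le_rfl h3 hε'
    obtain ⟨D₂, hD₂⟩ := seqLp_tail hp h4 hε'
    refine ⟨max D₁ D₂, ?_⟩
    have e1 := hD₁ _ (le_max_left D₁ D₂)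
    have e2 := hD₂ _ (le_max_right D₁ D₂)
    simp only [weightedNorm, apply_ite (fun x : ℂ => ‖x‖ₑ), enorm_zero, mul_ite, mul_zero]
    calc _ ≤ (2 : ℝ≥0∞) ^ σ * (ε / 2 ^ σ / 2 + ε / 2 ^ σ / 2) := by gcongr
      _ = ε := by rw [ENNReal.add_halves, ENNReal.mul_div_cancel h2' h2]

theorem summable_iff_tsum_enorm_ne_top {f : ℤ → ℝ} (hf : ∀ n, 0 ≤ f n) :
    Summable f ↔ ∑' n, ENNReal.ofReal (f n) ≠ ⊤ := by
  constructor
  · intro h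
    rw [← ENNReal.ofReal_tsum_of_nonneg hf h]
    exact ENNReal.ofReal_ne_top
  · intro h
    have := ENNReal.summable_toReal h
    simpa [ENNReal.toReal_ofReal, hf] using this

theorem ofReal_weight {p σ : ℝ} (hp : 0 < p) (hσ : 0 ≤ σ) (n : ℤ) (c : ℂ) :
    ENNReal.ofReal (|(n : ℝ)| ^ (σ * p) * ‖c‖ ^ p) = (seqWeight σ n * ‖c‖ₑ) ^ p := by
  have h : (n.natAbs : ℝ≥0∞) = ENNReal.ofReal |(n : ℝ)| := by
    rw [← ENNReal.ofReal_natCast]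
    congr 1
    rw [Nat.cast_natAbs, Int.cast_abs]
  rw [seqWeight, h, ← ofReal_norm, ENNReal.ofReal_rpow_of_nonneg (abs_nonneg _) hσ,
    ← ENNReal.ofReal_mul (by positivity), ENNReal.ofReal_rpow_of_nonneg (by positivity) hp.le,
    Real.mul_rpow (by positivity) (by positivity), ← Real.rpow_mul (abs_nonneg _)]

theorem mem_weightedEll_iff {p σ : ℝ} (hp : 1 ≤ p) (hσ : 0 ≤ σ) (β : ℤ → ℂ) :
    β ∈ weightedEll p (σ * p) ↔ seqLp p (fun n => seqWeight σ n * ‖β n‖ₑ) ≠ ⊤ := by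
  have hp0 : 0 < p := by linarith
  rw [weightedEll, Set.mem_ofPred_eq, summable_iff_tsum_enorm_ne_top (fun n => by positivity)]
  simp only [ofReal_weight hp0 hσ, seqLp]
  simp [ENNReal.rpow_eq_top_iff, hp0, hp0.le]

theorem mem_weightedEll_one_zero_iff (β : ℤ → ℂ) :
    β ∈ weightedEll 1 0 ↔ seqLp 1 (fun n => ‖β n‖ₑ) ≠ ⊤ := by
  have := mem_weightedEll_iff le_rfl le_rfl (p := 1) (σ := 0) β
  simpa [seqWeight] using this

theorem IsAdmissibleAlgebra.exists_isAlgNorm {Ahat : Set (ℤ → ℂ)} (h : IsAdmissibleAlgebra Ahat) :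
    ∃ N, IsAlgNorm Ahat N := by
  rcases h with rfl | ⟨s, hs, rfl⟩
  -- `|n| |β n|² = (|n|^(1/2) |β n|)²`, hence `σ = 1/2` with `p = 2`.
  · refine ⟨_, isAlgNorm_weightedNorm (p := 2) (σ := 1 / 2) (by norm_num) (by norm_num) _
      fun β => ?_⟩
    rw [mem_inter_iff, mem_weightedEll_one_zero_iff,
      ← mem_weightedEll_iff (by norm_num) (by norm_num)]
    norm_num
    exact and_comm
  · refine ⟨_, isAlgNorm_weightedNorm (p := 1) (σ := s) le_rfl (by linarith) _ fun β => ?_⟩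
    have hw := mem_weightedEll_iff le_rfl (by linarith : 0 ≤ s) β
    rw [mul_one] at hw
    rw [← hw]
    refine ⟨fun h => ⟨?_, h⟩, fun h => h.2⟩
    rw [← mem_weightedEll_one_zero_iff]
    rw [weightedEll, Set.mem_ofPred_eq] at h ⊢
    -- The weight vanishes at `n = 0` and is at least one elsewhere, so the weighted sum controls
    -- the plain `ℓ¹` sum only after this index is removed.
    rw [← (Set.finite_singleton (0 : ℤ)).summable_compl_iff] at h ⊢
    refine Summable.of_nonneg_of_le (fun n => mul_nonneg (Real.rpow_nonneg (abs_nonneg _) _)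
      (Real.rpow_nonneg (norm_nonneg _) _)) (fun n => ?_) h
    have hn : (n : ℤ) ≠ 0 := n.2
    have h1 : (1 : ℝ) ≤ |((n : ℤ) : ℝ)| := by exact_mod_cast Int.one_le_abs hn
    rw [Function.comp_apply, Function.comp_apply, Real.rpow_zero]
    gcongr
    exact Real.one_le_rpow h1 (by linarith)


/-! ### The algebra of functions -/

/-- `f` is the sum of a Fourier series whose coefficients have `N`-norm at most `c`. -/
def AlgBound (N : (ℤ → ℂ) → ℝ≥0∞) (f : ℝ → ℂ) (c : ℝ≥0∞) : Prop :=
  ∃ β, HasFourier β f ∧ N β ≤ c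

namespace IsAlgNorm

variable {Ahat : Set (ℤ → ℂ)} {N : (ℤ → ℂ) → ℝ≥0∞}

theorem mono (hN : IsAlgNorm Ahat N) {β γ : ℤ → ℂ} (h : ∀ n, ‖β n‖ₑ ≤ ‖γ n‖ₑ) : N β ≤ N γ := by
  have := hN.le_tsum β (fun _ : Unit => γ) (fun n => by simpa using h n)
  simpa using this

theorem add_le (hN : IsAlgNorm Ahat N) (β γ : ℤ → ℂ) : N (β + γ) ≤ N β + N γ := by
  have := hN.le_tsum (β + γ) (fun b : Bool => if b then β else γ) (fun n => by
    simpa [tsum_bool, add_comm] using enorm_add_le (β n) (γ n))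
  simpa [tsum_bool, add_comm] using this

theorem summable_norm (hN : IsAlgNorm Ahat N) {β : ℤ → ℂ} (h : N β ≠ ⊤) :
    Summable fun n => ‖β n‖ := by
  have h1 : ∑' n, ‖β n‖ₑ ≠ ⊤ := ne_top_of_le_ne_top h (hN.l1_le β)
  rw [summable_iff_tsum_enorm_ne_top (fun n => norm_nonneg _)]
  simpa only [ofReal_norm] using h1

theorem inAlg_iff (hN : IsAlgNorm Ahat N) (f : ℝ → ℂ) :
    InAlg Ahat f ↔ ∃ c, c ≠ ⊤ ∧ AlgBound N f c := by
  constructor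
  · rintro ⟨h1, h2, h3⟩
    have h4 := (hN.mem_iff _).1 h3
    exact ⟨_, h4, _, hasFourier_of_summable h1 h2 (hN.summable_norm h4), le_rfl⟩
  · rintro ⟨c, hc, β, hβ, hle⟩
    refine ⟨hβ.continuous, hβ.periodic, ?_⟩
    rw [hβ.fourierCoeffOn_eq, hN.mem_iff]
    exact ne_top_of_le_ne_top hc hle

theorem hasFourier_of_inAlg (hN : IsAlgNorm Ahat N) {f : ℝ → ℂ} (h : InAlg Ahat f) :
    HasFourier (fourierCoeffOn Real.two_pi_pos f) f :=
  hasFourier_of_summable h.1 h.2.1 (hN.summable_norm ((hN.mem_iff _).1 h.2.2))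

theorem algBound_add (hN : IsAlgNorm Ahat N) {f g : ℝ → ℂ} {c d : ℝ≥0∞} (hf : AlgBound N f c)
    (hg : AlgBound N g d) : AlgBound N (fun θ => f θ + g θ) (c + d) := by
  obtain ⟨β, hβ, h1⟩ := hf
  obtain ⟨γ, hγ, h2⟩ := hg
  exact ⟨_, hβ.add hγ, (hN.add_le β γ).trans (add_le_add h1 h2)⟩

theorem algBound_mul (hN : IsAlgNorm Ahat N) {f g : ℝ → ℂ} {c d : ℝ≥0∞} (hf : AlgBound N f c)
    (hg : AlgBound N g d) : AlgBound N (fun θ => f θ * g θ) (c * d) := by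
  obtain ⟨β, hβ, h1⟩ := hf
  obtain ⟨γ, hγ, h2⟩ := hg
  exact ⟨_, hβ.mul hγ, (hN.conv_le β γ).trans (mul_le_mul' h1 h2)⟩

theorem algBound_const_mul (hN : IsAlgNorm Ahat N) {f : ℝ → ℂ} {c : ℝ≥0∞} (a : ℂ)
    (hf : AlgBound N f c) : AlgBound N (fun θ => a * f θ) (‖a‖ₑ * c) := by
  obtain ⟨β, hβ, h1⟩ := hf
  exact ⟨_, hβ.const_mul a, (hN.smul_le a β).trans (by gcongr)⟩

theorem algBound_sum (hN : IsAlgNorm Ahat N) {ι : Type} (s : Finset ι) {f : ι → ℝ → ℂ}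
    {c : ι → ℝ≥0∞} (hf : ∀ i ∈ s, AlgBound N (f i) (c i)) :
    AlgBound N (fun θ => ∑ i ∈ s, f i θ) (∑ i ∈ s, c i) := by
  classical
  induction s using Finset.induction_on with
  | empty =>
    refine ⟨fun _ => 0, ⟨by simp, fun θ => by simp⟩, ?_⟩
    simpa using hN.le_tsum (fun _ => 0) (fun (i : Empty) => i.elim) (by simp)
  | insert a s ha ih =>
    simp only [Finset.sum_insert ha]
    exact hN.algBound_add (hf a (Finset.mem_insert_self a s))
      (ih fun i hi => hf i (Finset.mem_insert_of_mem hi))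

theorem single_zero_ne_top (hN : IsAlgNorm Ahat N) : N (Pi.single 0 1) ≠ ⊤ := by
  obtain ⟨C, d, h⟩ := hN.single_le
  refine ne_top_of_le_ne_top ?_ (h 0)
  simp

/-- The factor `N (Pi.single 0 1)` is needed because the unit of the algebra need not have norm one.
-/
theorem algBound_pow (hN : IsAlgNorm Ahat N) {f : ℝ → ℂ} {c : ℝ≥0∞} (hf : AlgBound N f c) (n : ℕ) :
    AlgBound N (fun θ => f θ ^ n) (N (Pi.single 0 1) * c ^ n) := by
  induction n with
  | zero =>
    have : (fun θ => f θ ^ 0) = expMono 0 := by funext θ; simp [expMono_zero]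
    rw [this]
    exact ⟨_, hasFourier_expMono 0, by simp⟩
  | succ n ih =>
    have := hN.algBound_mul ih hf
    simpa only [pow_succ, mul_assoc] using this

/-- The norm dominates the `ℓ¹` norm, so the double series over terms and frequencies converges
absolutely and may be summed over the terms first. -/
theorem algBound_tsum (hN : IsAlgNorm Ahat N) {f : ℕ → ℝ → ℂ} {c : ℕ → ℝ≥0∞}
    (hf : ∀ j, AlgBound N (f j) (c j)) (hc : ∑' j, c j ≠ ⊤) {g : ℝ → ℂ}
    (hg : ∀ θ, HasSum (fun j => f j θ) (g θ)) : AlgBound N g (∑' j, c j) := by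
  choose β hβ hle using hf
  have htot : ∑' j, ∑' n, ‖β j n‖ₑ ≠ ⊤ :=
    ne_top_of_le_ne_top hc (ENNReal.tsum_le_tsum fun j => (hN.l1_le _).trans (hle j))
  have hsum : Summable fun p : ℤ × ℕ => ‖β p.2 p.1‖ := by
    have h1 : ∑' p : ℤ × ℕ, ‖β p.2 p.1‖ₑ ≠ ⊤ := by
      rw [ENNReal.tsum_prod', ENNReal.tsum_comm]; exact htot
    have := ENNReal.summable_toReal h1
    simpa using this
  refine ⟨fun n => ∑' j, β j n, ⟨?_, fun θ => ?_⟩, ?_⟩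
  · exact Summable.of_nonneg_of_le (fun n => norm_nonneg _)
      (fun n => norm_tsum_le_tsum_norm (hsum.prod_factor n)) hsum.prod
  · have hs : Summable fun p : ℤ × ℕ => β p.2 p.1 * expMono p.1 θ := by
      refine Summable.of_norm (hsum.congr fun p => ?_)
      rw [norm_mul, norm_expMono, mul_one]
    have h1 := hs.hasSum.prod_fiberwise fun n =>
      ((hsum.prod_factor n).of_norm.hasSum.mul_right (expMono n θ))
    have h2 := ((Equiv.prodComm ℕ ℤ).hasSum_iff.2 hs.hasSum).prod_fiberwise fun j => (hβ j).2 θ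
    rwa [← (hg θ).unique h2] at h1
  · refine (hN.le_tsum _ β fun n => enorm_tsum_le_tsum_enorm).trans ?_
    exact ENNReal.tsum_le_tsum hle

end IsAlgNorm

section Closure

variable {Ahat : Set (ℤ → ℂ)} {N : (ℤ → ℂ) → ℝ≥0∞}

theorem InAlg.add (hN : IsAlgNorm Ahat N) {f g : ℝ → ℂ} (hf : InAlg Ahat f) (hg : InAlg Ahat g) :
    InAlg Ahat fun θ => f θ + g θ := by
  rw [hN.inAlg_iff] at *
  obtain ⟨c, hc, h1⟩ := hf
  obtain ⟨d, hd, h2⟩ := hg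
  exact ⟨_, ENNReal.add_ne_top.2 ⟨hc, hd⟩, hN.algBound_add h1 h2⟩

theorem InAlg.mul (hN : IsAlgNorm Ahat N) {f g : ℝ → ℂ} (hf : InAlg Ahat f) (hg : InAlg Ahat g) :
    InAlg Ahat fun θ => f θ * g θ := by
  rw [hN.inAlg_iff] at *
  obtain ⟨c, hc, h1⟩ := hf
  obtain ⟨d, hd, h2⟩ := hg
  exact ⟨_, ENNReal.mul_ne_top hc hd, hN.algBound_mul h1 h2⟩

theorem InAlg.const_mul (hN : IsAlgNorm Ahat N) {f : ℝ → ℂ} (a : ℂ) (hf : InAlg Ahat f) :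
    InAlg Ahat fun θ => a * f θ := by
  rw [hN.inAlg_iff] at *
  obtain ⟨c, hc, h1⟩ := hf
  exact ⟨_, ENNReal.mul_ne_top (by simp) hc, hN.algBound_const_mul a h1⟩

theorem InAlg.sum (hN : IsAlgNorm Ahat N) {ι : Type} (s : Finset ι) {f : ι → ℝ → ℂ}
    (hf : ∀ i ∈ s, InAlg Ahat (f i)) : InAlg Ahat fun θ => ∑ i ∈ s, f i θ := by
  classical
  simp only [hN.inAlg_iff] at *
  choose! c hc h1 using hf
  exact ⟨_, by simpa [ENNReal.sum_eq_top] using hc, hN.algBound_sum s h1⟩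

theorem InAlg.conj (hN : IsAlgNorm Ahat N) {f : ℝ → ℂ} (hf : InAlg Ahat f) :
    InAlg Ahat fun θ => starRingEnd ℂ (f θ) := by
  rw [hN.inAlg_iff] at *
  obtain ⟨c, hc, β, hβ, h1⟩ := hf
  refine ⟨_, hc, _, hβ.conj, (hN.mono fun n => ?_).trans ((hN.neg_le β).trans h1)⟩
  rw [← ofReal_norm, ← ofReal_norm, RCLike.norm_conj]

theorem InAlg.im (hN : IsAlgNorm Ahat N) {f : ℝ → ℂ} (hf : InAlg Ahat f) :
    InAlg Ahat fun θ => ((f θ).im : ℂ) := by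
  have h := (hf.add hN ((hf.conj hN).const_mul hN (-1))).const_mul hN (1 / (2 * Complex.I))
  convert h using 2 with θ
  rw [Complex.im_eq_sub_conj]
  ring

/-- Solidity of the norm. It is what allows half of a Fourier series to be discarded, although that
projection is unbounded for the supremum norm. -/
theorem InAlg.of_coeff_le (hN : IsAlgNorm Ahat N) {β γ : ℤ → ℂ} {f g : ℝ → ℂ}
    (hf : InAlg Ahat f) (hβ : HasFourier β f) (hγ : HasFourier γ g) {C : ℝ}
    (h : ∀ n, ‖γ n‖ ≤ C * ‖β n‖) : InAlg Ahat g := by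
  have hβN : N β ≠ ⊤ := by
    rw [← hN.mem_iff, ← hβ.fourierCoeffOn_eq]
    exact hf.2.2
  rw [hN.inAlg_iff]
  refine ⟨_, ENNReal.mul_ne_top (by simp) hβN, γ, hγ, (hN.mono fun n => ?_).trans
    (hN.smul_le (C : ℂ) β)⟩
  rw [← ofReal_norm, ← ofReal_norm]
  refine ENNReal.ofReal_le_ofReal ((h n).trans ?_)
  rw [norm_mul, Complex.norm_real]
  gcongr
  exact le_abs_self C

theorem InAlg.exp (hN : IsAlgNorm Ahat N) {f : ℝ → ℂ} (hf : InAlg Ahat f) :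
    InAlg Ahat fun θ => Complex.exp (f θ) := by
  rw [hN.inAlg_iff] at *
  obtain ⟨c, hc, h1⟩ := hf
  lift c to ℝ≥0 using hc
  obtain ⟨a, ha⟩ := WithTop.ne_top_iff_exists.1 hN.single_zero_ne_top
  change (a : ℝ≥0∞) = _ at ha
  have h2 := fun n : ℕ => hN.algBound_const_mul ((n.factorial : ℂ)⁻¹) (hN.algBound_pow h1 n)
  have h3 : ∀ n : ℕ, ‖((n.factorial : ℂ)⁻¹)‖ₑ * (N (Pi.single 0 1) * (c : ℝ≥0∞) ^ n) =
      ((a * (c ^ n / n.factorial) : ℝ≥0) : ℝ≥0∞) := by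
    intro n
    rw [← ha, enorm_eq_nnnorm, nnnorm_inv, Complex.nnnorm_natCast]
    norm_cast
    rw [div_eq_mul_inv]; ring
  simp only [h3] at h2
  refine ⟨_, ?_, hN.algBound_tsum h2 ?_ fun θ => ?_⟩
  · rw [ENNReal.tsum_coe_ne_top_iff_summable]
    exact (NNReal.summable_coe.1 (by simpa using Real.summable_pow_div_factorial c)).mul_left a
  · rw [ENNReal.tsum_coe_ne_top_iff_summable]
    exact (NNReal.summable_coe.1 (by simpa using Real.summable_pow_div_factorial c)).mul_left a
  · rw [Complex.exp_eq_exp_ℂ]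
    have := NormedSpace.expSeries_div_hasSum_exp (f θ)
    simpa only [div_eq_inv_mul] using this

end Closure


/-! ### Smooth functions belong to the algebra -/

theorem norm_fourierCoeffOn_le {f : ℝ → ℂ} (hc : Continuous f) :
    ∃ C, ∀ n, ‖fourierCoeffOn Real.two_pi_pos f n‖ ≤ C := by
  obtain ⟨C, hC⟩ := 
    (isCompact_Icc (a := (0 : ℝ)) (b := 2 * Real.pi)).exists_bound_of_continuousOn hc.continuousOn
  refine ⟨C, fun n => ?_⟩
  have hpi := Real.two_pi_pos
  have h1 : ‖∫ θ in (0 : ℝ)..2 * Real.pi, expMono (-n) θ * f θ‖ ≤ C * |2 * Real.pi - 0| := by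
    refine intervalIntegral.norm_integral_le_of_norm_le_const fun θ hθ => ?_
    rw [norm_mul, norm_expMono, one_mul]
    rw [uIoc_of_le hpi.le] at hθ
    exact hC θ ⟨hθ.1.le, hθ.2⟩
  rw [fourierCoeffOn_two_pi, norm_smul, Real.norm_of_nonneg (by positivity)]
  rw [sub_zero, abs_of_pos hpi] at h1
  calc 1 / (2 * Real.pi) * _ ≤ 1 / (2 * Real.pi) * (C * (2 * Real.pi)) := by gcongr
    _ = C := by field_simp

theorem periodic_deriv {f : ℝ → ℂ} {c : ℝ} (hp : Function.Periodic f c) :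
    Function.Periodic (deriv f) c := by
  intro x
  rw [← deriv_comp_add_const]
  congr 1
  funext y
  exact hp y

theorem fourierCoeffOn_deriv {f : ℝ → ℂ} (hf : ContDiff ℝ ∞ f)
    (hp : Function.Periodic f (2 * Real.pi)) {n : ℤ} (hn : n ≠ 0) :
    fourierCoeffOn Real.two_pi_pos f n =
      1 / (Complex.I * n) * fourierCoeffOn Real.two_pi_pos (deriv f) n := by
  have hd : Continuous (deriv f) := hf.continuous_deriv (by simp)
  rw [fourierCoeffOn_of_hasDerivAt Real.two_pi_pos hn
    (fun x _ => ((hf.differentiable (by simp)) x).hasDerivAt) (hd.intervalIntegrable _ _)]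
  have h0 : f (2 * Real.pi) = f 0 := by simpa using hp 0
  have hπ : (Real.pi : ℂ) ≠ 0 := by exact_mod_cast Real.pi_ne_zero
  have hn' : (n : ℂ) ≠ 0 := by exact_mod_cast hn
  rw [h0]
  push_cast
  field_simp
  ring

theorem fourierCoeffOn_decay (k : ℕ) : ∀ {f : ℝ → ℂ}, ContDiff ℝ ∞ f →
    Function.Periodic f (2 * Real.pi) →
    ∃ C, ∀ n : ℤ, ‖fourierCoeffOn Real.two_pi_pos f n‖ * (1 + n.natAbs : ℕ) ^ k ≤ C := by
  induction k with
  | zero => intro f hf hp; simpa using norm_fourierCoeffOn_le hf.continuous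
  | succ k ih =>
    intro f hf hp
    have hd : ContDiff ℝ ∞ (deriv f) := (contDiff_infty_iff_deriv.1 hf).2
    obtain ⟨C, hC⟩ := ih hd (periodic_deriv hp)
    refine ⟨max ‖fourierCoeffOn Real.two_pi_pos f 0‖ (2 * C), fun n => ?_⟩
    rcases eq_or_ne n 0 with rfl | hn
    · simp
    · refine le_trans ?_ (le_max_right _ _)
      have hn1 : (1 : ℝ) ≤ |(n : ℝ)| := by exact_mod_cast Int.one_le_abs hn
      have hna : ((n.natAbs : ℕ) : ℝ) = |(n : ℝ)| := by rw [Nat.cast_natAbs, Int.cast_abs]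
      rw [fourierCoeffOn_deriv hf hp hn, norm_mul, pow_succ]
      have e1 : ‖1 / (Complex.I * (n : ℂ))‖ * ((1 + n.natAbs : ℕ) : ℝ) ≤ 2 := by
        rw [norm_div, norm_one, norm_mul, Complex.norm_I, one_mul, Complex.norm_intCast]
        push_cast
        rw [hna, div_mul_eq_mul_div, one_mul, div_le_iff₀ (by linarith)]
        linarith
      calc _ = (‖1 / (Complex.I * (n : ℂ))‖ * ((1 + n.natAbs : ℕ) : ℝ)) *
            (‖fourierCoeffOn Real.two_pi_pos (deriv f) n‖ * ((1 + n.natAbs : ℕ) : ℝ) ^ k) := by ring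
        _ ≤ 2 * C := mul_le_mul e1 (hC n) (by positivity) (by norm_num)

theorem summable_one_add_natAbs_inv_sq :
    Summable fun n : ℤ => (((1 + n.natAbs : ℕ) : ℝ) ^ 2)⁻¹ := by
  have h := (summable_nat_add_iff 1).2 (Real.summable_nat_pow_inv.2 (one_lt_two))
  refine Summable.of_nat_of_neg ?_ ?_ <;>
  · refine h.congr fun n => ?_
    simp [add_comm]

/-- The coefficients decay faster than every power, by repeated integration by parts, while the
norms of the exponentials grow at most like a power `d`; two further powers of decay give
summability. -/
theorem IsAlgNorm.smooth {Ahat : Set (ℤ → ℂ)} {N : (ℤ → ℂ) → ℝ≥0∞} (hN : IsAlgNorm Ahat N)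
    {f : ℝ → ℂ} (hf : ContDiff ℝ ∞ f) (hp : Function.Periodic f (2 * Real.pi)) : InAlg Ahat f := by
  obtain ⟨A, d, hA⟩ := hN.single_le
  obtain ⟨C, hC⟩ := fourierCoeffOn_decay (d + 2) hf hp
  refine ⟨hf.continuous, hp, (hN.mem_iff _).2 ?_⟩
  set β := fourierCoeffOn Real.two_pi_pos f
  have h1 : N β ≤ ∑' k, N (fun n => β k * (Pi.single k 1 : ℤ → ℂ) n) := by
    refine hN.le_tsum _ _ fun n => ?_
    refine le_trans (le_of_eq ?_) (ENNReal.le_tsum n)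
    simp
  have h2 : ∀ k : ℤ, N (fun n => β k * (Pi.single k 1 : ℤ → ℂ) n) ≤
      ENNReal.ofReal (A * C * (((1 + k.natAbs : ℕ) : ℝ) ^ 2)⁻¹) := by
    intro k
    refine (hN.smul_le _ _).trans ((mul_le_mul_right (hA k) _).trans ?_)
    rw [← ofReal_norm, ← ENNReal.ofReal_natCast A, ← ENNReal.ofReal_natCast,
      ← ENNReal.ofReal_pow (by positivity), ← ENNReal.ofReal_mul (by positivity),
      ← ENNReal.ofReal_mul (by positivity)]
    refine ENNReal.ofReal_le_ofReal ?_
    have hk := hC k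
    set x : ℝ := ((1 + k.natAbs : ℕ) : ℝ)
    have hx : 0 < x := by positivity
    calc ‖β k‖ * (A * x ^ d) = A * (‖β k‖ * x ^ (d + 2)) * (x ^ 2)⁻¹ := by
          rw [pow_add]; field_simp
      _ ≤ A * C * (x ^ 2)⁻¹ := by gcongr
  refine ne_top_of_le_ne_top ?_ (h1.trans (ENNReal.tsum_le_tsum h2))
  have hC0 : 0 ≤ C := le_trans (by positivity) (hC 0)
  rw [← summable_iff_tsum_enorm_ne_top (fun n => by positivity)]
  exact summable_one_add_natAbs_inv_sq.mul_left _

/-! ### Gluing local membership -/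

theorem InAlg.smooth_mul {Ahat : Set (ℤ → ℂ)} {N : (ℤ → ℂ) → ℝ≥0∞} (hN : IsAlgNorm Ahat N)
    {χ : ℝ → ℝ} (hχ : ContDiff ℝ ∞ χ) (hp : Function.Periodic χ (2 * Real.pi)) {f : ℝ → ℂ}
    (hf : InAlg Ahat f) : InAlg Ahat fun θ => χ θ * f θ :=
  (hN.smooth (f := fun θ => (χ θ : ℂ)) (Complex.ofRealCLM.contDiff.comp hχ)
    (fun θ => by simp only [hp θ])).mul hN hf

/-- A smooth partition of unity: by compactness finitely many of the bumps have a strictly positive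
periodic sum `Φ`, and dividing `∑ χᵢ f` by the smooth function `Φ` recovers `f`. -/
theorem inAlg_of_inAlgLoc {Ahat : Set (ℤ → ℂ)} {N : (ℤ → ℂ) → ℝ≥0∞} (hN : IsAlgNorm Ahat N)
    {f : ℝ → ℂ} (hf : ∀ θ, InAlgLoc Ahat f θ) : InAlg Ahat f := by
  choose χ hχ hone hmem using hf
  obtain ⟨t, -, ht⟩ := (isCompact_Icc (a := (0 : ℝ)) (b := 2 * Real.pi)).elim_nhds_subcover
    (fun θ => {φ | χ θ φ = 1}) (fun θ _ => hone θ)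
  let Φ : ℝ → ℝ := fun θ => ∑ i ∈ t, χ i θ
  have hΦp : Function.Periodic Φ (2 * Real.pi) := fun θ => by
    simp only [Φ, (hχ _).2.1 θ]
  have hΦpos : ∀ θ, 0 < Φ θ := by
    intro θ
    obtain ⟨y, hy, hyθ⟩ := hΦp.exists_mem_Ico₀ Real.two_pi_pos θ
    rw [hyθ]
    obtain ⟨i, hi, hiy⟩ := mem_iUnion₂.1 (ht ⟨hy.1, hy.2.le⟩)
    have hiy' : χ i y = 1 := hiy
    calc (0 : ℝ) < χ i y := by rw [hiy']; norm_num
      _ ≤ Φ y := Finset.single_le_sum (f := fun i => χ i y) (fun j _ => ((hχ j).2.2 y).1) hi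
  have hΦs : ContDiff ℝ ∞ Φ := ContDiff.sum fun i _ => (hχ i).1
  have h1 := (InAlg.sum hN t fun i _ => hmem i).smooth_mul hN
    (χ := fun θ => (Φ θ)⁻¹) (hΦs.inv fun θ => (hΦpos θ).ne') (fun θ => by simp only [hΦp θ])
  convert h1 using 2 with θ
  rw [← Finset.sum_mul, ← mul_assoc]
  have : (Φ θ : ℂ) ≠ 0 := by exact_mod_cast (hΦpos θ).ne'
  have e : ∑ i ∈ t, (χ i θ : ℂ) = Φ θ := by simp [Φ]
  rw [e]
  push_cast
  rw [inv_mul_cancel₀ this, one_mul]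

/-! ### Growth of powers and the logarithm -/

theorem HasFourier.pow_of_support {β : ℤ → ℂ} {f : ℝ → ℂ} (hf : HasFourier β f) {D : ℕ}
    (hD : ∀ n : ℤ, (D : ℤ) < |n| → β n = 0) (j : ℕ) :
    ∃ γ, HasFourier γ (fun θ => f θ ^ j) ∧ ∀ n : ℤ, ((j * D : ℕ) : ℤ) < |n| → γ n = 0 := by
  induction j with
  | zero =>
    refine ⟨Pi.single 0 1, ?_, fun n hn => ?_⟩
    · have : (fun θ => f θ ^ 0) = expMono 0 := by funext θ; simp [expMono_zero]
      rw [this]; exact hasFourier_expMono 0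
    · have : n ≠ 0 := by rintro rfl; simp at hn
      simp [this]
  | succ j ih =>
    obtain ⟨γ, hγ, h0⟩ := ih
    refine ⟨conv γ β, by simpa only [pow_succ] using hγ.mul hf, fun n hn => ?_⟩
    rw [conv]
    convert tsum_zero with k
    by_cases hk : ((j * D : ℕ) : ℤ) < |k|
    · rw [h0 k hk, zero_mul]
    · rw [hD (n - k), mul_zero]
      have h3 : |n| ≤ |n - k| + |k| := by simpa using abs_add_le (n - k) k
      push_cast [add_mul] at hn hk ⊢
      linarith

theorem exists_poly_le_geometric (k : ℕ) {x : ℝ} (hx0 : 0 < x) (hx1 : x < 1) :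
    ∃ C : ℝ, ∀ j : ℕ, (1 + j : ℝ) ^ k * x ^ j ≤ C := by
  have h := (tendsto_pow_const_mul_const_pow_of_abs_lt_one k
    (by rwa [abs_of_pos hx0] : |x| < 1)).comp (tendsto_add_atTop_nat 1)
  obtain ⟨C, hC⟩ := h.bddAbove_range
  refine ⟨C / x, fun j => ?_⟩
  have := hC ⟨j, rfl⟩
  simp only [Function.comp_apply] at this
  rw [le_div_iff₀ hx0]
  calc _ = ((j + 1 : ℕ) : ℝ) ^ k * x ^ (j + 1) := by push_cast; ring
    _ ≤ C := this


/-- At most `2m + 1` frequencies occur, each costing at most `A (1 + m)^d` times the bound on the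
coefficients. -/
theorem IsAlgNorm.le_sum_of_support {Ahat : Set (ℤ → ℂ)} {N : (ℤ → ℂ) → ℝ≥0∞}
    (hN : IsAlgNorm Ahat N) {γ : ℤ → ℂ} {m : ℕ} (h0 : ∀ n : ℤ, (m : ℤ) < |n| → γ n = 0)
    {R : ℝ≥0} (hR : ∀ n, ‖γ n‖ ≤ R) {A d : ℕ}
    (hA : ∀ k : ℤ, N (Pi.single k 1) ≤ A * (1 + k.natAbs : ℕ) ^ d) :
    N γ ≤ ((2 * A * (1 + m) ^ (d + 1) * R : ℝ≥0) : ℝ≥0∞) := by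
  have h1 : N γ ≤ ∑ k ∈ Finset.Icc (-m : ℤ) m, N (fun n => γ k * (Pi.single k 1 : ℤ → ℂ) n) := by
    rw [← Finset.tsum_subtype]
    refine hN.le_tsum _ _ fun n => ?_
    by_cases hn : (m : ℤ) < |n|
    · simp [h0 n hn]
    · have hn' : n ∈ Finset.Icc (-m : ℤ) m := by
        rw [Finset.mem_Icc]
        exact abs_le.1 (not_lt.1 hn)
      refine le_trans (le_of_eq ?_) (ENNReal.le_tsum (⟨n, hn'⟩ : {k // k ∈ Finset.Icc (-m : ℤ) m}))
      simp
  refine h1.trans ?_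
  have h2 : ∀ k ∈ Finset.Icc (-m : ℤ) m, N (fun n => γ k * (Pi.single k 1 : ℤ → ℂ) n) ≤
      ((R * (A * (1 + m) ^ d) : ℝ≥0) : ℝ≥0∞) := by
    intro k hk
    refine (hN.smul_le _ _).trans ?_
    have hk' : k.natAbs ≤ m := by rw [Finset.mem_Icc] at hk; omega
    have e1 : ‖γ k‖ₑ ≤ R := by
      rw [enorm_eq_nnnorm]; exact_mod_cast hR k
    have e2 : (A : ℝ≥0∞) * ((1 + k.natAbs : ℕ) : ℝ≥0∞) ^ d ≤ A * ((1 + m : ℕ) : ℝ≥0∞) ^ d := by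
      gcongr
    refine (mul_le_mul' e1 ((hA k).trans e2)).trans (le_of_eq ?_)
    push_cast
    rfl
  refine (Finset.sum_le_sum h2).trans ?_
  rw [Finset.sum_const, Int.card_Icc, nsmul_eq_mul, ← ENNReal.coe_natCast, ← ENNReal.coe_mul,
    ENNReal.coe_le_coe]
  have e3 : (((m : ℤ) + 1 - -(m : ℤ)).toNat : ℝ≥0) ≤ 2 * (1 + m) := by
    have : ((m : ℤ) + 1 - -(m : ℤ)).toNat ≤ 2 * (1 + m) := by omega
    exact_mod_cast this
  calc _ ≤ 2 * (1 + (m : ℝ≥0)) * (R * (A * (1 + m) ^ d)) := by gcongr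
    _ = 2 * A * (1 + m) ^ (d + 1) * R := by ring

/-- Powers of a function in the algebra grow no faster than powers of its supremum norm. -/
theorem IsAlgNorm.exists_pow_bound {Ahat : Set (ℤ → ℂ)} {N : (ℤ → ℂ) → ℝ≥0∞}
    (hN : IsAlgNorm Ahat N) {f : ℝ → ℂ} (hf : InAlg Ahat f) {ρ r : ℝ≥0} (hρ : ∀ θ, ‖f θ‖ ≤ ρ)
    (hr : ρ < r) : ∃ C : ℝ≥0, ∀ n, AlgBound N (fun θ => f θ ^ n) ((C * r ^ n : ℝ≥0) : ℝ≥0∞) := by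
  obtain ⟨A, d, hA⟩ := hN.single_le
  -- Of the three `ε`, one bounds `f - p` in the supremum norm, one absorbs a polynomial factor in
  -- the powers of `p`, and one is the norm of the tail `h` in the binomial expansion.
  obtain ⟨ε, hε, hεr⟩ : ∃ ε : ℝ≥0, 0 < ε ∧ ρ + 3 * ε ≤ r := by
    refine ⟨(r - ρ) / 3, by simpa using hr, ?_⟩
    rw [mul_div_cancel₀ _ (by norm_num), add_tsub_cancel_of_le hr.le]
  have hβ := hN.hasFourier_of_inAlg hf
  set β := fourierCoeffOn Real.two_pi_pos f
  obtain ⟨D, hD⟩ := hN.tail_le β ((hN.mem_iff _).1 hf.2.2) ε (by exact_mod_cast hε.ne')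
  let β₁ : ℤ → ℂ := fun n => if |n| ≤ (D : ℤ) then β n else 0
  let β₂ : ℤ → ℂ := fun n => if |n| ≤ (D : ℤ) then 0 else β n
  have hsub : ∀ γ : ℤ → ℂ, (∀ n, ‖γ n‖ ≤ ‖β n‖) →
      HasFourier γ fun θ => ∑' n, γ n * expMono n θ := by
    intro γ hγ
    have hs := Summable.of_nonneg_of_le (fun n => norm_nonneg _) hγ hβ.1
    refine ⟨hs, fun θ => (Summable.of_norm ?_).hasSum⟩
    simpa only [norm_mul, norm_expMono, mul_one] using hs
  have hP := hsub β₁ (fun n => by simp only [β₁]; split_ifs <;> simp)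
  have hh := hsub β₂ (fun n => by simp only [β₂]; split_ifs <;> simp)
  set p : ℝ → ℂ := fun θ => ∑' n, β₁ n * expMono n θ
  set h : ℝ → ℂ := fun θ => ∑' n, β₂ n * expMono n θ
  have hfph : ∀ θ, f θ = p θ + h θ := by
    intro θ
    refine (hβ.2 θ).unique ?_
    have := (hP.2 θ).add (hh.2 θ)
    refine this.congr_fun fun n => ?_
    simp only [β₁, β₂]
    split_ifs <;> simp
  have hhle : ∀ θ, ‖h θ‖ ≤ ε := by
    intro θ
    have h1 : ‖h θ‖ₑ ≤ ε := by
      calc ‖h θ‖ₑ ≤ ∑' n, ‖β₂ n * expMono n θ‖ₑ := enorm_tsum_le_tsum_enorm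
        _ = ∑' n, ‖β₂ n‖ₑ := by
          refine tsum_congr fun n => ?_
          rw [← ofReal_norm, norm_mul, norm_expMono, mul_one, ofReal_norm]
        _ ≤ ε := (hN.l1_le _).trans hD
    rw [enorm_eq_nnnorm] at h1
    exact_mod_cast h1
  have hple : ∀ θ, ‖p θ‖ ≤ ((ρ + ε : ℝ≥0) : ℝ) := by
    intro θ
    have : p θ = f θ - h θ := by rw [hfph θ]; ring
    rw [this]
    push_cast
    exact (norm_sub_le _ _).trans (add_le_add (hρ θ) (hhle θ))
  -- `p ^ j` has frequencies up to `j * D` and coefficients bounded by `(ρ + ε) ^ j`, so its norm is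
  -- at most a polynomial in `j` times this power. Passing from `ρ + ε` to `ρ + 2ε` removes the
  -- polynomial.
  obtain ⟨C₁, hC₁⟩ : ∃ C₁ : ℝ≥0, ∀ j : ℕ,
      AlgBound N (fun θ => p θ ^ j) ((C₁ * (ρ + 2 * ε) ^ j : ℝ≥0) : ℝ≥0∞) := by
    have hs : (0 : ℝ≥0) < ρ + ε := lt_of_lt_of_le hε le_add_self
    have hs2 : (0 : ℝ≥0) < ρ + 2 * ε := by positivity
    obtain ⟨C, hC⟩ := exists_poly_le_geometric (d + 1) (x := ((ρ + ε) / (ρ + 2 * ε) : ℝ≥0))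
      (by have := div_pos hs hs2; exact_mod_cast this)
      (by
        have : (ρ + ε) / (ρ + 2 * ε) < 1 := by
          rw [div_lt_one hs2, two_mul, ← add_assoc]
          exact lt_add_of_pos_right _ hε
        exact_mod_cast this)
    have hC0 : 0 ≤ C := le_trans (by positivity) (hC 0)
    lift C to ℝ≥0 using hC0
    refine ⟨2 * A * (1 + D) ^ (d + 1) * C, fun j => ?_⟩
    obtain ⟨γ, hγ, h0⟩ := hP.pow_of_support (D := D) (fun n hn => by
      simp [β₁, not_le.2 hn]) j
    refine ⟨γ, hγ, (hN.le_sum_of_support h0 (R := (ρ + ε) ^ j) (fun n => ?_) hA).trans ?_⟩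
    · refine hγ.norm_coeff_le (fun θ => ?_) n
      rw [norm_pow]
      exact_mod_cast pow_le_pow_left₀ (norm_nonneg _) (hple θ) j
    · have e1 : (1 + j : ℝ≥0) ^ (d + 1) * ((ρ + ε) / (ρ + 2 * ε)) ^ j ≤ C := by
        exact_mod_cast hC j
      have e2 : (1 + j : ℝ≥0) ^ (d + 1) * (ρ + ε) ^ j ≤ C * (ρ + 2 * ε) ^ j := by
        rw [div_pow, ← mul_div_assoc, div_le_iff₀ (by positivity)] at e1
        exact e1
      have e3 : (1 + ((j * D : ℕ) : ℝ≥0)) ≤ (1 + D) * (1 + j) := by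
        have : 1 + j * D ≤ (1 + D) * (1 + j) := by nlinarith
        exact_mod_cast this
      rw [ENNReal.coe_le_coe]
      calc 2 * A * (1 + ((j * D : ℕ) : ℝ≥0)) ^ (d + 1) * (ρ + ε) ^ j
          ≤ 2 * A * ((1 + D) * (1 + j)) ^ (d + 1) * (ρ + ε) ^ j := by gcongr
        _ = 2 * A * (1 + D) ^ (d + 1) * ((1 + j) ^ (d + 1) * (ρ + ε) ^ j) := by
            rw [mul_pow]; ring
        _ ≤ 2 * A * (1 + D) ^ (d + 1) * (C * (ρ + 2 * ε) ^ j) := by gcongr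
        _ = _ := by ring
  obtain ⟨a, ha⟩ := WithTop.ne_top_iff_exists.1 hN.single_zero_ne_top
  change (a : ℝ≥0∞) = _ at ha
  refine ⟨C₁ * a, fun n => ?_⟩
  have hhB : AlgBound N h ε := ⟨β₂, hh, hD⟩
  -- The binomial expansion of `(p + h) ^ n` resums to `(ρ + 2ε + ε) ^ n`.
  have hsum := hN.algBound_sum (Finset.range (n + 1)) fun j (_ : j ∈ Finset.range (n + 1)) =>
    hN.algBound_const_mul (n.choose j : ℂ)
      (hN.algBound_mul (hC₁ j) (hN.algBound_pow hhB (n - j)))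
  have e1 : (fun θ => ∑ j ∈ Finset.range (n + 1), (n.choose j : ℂ) * (p θ ^ j * h θ ^ (n - j))) =
      fun θ => f θ ^ n := by
    funext θ
    rw [hfph, add_pow]
    exact Finset.sum_congr rfl fun j _ => by ring
  rw [e1] at hsum
  obtain ⟨γ, hγ, hle⟩ := hsum
  refine ⟨γ, hγ, hle.trans ?_⟩
  have e2 : ∀ j, ‖(n.choose j : ℂ)‖ₑ = ((n.choose j : ℝ≥0) : ℝ≥0∞) := by
    intro j; rw [enorm_eq_nnnorm, Complex.nnnorm_natCast]
  simp only [e2, ← ha]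
  norm_cast
  calc _ = C₁ * a * ∑ j ∈ Finset.range (n + 1), (ρ + 2 * ε) ^ j * ε ^ (n - j) * (n.choose j) := by
        rw [Finset.mul_sum]
        exact Finset.sum_congr rfl fun j _ => by ring
    _ = C₁ * a * (ρ + 3 * ε) ^ n := by
        rw [← add_pow]
        congr 2
        ring
    _ ≤ C₁ * a * r ^ n := by gcongr

theorem enorm_neg_inv_succ_le_one (n : ℕ) : ‖-((n : ℂ) + 1)⁻¹‖ₑ ≤ 1 := by
  rw [← ofReal_norm, norm_neg, norm_inv]
  refine ENNReal.ofReal_le_one.2 (inv_le_one_of_one_le₀ ?_)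
  have : ‖(n : ℂ) + 1‖ = (n : ℝ) + 1 := by
    rw [← Nat.cast_succ, Complex.norm_natCast]; push_cast; ring
  rw [this]
  have := n.cast_nonneg (α := ℝ)
  linarith

/-- The logarithmic series converges in the algebra because the powers of `u` decay at any rate `r`
strictly between `ρ` and `1`; the algebra norm of `u` itself may exceed one. -/
theorem InAlg.log_one_sub {Ahat : Set (ℤ → ℂ)} {N : (ℤ → ℂ) → ℝ≥0∞} (hN : IsAlgNorm Ahat N)
    {u : ℝ → ℝ} (hu : InAlg Ahat fun θ => (u θ : ℂ)) {ρ : ℝ≥0} (hρ : ∀ θ, |u θ| ≤ ρ)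
    (hρ1 : ρ < 1) : InAlg Ahat fun θ => (Real.log (1 - u θ) : ℂ) := by
  obtain ⟨r, hr1, hr2⟩ := exists_between hρ1
  obtain ⟨C, hC⟩ := hN.exists_pow_bound hu (ρ := ρ) (r := r)
    (fun θ => by rw [Complex.norm_real]; exact hρ θ) hr1
  have hterm := fun n : ℕ => hN.algBound_const_mul (-((n : ℂ) + 1)⁻¹) (hC (n + 1))
  have hfin : ∑' n : ℕ, ‖-((n : ℂ) + 1)⁻¹‖ₑ * ((C * r ^ (n + 1) : ℝ≥0) : ℝ≥0∞) ≠ ⊤ := by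
    refine ne_top_of_le_ne_top (b := ∑' n : ℕ, ((C * r ^ (n + 1) : ℝ≥0) : ℝ≥0∞))
      ?_ (ENNReal.tsum_le_tsum fun n => mul_le_of_le_one_left' (enorm_neg_inv_succ_le_one n))
    rw [ENNReal.tsum_coe_ne_top_iff_summable]
    have h := (NNReal.summable_geometric hr2).mul_left (C * r)
    exact h.congr fun n => by rw [pow_succ]; ring
  rw [hN.inAlg_iff]
  refine ⟨_, hfin, hN.algBound_tsum hterm hfin fun θ => ?_⟩
  have hlt : |u θ| < 1 := (hρ θ).trans_lt (by exact_mod_cast hρ1)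
  have h1 := (Real.hasSum_pow_div_log_of_abs_lt_one hlt).neg
  rw [neg_neg] at h1
  refine (Complex.hasSum_ofReal.2 h1).congr_fun fun n => ?_
  push_cast
  ring

/-- Dividing by the maximum `b` writes `w / b = 1 - u` with `0 ≤ u ≤ 1 - a / b < 1`, where `a > 0`
is the minimum; both extrema exist by continuity and periodicity. -/
theorem InAlg.log {Ahat : Set (ℤ → ℂ)} {N : (ℤ → ℂ) → ℝ≥0∞} (hN : IsAlgNorm Ahat N) {w : ℝ → ℝ}
    (hw : InAlg Ahat fun θ => (w θ : ℂ)) (hpos : ∀ θ, 0 < w θ) :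
    InAlg Ahat fun θ => (Real.log (w θ) : ℂ) := by
  have hwc : Continuous w := by
    have := Complex.continuous_re.comp hw.1
    simpa [Function.comp_def] using this
  have hwp : Function.Periodic w (2 * Real.pi) := fun θ => by
    exact Complex.ofReal_injective (hw.2.1 θ)
  have hne : (Icc (0 : ℝ) (2 * Real.pi)).Nonempty := ⟨0, le_rfl, Real.two_pi_pos.le⟩
  obtain ⟨x₀, -, hmin⟩ := isCompact_Icc.exists_isMinOn hne hwc.continuousOn
  obtain ⟨x₁, -, hmax⟩ := isCompact_Icc.exists_isMaxOn hne hwc.continuousOn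
  have hlo : ∀ θ, w x₀ ≤ w θ := by
    intro θ
    obtain ⟨y, hy, hyθ⟩ := hwp.exists_mem_Ico₀ Real.two_pi_pos θ
    rw [hyθ]
    exact hmin ⟨hy.1, hy.2.le⟩
  have hhi : ∀ θ, w θ ≤ w x₁ := by
    intro θ
    obtain ⟨y, hy, hyθ⟩ := hwp.exists_mem_Ico₀ Real.two_pi_pos θ
    rw [hyθ]
    exact hmax ⟨hy.1, hy.2.le⟩
  set a := w x₀
  set b := w x₁
  have ha : 0 < a := hpos _
  have hb : 0 < b := hpos _
  have hab : a ≤ b := hhi _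
  have hconst : ∀ c : ℂ, InAlg Ahat fun _ => c := fun c =>
    hN.smooth contDiff_const (fun _ => rfl)
  have hb' : (b : ℂ) ≠ 0 := by exact_mod_cast hb.ne'
  have hg0 : ∀ θ, 0 ≤ 1 - w θ / b := fun θ => by
    rw [sub_nonneg, div_le_one hb]; exact hhi θ
  have hg1 : ∀ θ, 1 - w θ / b ≤ 1 - a / b := fun θ => by
    have := hlo θ
    gcongr
  have hρ1 : 1 - a / b < 1 := by have := div_pos ha hb; linarith
  have hu : InAlg Ahat fun θ => ((1 - w θ / b : ℝ) : ℂ) := by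
    convert (hconst 1).add hN (hw.const_mul hN (-(1 / b : ℂ))) using 2 with θ
    push_cast; ring
  have hlog := InAlg.log_one_sub hN hu (ρ := ⟨1 - a / b, hg0 x₀⟩)
    (fun θ => by rw [abs_of_nonneg (hg0 θ)]; exact hg1 θ) (by exact_mod_cast hρ1)
  convert hlog.add hN (hconst (Real.log b)) using 2 with θ
  rw [sub_sub_cancel, Real.log_div (hpos θ).ne' hb.ne']
  push_cast
  ring

/-! ### Spectrum of a Jacobi operator outside the band -/

theorem EllTwo.norm_sq_eq (u : EllTwo) : ‖u‖ ^ 2 = ∑' n, ‖(u : ℕ → ℂ) n‖ ^ 2 := by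
  have := lp.norm_rpow_eq_tsum (p := 2) (by norm_num) u
  simpa using this

theorem EllTwo.summable_sq (u : EllTwo) : Summable fun n => ‖(u : ℕ → ℂ) n‖ ^ 2 := by
  have := (lp.memℓp u).summable (by norm_num)
  simpa using this

theorem EllTwo.norm_le_of_pointwise {u v : EllTwo} {C : ℝ} (hC : 0 ≤ C)
    (h : ∀ n, ‖(v : ℕ → ℂ) n‖ ≤ C * ‖(u : ℕ → ℂ) n‖) : ‖v‖ ≤ C * ‖u‖ := by
  refine le_of_sq_le_sq ?_ (by positivity)
  rw [mul_pow, EllTwo.norm_sq_eq, EllTwo.norm_sq_eq, ← tsum_mul_left]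
  refine Summable.tsum_le_tsum (fun n => ?_) v.summable_sq (u.summable_sq.mul_left _)
  rw [← mul_pow]
  exact pow_le_pow_left₀ (norm_nonneg _) (h n) 2

theorem EllTwo.norm_le_of_shift_left {u v : EllTwo} {C : ℝ} (hC : 0 ≤ C)
    (h : ∀ n, ‖(v : ℕ → ℂ) n‖ ≤ C * ‖(u : ℕ → ℂ) (n + 1)‖) : ‖v‖ ≤ C * ‖u‖ := by
  refine le_of_sq_le_sq ?_ (by positivity)
  have hs := (summable_nat_add_iff 1).2 u.summable_sq
  rw [mul_pow, EllTwo.norm_sq_eq, EllTwo.norm_sq_eq, ← tsum_mul_left]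
  calc ∑' n, ‖(v : ℕ → ℂ) n‖ ^ 2 ≤ ∑' n, C ^ 2 * ‖(u : ℕ → ℂ) (n + 1)‖ ^ 2 := by
        refine Summable.tsum_le_tsum (fun n => ?_) v.summable_sq (hs.mul_left _)
        rw [← mul_pow]
        exact pow_le_pow_left₀ (norm_nonneg _) (h n) 2
    _ ≤ C ^ 2 * ‖(u : ℕ → ℂ) 0‖ ^ 2 + ∑' n, C ^ 2 * ‖(u : ℕ → ℂ) (n + 1)‖ ^ 2 :=
        le_add_of_nonneg_left (by positivity)
    _ = _ := ((u.summable_sq.mul_left (C ^ 2)).tsum_eq_zero_add).symm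

theorem EllTwo.norm_le_of_shift_right {u v : EllTwo} {C : ℝ} (hC : 0 ≤ C)
    (h0 : (v : ℕ → ℂ) 0 = 0)
    (h : ∀ n, ‖(v : ℕ → ℂ) (n + 1)‖ ≤ C * ‖(u : ℕ → ℂ) n‖) : ‖v‖ ≤ C * ‖u‖ := by
  refine le_of_sq_le_sq ?_ (by positivity)
  have hs := (summable_nat_add_iff 1).2 v.summable_sq
  rw [mul_pow, EllTwo.norm_sq_eq, EllTwo.norm_sq_eq, ← tsum_mul_left,
    v.summable_sq.tsum_eq_zero_add, h0]
  rw [norm_zero, zero_pow two_ne_zero, zero_add]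
  refine Summable.tsum_le_tsum (fun n => ?_) hs (u.summable_sq.mul_left _)
  rw [← mul_pow]
  exact pow_le_pow_left₀ (norm_nonneg _) (h n) 2

theorem JacobiMatrix.norm_op_le (J : JacobiMatrix) {A B : ℝ} (hA : ∀ n, |J.a n| ≤ A)
    (hB : ∀ n, |J.b n| ≤ B) : ‖J.op‖ ≤ 2 * A + B := by
  have hA0 : 0 ≤ A := (abs_nonneg _).trans (hA 0)
  have hB0 : 0 ≤ B := (abs_nonneg _).trans (hB 0)
  refine J.op.opNorm_le_bound (by positivity) fun u => ?_
  have hu : Memℓp (u : ℕ → ℂ) 2 := lp.memℓp u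
  have hshift : Memℓp (fun n => (u : ℕ → ℂ) (n + 1)) 2 :=
    memℓp_gen ((summable_nat_add_iff 1).2 (hu.summable (by norm_num)))
  let z : ℕ → ℂ := fun n => match n with
    | 0 => 0
    | n + 1 => J.a n * (u : ℕ → ℂ) n
  have hz : Memℓp z 2 :=
    memℓp_gen ((summable_nat_add_iff 1).1 ((memlp_two_mul_of_bounded hA hu).summable (by norm_num)))
  let U : EllTwo := ⟨_, memlp_two_mul_of_bounded hA hshift⟩
  let D : EllTwo := ⟨_, memlp_two_mul_of_bounded hB hu⟩
  let Z : EllTwo := ⟨z, hz⟩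
  have hsum : J.op u = Z + D + U := by
    ext n
    rw [J.op_apply]
    cases n with
    | zero =>
      change J.b 0 * (u : ℕ → ℂ) 0 + J.a 0 * (u : ℕ → ℂ) 1 =
        (0 + J.b 0 * (u : ℕ → ℂ) 0) + J.a 0 * (u : ℕ → ℂ) 1
      rw [zero_add]
    | succ n => rfl
  have hU : ‖U‖ ≤ A * ‖u‖ := EllTwo.norm_le_of_shift_left hA0 fun n => by
    simp only [U, norm_mul, Complex.norm_real, Real.norm_eq_abs]
    gcongr
    exact hA n
  have hD : ‖D‖ ≤ B * ‖u‖ := EllTwo.norm_le_of_pointwise hB0 fun n => by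
    simp only [D, norm_mul, Complex.norm_real, Real.norm_eq_abs]
    gcongr
    exact hB n
  have hZ : ‖Z‖ ≤ A * ‖u‖ := EllTwo.norm_le_of_shift_right hA0 rfl fun n => by
    simp only [Z, z, norm_mul, Complex.norm_real, Real.norm_eq_abs]
    gcongr
    exact hA n
  rw [hsum]
  calc ‖Z + D + U‖ ≤ ‖Z‖ + ‖D‖ + ‖U‖ := norm_add₃_le
    _ ≤ A * ‖u‖ + B * ‖u‖ + A * ‖u‖ := by gcongr
    _ = _ := by ring

theorem condSummable_truncate {f : ℕ → ℝ} (n : ℕ)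
    (h : ∃ L : ℝ, Tendsto (fun N => ∑ k ∈ Finset.range N, f k) atTop (𝓝 L)) :
    ∃ L : ℝ, Tendsto (fun N => ∑ k ∈ Finset.range N, if k < n then 0 else f k) atTop (𝓝 L) := by
  obtain ⟨L, hL⟩ := h
  refine ⟨L - ∑ k ∈ Finset.range n, f k, ?_⟩
  refine (hL.sub_const _).congr' ?_
  filter_upwards [eventually_ge_atTop n] with N hN
  have h1 : ∑ k ∈ Finset.range n, f k = ∑ k ∈ Finset.range N, if k < n then f k else 0 := by
    rw [← Finset.sum_filter]
    congr 1
    ext k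
    simp only [Finset.mem_range, Finset.mem_filter]
    omega
  rw [h1, ← Finset.sum_sub_distrib]
  refine Finset.sum_congr rfl fun k _ => ?_
  split_ifs <;> simp

/-- The Jacobi matrix whose first `n` parameters are replaced by those of the free matrix. -/
def JacobiMatrix.freeHead (J : JacobiMatrix) (n : ℕ) : JacobiMatrix where
  a k := if k < n then 1 else J.a k
  b k := if k < n then 0 else J.b k
  a_pos k := by split_ifs <;> simp [J.a_pos]
  b_condSummable := condSummable_truncate n J.b_condSummable
  a_condSummable := by
    obtain ⟨L, hL⟩ := condSummable_truncate n J.a_condSummable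
    refine ⟨L, hL.congr fun N => Finset.sum_congr rfl fun k _ => ?_⟩
    split_ifs <;> simp

/-- Beyond a large index the parameters are within `δ` of those of the free matrix, and the norm is
at most `2 sup a + sup |b|`. -/
theorem JacobiMatrix.exists_norm_freeHead_lt (J : JacobiMatrix) {c : ℝ} (hc : 2 < c) :
    ∃ n, ‖(J.freeHead n).op‖ < c := by
  obtain ⟨δ, hδ, hδc⟩ : ∃ δ : ℝ, 0 < δ ∧ 2 * (1 + δ) + δ < c :=
    ⟨(c - 2) / 4, by linarith, by linarith⟩
  obtain ⟨L, hL⟩ := J.b_condSummable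
  obtain ⟨L', hL'⟩ := J.a_condSummable
  have h1 := (tendsto_zero_of_partialSums hL).abs
  have h2 := (tendsto_zero_of_partialSums hL').abs
  rw [abs_zero] at h1 h2
  obtain ⟨n, hn⟩ := eventually_atTop.1
    ((h1.eventually (gt_mem_nhds hδ)).and (h2.eventually (gt_mem_nhds hδ)))
  refine ⟨n, (JacobiMatrix.norm_op_le _ (A := 1 + δ) (B := δ) (fun k => ?_) fun k => ?_).trans_lt
    hδc⟩
  · simp only [JacobiMatrix.freeHead]
    split_ifs with hk
    · simpa using hδ.le
    · have := (hn k (not_lt.1 hk)).2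
      have hp := J.a_pos k
      rw [abs_of_pos hp]
      have := (abs_lt.1 this).2
      nlinarith
  · simp only [JacobiMatrix.freeHead]
    split_ifs with hk
    · simpa using hδ.le
    · exact (hn k (not_lt.1 hk)).1.le

theorem JacobiMatrix.op_sub_freeHead_apply (J : JacobiMatrix) (n : ℕ) (u : EllTwo) {k : ℕ}
    (hk : n < k) : ((J.op - (J.freeHead n).op) u : ℕ → ℂ) k = 0 := by
  change (J.op u : ℕ → ℂ) k - ((J.freeHead n).op u : ℕ → ℂ) k = 0
  obtain ⟨k, rfl⟩ : ∃ j, k = j + 1 := ⟨k - 1, by omega⟩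
  simp only [JacobiMatrix.op_apply, JacobiMatrix.act, JacobiMatrix.freeHead]
  rw [if_neg (by omega), if_neg (by omega), if_neg (by omega), sub_self]

/-- The sequences in `ℓ²` supported in `{0, …, n}`. -/
def EllTwo.head (n : ℕ) : Submodule ℂ EllTwo where
  carrier := {u | ∀ k, n < k → (u : ℕ → ℂ) k = 0}
  add_mem' := fun {u v} hu hv k hk => by
    change (u : ℕ → ℂ) k + (v : ℕ → ℂ) k = 0
    rw [hu k hk, hv k hk, add_zero]
  zero_mem' := fun _ _ => rfl
  smul_mem' := fun c u hu k hk => by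
    change c * (u : ℕ → ℂ) k = 0
    rw [hu k hk, mul_zero]

instance EllTwo.finiteDimensional_head (n : ℕ) : FiniteDimensional ℂ (EllTwo.head n) := by
  let φ : EllTwo.head n →ₗ[ℂ] (Fin (n + 1) → ℂ) :=
    { toFun := fun u i => ((u : EllTwo) : ℕ → ℂ) i
      map_add' := fun u v => rfl
      map_smul' := fun c u => rfl }
  refine FiniteDimensional.of_injective φ fun u v h => ?_
  ext k
  by_cases hk : n < k
  · rw [u.2 k hk, v.2 k hk]
  · exact congrFun h ⟨k, by omega⟩

theorem JacobiMatrix.isCompactOperator_op_sub_freeHead (J : JacobiMatrix) (n : ℕ) :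
    IsCompactOperator (J.op - (J.freeHead n).op) := by
  let F := J.op - (J.freeHead n).op
  let G : EllTwo →L[ℂ] EllTwo.head n :=
    F.codRestrict (EllTwo.head n) fun u k hk => J.op_sub_freeHead_apply n u hk
  have h1 : IsCompactOperator (EllTwo.head n).subtypeL := by
    refine ⟨(EllTwo.head n).subtypeL '' Metric.closedBall 0 1,
      (isCompact_closedBall 0 1).image (EllTwo.head n).subtypeL.continuous, ?_⟩
    exact mem_of_superset (Metric.closedBall_mem_nhds 0 one_pos) (subset_preimage_image _ _)
  exact h1.comp_clm G

/-- `J` differs by a finite-rank operator from an operator of norm less than `‖z‖`. Factoring out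
the invertible `z - J.freeHead n` leaves `1 - K` with `K` compact, to which the Fredholm alternative
applies. -/
theorem JacobiMatrix.hasEigenvalue_or_isUnit (J : JacobiMatrix) {z : ℂ} (hz : 2 < ‖z‖) :
    z ∈ J.eigenvalues ∨ IsUnit (algebraMap ℂ (EllTwo →L[ℂ] EllTwo) z - J.op) := by
  obtain ⟨n, hn⟩ := J.exists_norm_freeHead_lt hz
  have hd : deltaOne ≠ 0 := by
    intro h
    have := congrArg (fun u : EllTwo => (u : ℕ → ℂ) 0) h
    simp [deltaOne] at this
  have : Nontrivial EllTwo := ⟨deltaOne, 0, hd⟩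
  obtain ⟨A, hA⟩ := spectrum.mem_resolventSet_of_norm_lt (𝕜 := ℂ) hn
  let F := J.op - (J.freeHead n).op
  let K : EllTwo →L[ℂ] EllTwo := (↑A⁻¹ : EllTwo →L[ℂ] EllTwo) * F
  have hK : IsCompactOperator K :=
    (J.isCompactOperator_op_sub_freeHead n).clm_comp (↑A⁻¹ : EllTwo →L[ℂ] EllTwo)
  have hfac : algebraMap ℂ (EllTwo →L[ℂ] EllTwo) z - J.op =
      A * (algebraMap ℂ (EllTwo →L[ℂ] EllTwo) 1 - K) := by
    rw [mul_sub, map_one, mul_one, ← mul_assoc, Units.mul_inv, one_mul, hA]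
    simp only [F]
    abel
  rcases hK.hasEigenvalue_or_mem_resolventSet one_ne_zero with h | h
  · left
    obtain ⟨v, hv⟩ := h.exists_hasEigenvector
    have h1 : K v = v := by simpa using hv.apply_eq_smul
    refine Module.End.hasEigenvalue_of_hasEigenvector (x := v) ⟨?_, hv.2⟩
    rw [Module.End.mem_eigenspace_iff]
    have h2 := congrArg (fun T : EllTwo →L[ℂ] EllTwo => T v) hfac
    have h3 : (algebraMap ℂ (EllTwo →L[ℂ] EllTwo) 1 - K) v = 0 := by
      rw [map_one]
      change v - K v = 0
      rw [h1, sub_self]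
    change (algebraMap ℂ (EllTwo →L[ℂ] EllTwo) z) v - J.op v =
      (A : EllTwo →L[ℂ] EllTwo) ((algebraMap ℂ (EllTwo →L[ℂ] EllTwo) 1 - K) v) at h2
    rw [h3, map_zero, sub_eq_zero, Algebra.algebraMap_eq_smul_one] at h2
    exact h2.symm
  · right
    rw [hfac]
    exact A.isUnit.mul h

theorem JacobiMatrix.eigenvalue_real (J : JacobiMatrix) {z : ℂ} (hz : z ∈ J.eigenvalues) :
    ∃ x : ℝ, z = x := by
  have h := (ContinuousLinearMap.isSelfAdjoint_iff_isSymmetric.1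
    J.op_isSelfAdjoint).conj_eigenvalue_eq_self hz
  exact ⟨z.re, (Complex.conj_eq_iff_re.1 h).symm⟩

theorem JacobiMatrix.spectrum_subset (J : JacobiMatrix) :
    spectrum ℝ J.op ⊆ Icc (-2) 2 ∪ {x | (x : ℂ) ∈ J.eigenvalues} := by
  intro x hx
  by_contra h
  rw [mem_union, not_or] at h
  have h2 : 2 < ‖(x : ℂ)‖ := by
    rw [Complex.norm_real, Real.norm_eq_abs, lt_abs]
    by_contra h3
    push Not at h3
    exact h.1 ⟨by linarith, by linarith⟩
  rw [← spectrum.algebraMap_mem_iff ℂ] at hx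
  exact hx ((J.hasEigenvalue_or_isUnit h2).resolve_left h.2)

/-! ### Properties of the spectral measure -/

section SpectralMeasure

variable {H : Type} [NormedAddCommGroup H] [InnerProductSpace ℂ H] [CompleteSpace H]

instance regular_vectorSpectralMeasure (T : H →L[ℂ] H) (v : H) :
    (vectorSpectralMeasure T v).Regular :=
  RealRMK.regular_rieszMeasure _

theorem spectralFunctional_apply (T : H →L[ℂ] H) (v : H) (f : C_c(ℝ, ℝ)) :
    spectralFunctional T v f = (⟪v, cfc (f : ℝ → ℝ) T v⟫_ℂ).re := rfl

/-- A bump that equals one on a compact set off the spectrum and vanishes on the spectrum has zero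
functional calculus; inner regularity then suffices. -/
theorem vectorSpectralMeasure_compl_spectrum (T : H →L[ℂ] H) (v : H) :
    vectorSpectralMeasure T v (spectrum ℝ T)ᶜ = 0 := by
  rw [(spectrum.isClosed T).isOpen_compl.measure_eq_iSup_isCompact]
  simp only [ENNReal.iSup_eq_zero]
  intro K hK hKc
  obtain ⟨f, hf1, hf0, hfc, hf01⟩ := exists_continuous_one_zero_of_isCompact hKc
    (spectrum.isClosed T) (disjoint_compl_left.mono_left hK)
  have := RealRMK.rieszMeasure_le_of_eq_one (spectralFunctional T v) (f := ⟨f, hfc⟩)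
    (fun x => (hf01 x).1) hKc (fun x hx => hf1 hx)
  refine le_antisymm (this.trans (le_of_eq ?_)) zero_le
  rw [spectralFunctional_apply]
  have h0 : cfc (f : ℝ → ℝ) T = 0 := by
    rw [cfc_congr (g := fun _ => 0) (fun x hx => hf0 hx)]
    exact cfc_const_zero ℝ T
  simp [h0]

/-- The Riesz measure is defined by compactly supported functions; a cutoff equal to one on the
compact spectrum changes neither side. -/
theorem integral_vectorSpectralMeasure_of_continuous (T : H →L[ℂ] H)
    (v : H) {g : ℝ → ℝ} (hg : Continuous g) :
    Integrable g (vectorSpectralMeasure T v) ∧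
      ∫ x, g x ∂vectorSpectralMeasure T v = (⟪v, cfc g T v⟫_ℂ).re := by
  obtain ⟨χ, hχ1, -, hχc, -⟩ := exists_continuous_one_zero_of_isCompact
    (spectrum.isCompact (𝕜 := ℝ) T) isClosed_empty (disjoint_empty _)
  let f : C_c(ℝ, ℝ) := ⟨⟨fun x => g x * χ x, hg.mul χ.continuous⟩, hχc.mul_left⟩
  have hae : g =ᵐ[vectorSpectralMeasure T v] f := by
    have : ∀ᵐ x ∂vectorSpectralMeasure T v, x ∈ spectrum ℝ T :=
      vectorSpectralMeasure_compl_spectrum T v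
    filter_upwards [this] with x hx
    change g x = g x * χ x
    rw [hχ1 hx, Pi.one_apply, mul_one]
  have hint : Integrable f (vectorSpectralMeasure T v) :=
    f.continuous.integrable_of_hasCompactSupport f.hasCompactSupport
  refine ⟨hint.congr hae.symm, ?_⟩
  rw [integral_congr_ae hae, integral_vectorSpectralMeasure]
  congr 3
  refine cfc_congr fun x hx => ?_
  change g x * χ x = g x
  rw [hχ1 hx, Pi.one_apply, mul_one]

instance isFiniteMeasure_vectorSpectralMeasure (T : H →L[ℂ] H) (v : H) :
    IsFiniteMeasure (vectorSpectralMeasure T v) := by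
  have := (integral_vectorSpectralMeasure_of_continuous T v
    (continuous_const (y := (1 : ℝ)))).1
  rw [integrable_const_iff] at this
  exact this.resolve_left one_ne_zero

theorem ofReal_sub_ne_zero {z : ℂ} (hz : z.im ≠ 0) (x : ℝ) : (x : ℂ) - z ≠ 0 := by
  intro h
  apply hz
  rw [← sub_eq_zero.1 h, Complex.ofReal_im]

theorem continuous_inv_sub {z : ℂ} (hz : z.im ≠ 0) : Continuous fun x : ℝ => ((x : ℂ) - z)⁻¹ :=
  (Complex.continuous_ofReal.sub continuous_const).inv₀ (ofReal_sub_ne_zero hz)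

theorem integrable_inv_sub (μ : Measure ℝ) [IsFiniteMeasure μ] {z : ℂ} (hz : z.im ≠ 0) :
    Integrable (fun x : ℝ => ((x : ℂ) - z)⁻¹) μ := by
  refine (integrable_const (|z.im|⁻¹)).mono'
    (continuous_inv_sub hz).aestronglyMeasurable (Eventually.of_forall fun x => ?_)
  rw [norm_inv]
  refine inv_anti₀ (abs_pos.2 hz) ?_
  have := Complex.abs_im_le_norm ((x : ℂ) - z)
  simpa using this

theorem inner_cfc_eq_re {T : H →L[ℂ] H} (v : H) (g : ℝ → ℝ) :
    ⟪v, cfc g T v⟫_ℂ = ((⟪v, cfc g T v⟫_ℂ).re : ℂ) := by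
  have h : IsSelfAdjoint (cfc g T) := cfc_predicate g T
  have h2 := (ContinuousLinearMap.isSelfAdjoint_iff_isSymmetric.1 h) v v
  have h3 : (starRingEnd ℂ) ⟪v, cfc g T v⟫_ℂ = ⟪v, cfc g T v⟫_ℂ := by
    rw [inner_conj_symm]
    exact h2
  exact (Complex.conj_eq_iff_re.1 h3).symm

/-- The spectral measure comes from real functions, so the resolvent is assembled from the real and
imaginary parts of `(x - z)⁻¹`. The identity is checked in the complex calculus, where the points of
the spectrum are real. -/
theorem resolvent_mul_eq_one {T : H →L[ℂ] H} (hT : IsSelfAdjoint T) {z : ℂ} (hz : z.im ≠ 0) :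
    (T - algebraMap ℂ (H →L[ℂ] H) z) *
      (cfc (fun x : ℝ => (((x : ℂ) - z)⁻¹).re) T +
        Complex.I • cfc (fun x : ℝ => (((x : ℂ) - z)⁻¹).im) T) = 1 := by
  have hc := continuous_inv_sub hz
  have hre : Continuous fun x : ℂ => ((((x.re : ℂ) - z)⁻¹).re : ℂ) :=
    Complex.continuous_ofReal.comp (Complex.continuous_re.comp (hc.comp Complex.continuous_re))
  have him : Continuous fun x : ℂ => ((((x.re : ℂ) - z)⁻¹).im : ℂ) :=
    Complex.continuous_ofReal.comp (Complex.continuous_im.comp (hc.comp Complex.continuous_re))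
  have him' : Continuous fun x : ℂ => Complex.I • ((((x.re : ℂ) - z)⁻¹).im : ℂ) :=
    him.const_smul Complex.I
  have hsum : Continuous fun x : ℂ => ((((x.re : ℂ) - z)⁻¹).re : ℂ) +
      Complex.I • ((((x.re : ℂ) - z)⁻¹).im : ℂ) := hre.add him'
  have hn : IsStarNormal T := hT.isStarNormal
  have h1 : T - algebraMap ℂ (H →L[ℂ] H) z = cfc (fun x : ℂ => x - z) T := by
    rw [cfc_sub (fun x : ℂ => x) (fun _ => z) T (by fun_prop) (by fun_prop), cfc_id' ℂ T,
      cfc_const z T]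
  rw [cfc_real_eq_complex, cfc_real_eq_complex, ← cfc_smul Complex.I _ T him.continuousOn,
    ← cfc_add (a := T) _ _ hre.continuousOn him'.continuousOn, h1,
    ← cfc_mul _ _ T (by fun_prop) hsum.continuousOn]
  rw [← cfc_const_one ℂ T]
  refine cfc_congr fun x hx => ?_
  have hx' : x = (x.re : ℂ) := hT.mem_spectrum_eq_re hx
  have hne := ofReal_sub_ne_zero hz x.re
  simp only [smul_eq_mul]
  rw [mul_comm Complex.I, Complex.re_add_im]
  conv_lhs => rw [hx']
  simp only [Complex.ofReal_re]
  exact mul_inv_cancel₀ hne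

theorem isUnit_sub_of_im_ne_zero {T : H →L[ℂ] H} (hT : IsSelfAdjoint T) {z : ℂ} (hz : z.im ≠ 0) :
    IsUnit (T - algebraMap ℂ (H →L[ℂ] H) z) := by
  by_contra h
  have h1 : z ∈ spectrum ℂ T := by
    rw [spectrum.mem_iff, IsUnit.sub_iff]
    exact h
  apply hz
  rw [hT.mem_spectrum_eq_re h1, Complex.ofReal_im]

theorem inner_resolvent_eq_integral {T : H →L[ℂ] H} (hT : IsSelfAdjoint T) (v : H) {z : ℂ}
    (hz : z.im ≠ 0) :
    ⟪v, Ring.inverse (T - algebraMap ℂ (H →L[ℂ] H) z) v⟫_ℂ =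
      ∫ x, ((x : ℂ) - z)⁻¹ ∂vectorSpectralMeasure T v := by
  have hc := continuous_inv_sub hz
  have hre : Continuous fun x : ℝ => (((x : ℂ) - z)⁻¹).re := Complex.continuous_re.comp hc
  have him : Continuous fun x : ℝ => (((x : ℂ) - z)⁻¹).im := Complex.continuous_im.comp hc
  obtain ⟨i1, e1⟩ := integral_vectorSpectralMeasure_of_continuous T v hre
  obtain ⟨i2, e2⟩ := integral_vectorSpectralMeasure_of_continuous T v him
  have hinv : Ring.inverse (T - algebraMap ℂ (H →L[ℂ] H) z) =
      cfc (fun x : ℝ => (((x : ℂ) - z)⁻¹).re) T +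
        Complex.I • cfc (fun x : ℝ => (((x : ℂ) - z)⁻¹).im) T := by
    have hu := isUnit_sub_of_im_ne_zero hT hz
    rw [← hu.mul_right_inj, Ring.mul_inverse_cancel _ hu, resolvent_mul_eq_one hT hz]
  have hint : Integrable (fun x : ℝ => ((x : ℂ) - z)⁻¹) (vectorSpectralMeasure T v) := by
    have := i1.ofReal (𝕜 := ℂ) |>.add ((i2.ofReal (𝕜 := ℂ)).mul_const Complex.I)
    refine this.congr (Eventually.of_forall fun x => ?_)
    exact Complex.re_add_im _
  rw [← integral_re_add_im hint, hinv]
  change ⟪v, cfc _ T v + Complex.I • cfc _ T v⟫_ℂ = _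
  rw [inner_add_right, inner_smul_right, inner_cfc_eq_re v, inner_cfc_eq_re (T := T) v
    (fun x : ℝ => (((x : ℂ) - z)⁻¹).im), ← e1, ← e2]
  rw [mul_comm]
  rfl

/-- An eigenvector not orthogonal to `v` produces a point mass of the spectral measure. -/
theorem vectorSpectralMeasure_singleton_ne_zero {T : H →L[ℂ] H} (hT : IsSelfAdjoint T) {v u : H}
    {E : ℝ} (hu : T u = (E : ℂ) • u) (huv : ⟪u, v⟫_ℂ ≠ 0) :
    vectorSpectralMeasure T v {E} ≠ 0 := by
  set ν := vectorSpectralMeasure T v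
  have hsym := ContinuousLinearMap.isSelfAdjoint_iff_isSymmetric.1 hT
  have hu0 : u ≠ 0 := by rintro rfl; simp at huv
  -- With `z = E + iε` and `w = (T - z)⁻¹ v`, the eigenvector sees `⟪u, v⟫ = -iε ⟪u, w⟫`, while `Im
  -- ⟪v, w⟫ = ε ‖w‖²`. Cauchy–Schwarz gives a lower bound independent of `ε` for the scaled Poisson
  -- integral.
  have hkey : ∀ ε : ℝ, 0 < ε →
      ‖⟪u, v⟫_ℂ‖ ^ 2 / ‖u‖ ^ 2 ≤ ∫ x, ε ^ 2 / ((x - E) ^ 2 + ε ^ 2) ∂ν := by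
    intro ε hε
    set z : ℂ := E + ε * Complex.I
    have hzim : z.im = ε := by simp [z]
    have hz : z.im ≠ 0 := by rw [hzim]; exact hε.ne'
    set w := Ring.inverse (T - algebraMap ℂ (H →L[ℂ] H) z) v
    have hw : T w - z • w = v := by
      have := congrArg (fun S : H →L[ℂ] H => S v)
        (Ring.mul_inverse_cancel _ (isUnit_sub_of_im_ne_zero hT hz))
      exact this
    have h1 : ⟪u, v⟫_ℂ = -(ε * Complex.I) * ⟪u, w⟫_ℂ := by
      have h3 : ⟪u, T w⟫_ℂ = E * ⟪u, w⟫_ℂ := by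
        have := hsym u w
        change ⟪T u, w⟫_ℂ = ⟪u, T w⟫_ℂ at this
        rw [← this, hu, inner_smul_left, Complex.conj_ofReal]
      rw [← hw, inner_sub_right, inner_smul_right, h3]
      simp only [z]; ring
    have h2 : (⟪v, w⟫_ℂ).im = ε * ‖w‖ ^ 2 := by
      have h4 : (⟪T w, w⟫_ℂ).im = 0 := by
        have h5 := hsym w w
        change ⟪T w, w⟫_ℂ = ⟪w, T w⟫_ℂ at h5
        exact Complex.conj_eq_iff_im.1 (by rw [inner_conj_symm, h5])
      rw [← hw, inner_sub_left, inner_smul_left, Complex.sub_im, h4,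
        inner_self_eq_norm_sq_to_K]
      have h5 : ((‖w‖ : ℂ) ^ 2) = ((‖w‖ ^ 2 : ℝ) : ℂ) := by push_cast; rfl
      change 0 - (starRingEnd ℂ z * (‖w‖ : ℂ) ^ 2).im = _
      rw [h5, Complex.im_mul_ofReal, Complex.conj_im, hzim]
      ring
    have h6 := inner_resolvent_eq_integral hT v hz
    have hint : Integrable (fun x : ℝ => ((x : ℂ) - z)⁻¹) ν := integrable_inv_sub ν hz
    have h7 : (⟪v, w⟫_ℂ).im = ∫ x, (((x : ℂ) - z)⁻¹).im ∂ν := by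
      rw [h6]
      exact (integral_im hint).symm
    have h8 : ∀ x : ℝ, ε * (((x : ℂ) - z)⁻¹).im = ε ^ 2 / ((x - E) ^ 2 + ε ^ 2) := by
      intro x
      rw [Complex.inv_im, Complex.normSq_apply]
      simp [z]
      ring
    simp only [← h8]
    rw [integral_const_mul, ← h7, h2, div_le_iff₀ (by positivity), h1, norm_mul, norm_neg, norm_mul,
      Complex.norm_I, mul_one, Complex.norm_real, Real.norm_of_nonneg hε.le]
    have := norm_inner_le_norm (𝕜 := ℂ) u w
    calc (ε * ‖⟪u, w⟫_ℂ‖) ^ 2 ≤ (ε * (‖u‖ * ‖w‖)) ^ 2 := by gcongr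
      _ = _ := by ring
  -- The kernels are bounded by one and tend pointwise to the indicator of `{E}`.
  have hlim : Tendsto (fun ε : ℝ => ∫ x, ε ^ 2 / ((x - E) ^ 2 + ε ^ 2) ∂ν) (𝓝[>] 0)
      (𝓝 (∫ x, ({E} : Set ℝ).indicator (fun _ => (1 : ℝ)) x ∂ν)) := by
    refine tendsto_integral_filter_of_dominated_convergence (fun _ => 1) ?_ ?_
      (integrable_const 1) ?_
    · filter_upwards [self_mem_nhdsWithin] with ε (hε : 0 < ε)
      refine (Continuous.div (by fun_prop) (by fun_prop) fun x => ?_).aestronglyMeasurable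
      positivity
    · filter_upwards [self_mem_nhdsWithin] with ε (hε : 0 < ε)
      refine Eventually.of_forall fun x => ?_
      rw [Real.norm_of_nonneg (by positivity), div_le_one (by positivity)]
      nlinarith [sq_nonneg (x - E)]
    · refine Eventually.of_forall fun x => ?_
      by_cases hx : x = E
      · rw [hx, indicator_of_mem (mem_singleton E)]
        refine tendsto_const_nhds.congr' ?_
        filter_upwards [self_mem_nhdsWithin] with ε (hε : 0 < ε)
        rw [sub_self]
        field_simp
        ring
      · rw [indicator_of_notMem (s := {E}) hx]
        have hne : (x - E) ^ 2 + 0 ^ 2 ≠ 0 := by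
          have := sub_ne_zero.2 hx
          positivity
        have : ContinuousAt (fun ε : ℝ => ε ^ 2 / ((x - E) ^ 2 + ε ^ 2)) 0 :=
          ContinuousAt.div (by fun_prop) (by fun_prop) hne
        have h9 := this.tendsto
        simp only [ne_eq, OfNat.ofNat_ne_zero, not_false_eq_true, zero_pow, zero_div] at h9
        exact h9.mono_left nhdsWithin_le_nhds
  rw [integral_indicator (measurableSet_singleton E)] at hlim
  intro h0
  have hz : ∫ _ in ({E} : Set ℝ), (1 : ℝ) ∂ν = 0 := by
    rw [Measure.restrict_eq_zero.2 h0, integral_zero_measure]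
  rw [hz] at hlim
  have hle := ge_of_tendsto hlim (by
    filter_upwards [self_mem_nhdsWithin] with ε (hε : 0 < ε) using hkey ε hε)
  have hpos : 0 < ‖⟪u, v⟫_ℂ‖ ^ 2 / ‖u‖ ^ 2 := by
    have := norm_pos_iff.2 huv
    have := norm_pos_iff.2 hu0
    positivity
  linarith

end SpectralMeasure

/-! ### The spectral measure of a Jacobi matrix -/

instance JacobiMatrix.isFiniteMeasure_spectralMeasure (J : JacobiMatrix) :
    IsFiniteMeasure J.spectralMeasure :=
  isFiniteMeasure_vectorSpectralMeasure J.op deltaOne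

theorem JacobiMatrix.MFunction_eq_integral (J : JacobiMatrix) {z : ℂ} (hz : (z + z⁻¹).im ≠ 0) :
    J.MFunction z = ∫ x, (z + z⁻¹ - (x : ℂ))⁻¹ ∂J.spectralMeasure := by
  rw [JacobiMatrix.MFunction, JacobiMatrix.mFunction,
    inner_resolvent_eq_integral J.op_isSelfAdjoint deltaOne hz, ← integral_neg]
  refine integral_congr_ae (Eventually.of_forall fun x => ?_)
  change -((x : ℂ) - (z + z⁻¹))⁻¹ = (z + z⁻¹ - x)⁻¹
  rw [← inv_neg, neg_sub]

/-- Since `a n > 0`, the three-term recurrence determines a solution from its first entry. Hence no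
eigenvector is orthogonal to `δ₁`, and every eigenvalue is an atom. -/
theorem JacobiMatrix.eq_zero_of_op_eq_smul (J : JacobiMatrix) {u : EllTwo} {E : ℂ}
    (hu : J.op u = E • u) (h0 : (u : ℕ → ℂ) 0 = 0) : u = 0 := by
  have hrec : ∀ n, J.act u n = E * (u : ℕ → ℂ) n := fun n =>
    congrArg (fun w : EllTwo => (w : ℕ → ℂ) n) hu
  have hboth : ∀ n, (u : ℕ → ℂ) n = 0 ∧ (u : ℕ → ℂ) (n + 1) = 0 := by
    intro n
    induction n with
    | zero =>
      have h := hrec 0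
      simp only [JacobiMatrix.act, h0, mul_zero, zero_add, mul_eq_zero, Complex.ofReal_eq_zero,
        (J.a_pos 0).ne', false_or] at h
      exact ⟨h0, h⟩
    | succ n ih =>
      have h := hrec (n + 1)
      simp only [JacobiMatrix.act, ih.1, ih.2, mul_zero, zero_add, mul_eq_zero,
        Complex.ofReal_eq_zero, (J.a_pos (n + 1)).ne', false_or] at h
      exact ⟨ih.2, h⟩
  ext n
  exact (hboth n).1

theorem JacobiMatrix.spectralMeasure_singleton_ne_zero (J : JacobiMatrix) {E : ℝ}
    (hE : (E : ℂ) ∈ J.eigenvalues) : J.spectralMeasure {E} ≠ 0 := by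
  obtain ⟨u, hu⟩ := Module.End.HasEigenvalue.exists_hasEigenvector hE
  have h1 : J.op u = (E : ℂ) • u := hu.apply_eq_smul
  refine vectorSpectralMeasure_singleton_ne_zero J.op_isSelfAdjoint h1 fun h => ?_
  rw [deltaOne, lp.inner_single_right] at h
  simp only [RCLike.inner_apply, one_mul, map_eq_zero] at h
  exact hu.2 (J.eq_zero_of_op_eq_smul h1 h)

theorem JacobiMatrix.exists_finset_compl_band (J : JacobiMatrix)
    (hfin : (J.eigenvalues \ bandSet).Finite) :
    ∃ E : Finset ℝ, (∀ e ∈ E, e ∉ Icc (-2 : ℝ) 2) ∧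
      J.spectralMeasure (Icc (-2) 2 ∪ (E : Set ℝ))ᶜ = 0 := by
  have hf : {x : ℝ | (x : ℂ) ∈ J.eigenvalues \ bandSet}.Finite :=
    hfin.preimage Complex.ofReal_injective.injOn
  refine ⟨hf.toFinset, fun e he h => ?_, ?_⟩
  · rw [Set.Finite.mem_toFinset] at he
    exact he.2 ⟨e, h, rfl⟩
  · refine measure_mono_null ?_ (vectorSpectralMeasure_compl_spectrum J.op deltaOne)
    refine compl_subset_compl.2 fun x hx => ?_
    by_cases hb : x ∈ Icc (-2 : ℝ) 2
    · exact Or.inl hb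
    · right
      rw [Set.Finite.coe_toFinset]
      refine ⟨(J.spectrum_subset hx).resolve_left hb, ?_⟩
      rintro ⟨y, hy, hyx⟩
      rw [Complex.ofReal_injective hyx] at hy
      exact hb hy

theorem integrableOn_finset {μ : Measure ℝ} [IsFiniteMeasure μ] (E : Finset ℝ) (g : ℝ → ℂ) :
    IntegrableOn g (E : Set ℝ) μ := by
  have h : (E : Set ℝ) = ⋃ e ∈ E, {e} := by ext; simp
  rw [h, integrableOn_finset_iUnion]
  exact fun e _ => integrableOn_singleton (by simp)

theorem integral_eq_band_add_atoms {μ : Measure ℝ} [IsFiniteMeasure μ] {E : Finset ℝ}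
    (hE : ∀ e ∈ E, e ∉ Icc (-2 : ℝ) 2) (h0 : μ (Icc (-2) 2 ∪ (E : Set ℝ))ᶜ = 0) {g : ℝ → ℂ}
    (hg : IntegrableOn g (Icc (-2) 2) μ) :
    ∫ x, g x ∂μ = (∫ x in Icc (-2) 2, g x ∂μ) + ∑ e ∈ E, (μ.real {e} : ℂ) * g e := by
  have hae : ∀ᵐ x ∂μ, x ∈ Icc (-2 : ℝ) 2 ∪ (E : Set ℝ) := h0
  have hEint : IntegrableOn g (E : Set ℝ) μ := integrableOn_finset E g
  have hdisj : Disjoint (Icc (-2 : ℝ) 2) (E : Set ℝ) :=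
    Set.disjoint_left.2 fun x hx hxE => hE x hxE hx
  have h1 : ∫ x, g x ∂μ = ∫ x in Icc (-2 : ℝ) 2 ∪ (E : Set ℝ), g x ∂μ := by
    rw [Measure.restrict_eq_self_of_ae_mem hae]
  rw [h1, setIntegral_union hdisj E.measurableSet hg hEint, setIntegral_finset E hEint]
  simp only [Complex.real_smul]


/-! ### Stieltjes inversion -/

/-- The radius at which the Poisson kernel of width one takes the value `u`. -/
def poissonRadius (u : ℝ) : ℝ := Real.sqrt (1 / u - 1)

theorem measurable_poissonRadius : Measurable poissonRadius := by
  unfold poissonRadius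
  fun_prop

theorem poissonRadius_pos {u : ℝ} (hu : u ∈ Ioo (0 : ℝ) 1) : 0 < poissonRadius u := by
  refine Real.sqrt_pos.2 (sub_pos.2 ?_)
  rw [lt_div_iff₀ hu.1, one_mul]
  exact hu.2

theorem le_poisson_iff {ε u x y : ℝ} (hε : 0 < ε) (hu : u ∈ Ioo (0 : ℝ) 1) :
    u ≤ ε ^ 2 / ((y - x) ^ 2 + ε ^ 2) ↔ y ∈ Metric.closedBall x (ε * poissonRadius u) := by
  have h1 : 0 ≤ 1 / u - 1 := by
    rw [sub_nonneg, le_div_iff₀ hu.1, one_mul]; exact hu.2.le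
  have h0 : 0 ≤ ε * poissonRadius u := mul_nonneg hε.le (Real.sqrt_nonneg _)
  rw [Metric.mem_closedBall, Real.dist_eq, ← sq_le_sq₀ (abs_nonneg _)
    h0, sq_abs, mul_pow, poissonRadius,
    Real.sq_sqrt h1,
    le_div_iff₀ (by positivity)]
  have h2 : ε ^ 2 * (1 / u - 1) = (ε ^ 2 - ε ^ 2 * u) / u := by
    have := hu.1.ne'
    field_simp
  rw [h2, le_div_iff₀ hu.1]
  constructor <;> intro h <;> nlinarith

/-- Layer-cake formula: the superlevel sets of the kernel at heights in `(0, 1)` are closed balls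
around `x`, and those above height `1` are empty. -/
theorem lintegral_poisson_eq (ν : Measure ℝ) {ε : ℝ} (hε : 0 < ε) (x : ℝ) :
    ∫⁻ y, ENNReal.ofReal (ε ^ 2 / ((y - x) ^ 2 + ε ^ 2)) ∂ν =
      ∫⁻ u in Ioo (0 : ℝ) 1, ν (Metric.closedBall x (ε * poissonRadius u)) := by
  have hcont : Continuous fun y : ℝ => ε ^ 2 / ((y - x) ^ 2 + ε ^ 2) :=
    Continuous.div (by fun_prop) (by fun_prop) fun y => by positivity
  rw [lintegral_eq_lintegral_meas_le ν (Eventually.of_forall fun y => by positivity)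
    hcont.aemeasurable]
  have h1 : ∀ u ∈ Ioi (1 : ℝ), ν {y | u ≤ ε ^ 2 / ((y - x) ^ 2 + ε ^ 2)} = 0 := by
    intro u hu
    convert measure_empty (μ := ν)
    ext y
    simp only [Set.mem_ofPred_eq, mem_empty_iff_false, iff_false, not_le]
    refine lt_of_le_of_lt ?_ hu
    rw [div_le_one (by positivity)]
    nlinarith [sq_nonneg (y - x)]
  rw [← Ioc_union_Ioi_eq_Ioi (zero_le_one (α := ℝ)), lintegral_union measurableSet_Ioi
    (Set.disjoint_left.2 fun u hu hu' => not_lt.2 hu.2 hu'),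
    setLIntegral_congr_fun measurableSet_Ioi h1, lintegral_zero, add_zero,
    setLIntegral_congr Ioo_ae_eq_Ioc.symm]
  refine setLIntegral_congr_fun measurableSet_Ioo fun u hu => ?_
  congr 1
  ext y
  exact le_poisson_iff hε hu

/-- The layer-cake formula for Lebesgue measure turns this into `∫ dx / (1 + x²) = π`. -/
theorem lintegral_poissonRadius :
    ∫⁻ u in Ioo (0 : ℝ) 1, ENNReal.ofReal (2 * poissonRadius u) = ENNReal.ofReal Real.pi := by
  have h := lintegral_poisson_eq volume one_pos 0
  simp only [one_mul, Real.volume_closedBall] at h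
  rw [← h, ← ofReal_integral_eq_lintegral_ofReal]
  · congr 1
    rw [← integral_univ_inv_one_add_sq]
    congr 1
    funext y
    simp [add_comm]
  · refine integrable_inv_one_add_sq.congr (Eventually.of_forall fun y => ?_)
    simp [add_comm]
  · exact Eventually.of_forall fun y => by positivity

/-- The Poisson integral is an average of the ratios `ν(B) / |B|` over balls of radius proportional
to `ε n`, with total weight `π`, so it inherits their limit. The value `q = ∞` is allowed, which is
what excludes singular parts later. -/
theorem tendsto_lintegral_poisson {ν : Measure ℝ} [IsFiniteMeasure ν] {x : ℝ} {q : ℝ≥0∞}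
    (hq : Tendsto (fun r => ν (Metric.closedBall x r) / volume (Metric.closedBall x r)) (𝓝[>] 0)
      (𝓝 q)) {ε : ℕ → ℝ} (hε : ∀ n, 0 < ε n) (hε0 : Tendsto ε atTop (𝓝 0)) :
    Tendsto (fun n => ∫⁻ y, ENNReal.ofReal (ε n / ((y - x) ^ 2 + ε n ^ 2)) ∂ν) atTop
      (𝓝 (ENNReal.ofReal Real.pi * q)) := by
  set Q : ℝ → ℝ≥0∞ := fun r => ν (Metric.closedBall x r) / volume (Metric.closedBall x r)
  have hmono : Monotone fun r => ν (Metric.closedBall x r) := fun r s h =>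
    measure_mono (Metric.closedBall_subset_closedBall h)
  have hrep : ∀ n, ∫⁻ y, ENNReal.ofReal (ε n / ((y - x) ^ 2 + ε n ^ 2)) ∂ν =
      ∫⁻ u in Ioo (0 : ℝ) 1, Q (ε n * poissonRadius u) * ENNReal.ofReal (2 * poissonRadius u) := by
    intro n
    have hn := hε n
    have h1 : ∀ y, ENNReal.ofReal (ε n / ((y - x) ^ 2 + ε n ^ 2)) =
        ENNReal.ofReal (1 / ε n) * ENNReal.ofReal (ε n ^ 2 / ((y - x) ^ 2 + ε n ^ 2)) := by
      intro y
      rw [← ENNReal.ofReal_mul (by positivity)]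
      congr 1
      have : (y - x) ^ 2 + ε n ^ 2 ≠ 0 := by positivity
      field_simp
    simp only [h1]
    rw [lintegral_const_mul' _ _ ENNReal.ofReal_ne_top, lintegral_poisson_eq ν hn,
      ← lintegral_const_mul' _ _ ENNReal.ofReal_ne_top]
    refine setLIntegral_congr_fun measurableSet_Ioo fun u hu => ?_
    have hr := poissonRadius_pos hu
    simp only [Q, Real.volume_closedBall]
    rw [ENNReal.div_eq_inv_mul, mul_right_comm, ← ENNReal.ofReal_inv_of_pos (by positivity),
      ← ENNReal.ofReal_mul (by positivity)]
    congr 2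
    field_simp
  simp only [hrep]
  have hpt : ∀ u ∈ Ioo (0 : ℝ) 1, Tendsto (fun n => Q (ε n * poissonRadius u) *
      ENNReal.ofReal (2 * poissonRadius u)) atTop
      (𝓝 (q * ENNReal.ofReal (2 * poissonRadius u))) := by
    intro u hu
    have hr := poissonRadius_pos hu
    refine ENNReal.Tendsto.mul_const (hq.comp ?_) (Or.inr ENNReal.ofReal_ne_top)
    refine tendsto_nhdsWithin_iff.2 ⟨by simpa using hε0.mul_const (poissonRadius u), ?_⟩
    exact Eventually.of_forall fun n => mul_pos (hε n) hr
  have hlimint : ∫⁻ u in Ioo (0 : ℝ) 1, q * ENNReal.ofReal (2 * poissonRadius u) =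
      ENNReal.ofReal Real.pi * q := by
    rw [lintegral_const_mul _ (by have := measurable_poissonRadius; fun_prop),
      lintegral_poissonRadius, mul_comm]
  have hQm : Measurable Q := hmono.measurable.div (by
    simp only [Real.volume_closedBall]
    fun_prop)
  have hmeas : ∀ n, Measurable fun u => Q (ε n * poissonRadius u) *
      ENNReal.ofReal (2 * poissonRadius u) := by
    intro n
    have := measurable_poissonRadius
    exact (hQm.comp (by fun_prop)).mul (by fun_prop)
  rw [← hlimint]
  -- An infinite limit is handled by Fatou. For a finite limit the ratios are bounded at small radii
  -- by convergence and at large radii by the total mass, so dominated convergence applies.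
  by_cases hqtop : q = ⊤
  · have hF := lintegral_liminf_le (u := atTop) (μ := volume.restrict (Ioo (0 : ℝ) 1)) hmeas
    have h2 : ∫⁻ u in Ioo (0 : ℝ) 1, q * ENNReal.ofReal (2 * poissonRadius u) = ⊤ := by
      rw [hlimint, hqtop, ENNReal.mul_top]
      simpa using Real.pi_pos
    have h3 : ∫⁻ u in Ioo (0 : ℝ) 1, liminf (fun n => Q (ε n * poissonRadius u) *
        ENNReal.ofReal (2 * poissonRadius u)) atTop = ⊤ := by
      rw [← h2]
      exact setLIntegral_congr_fun measurableSet_Ioo fun u hu => (hpt u hu).liminf_eq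
    rw [h2]
    rw [h3, top_le_iff] at hF
    refine tendsto_of_le_liminf_of_limsup_le (le_of_eq hF.symm) le_top
  · obtain ⟨C, hCtop, hC⟩ : ∃ C : ℝ≥0∞, C ≠ ⊤ ∧ ∀ r, 0 < r → Q r ≤ C := by
      have h1 : ∀ᶠ r in 𝓝[>] (0 : ℝ), Q r ≤ q + 1 :=
        (hq.eventually (gt_mem_nhds (ENNReal.lt_add_right hqtop one_ne_zero))).mono
          fun r h => h.le
      obtain ⟨r₀, hr₀, hsub⟩ := mem_nhdsGT_iff_exists_Ioc_subset.1 h1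
      have hr₀' : (0 : ℝ) < r₀ := hr₀
      refine ⟨max (q + 1) (ν univ / ENNReal.ofReal (2 * r₀)), ?_, fun r hr => ?_⟩
      · refine (max_lt (ENNReal.add_lt_top.2 ⟨lt_top_iff_ne_top.2 hqtop, by simp⟩)
          (ENNReal.div_lt_top (measure_ne_top _ _) ?_)).ne
        simpa using hr₀'
      · rcases le_or_gt r r₀ with h | h
        · exact (hsub ⟨hr, h⟩).trans (le_max_left _ _)
        · refine le_trans ?_ (le_max_right _ _)
          simp only [Q, Real.volume_closedBall]
          exact ENNReal.div_le_div (measure_mono (subset_univ _)) (by gcongr)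
    refine tendsto_lintegral_of_dominated_convergence
      (fun u => C * ENNReal.ofReal (2 * poissonRadius u)) hmeas (fun n => ?_) ?_ ?_
    · filter_upwards [ae_restrict_mem measurableSet_Ioo] with u hu
      gcongr
      exact hC _ (mul_pos (hε n) (poissonRadius_pos hu))
    · rw [lintegral_const_mul' _ _ hCtop, lintegral_poissonRadius]
      exact ENNReal.mul_ne_top hCtop ENNReal.ofReal_ne_top
    · filter_upwards [ae_restrict_mem measurableSet_Ioo] with u hu
      exact hpt u hu

theorem lintegral_poisson_eq_ofReal {ν : Measure ℝ} [IsFiniteMeasure ν] (x : ℝ) {ε : ℝ}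
    (hε : 0 < ε) : ∫⁻ y, ENNReal.ofReal (ε / ((y - x) ^ 2 + ε ^ 2)) ∂ν =
      ENNReal.ofReal (∫ y, ε / ((y - x) ^ 2 + ε ^ 2) ∂ν) := by
  rw [ofReal_integral_eq_lintegral_ofReal]
  · refine (integrable_const (ε / ε ^ 2)).mono' (Continuous.aestronglyMeasurable
      (Continuous.div (by fun_prop) (by fun_prop) fun y => by positivity))
      (Eventually.of_forall fun y => ?_)
    rw [Real.norm_of_nonneg (by positivity)]
    gcongr
    nlinarith [sq_nonneg (y - x)]
  · exact Eventually.of_forall fun y => by positivity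

/-- If the Poisson integrals of a finite measure converge everywhere on a measurable set, then the
measure is absolutely continuous there, and the limit is `π` times its density. -/
theorem restrict_eq_withDensity_of_tendsto_poisson {ν : Measure ℝ} [IsFiniteMeasure ν] {S : Set ℝ}
    (hS : MeasurableSet S) {g : ℝ → ℝ}
    (hg : ∀ x ∈ S, Tendsto (fun ε : ℝ => ∫ y, ε / ((y - x) ^ 2 + ε ^ 2) ∂ν) (𝓝[>] 0)
      (𝓝 (Real.pi * g x))) :
    ν.restrict S = (volume.restrict S).withDensity fun x => ENNReal.ofReal (g x) := by
  have hε : ∀ n : ℕ, (0 : ℝ) < 1 / ((n : ℝ) + 1) := fun n => Nat.one_div_pos_of_nat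
  have hε0 : Tendsto (fun n : ℕ => 1 / ((n : ℝ) + 1)) atTop (𝓝 0) :=
    tendsto_one_div_add_atTop_nhds_zero_nat
  have hlim : ∀ x ∈ S, ∀ q : ℝ≥0∞, Tendsto (fun r => ν (Metric.closedBall x r) /
      volume (Metric.closedBall x r)) (𝓝[>] 0) (𝓝 q) → q = ENNReal.ofReal (g x) := by
    intro x hx q hq
    have h1 := tendsto_lintegral_poisson hq hε hε0
    have h2 := (ENNReal.continuous_ofReal.tendsto _).comp ((hg x hx).comp
      (tendsto_nhdsWithin_iff.2 ⟨hε0, Eventually.of_forall hε⟩))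
    have h3 := tendsto_nhds_unique h1 (h2.congr fun n =>
      (lintegral_poisson_eq_ofReal x (hε n)).symm)
    rw [ENNReal.ofReal_mul Real.pi_pos.le] at h3
    exact (ENNReal.mul_right_inj (by simpa using Real.pi_pos) ENNReal.ofReal_ne_top).1 h3
  -- On a Lebesgue-null set the derivative of Lebesgue measure with respect to `ν` vanishes
  -- `ν`-almost everywhere. There the inverse ratios tend to infinity, which contradicts the finite
  -- Poisson limit at each point of `S`.
  have hac : ν.restrict S ≪ volume := by
    refine Measure.AbsolutelyContinuous.mk fun s hs hs0 => ?_
    rw [Measure.restrict_apply hs]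
    have hsS := hs.inter hS
    have hz : ∫⁻ x in s ∩ S, (volume : Measure ℝ).rnDeriv ν x ∂ν = 0 :=
      le_antisymm ((Measure.setLIntegral_rnDeriv_le _).trans
        ((measure_mono inter_subset_left).trans hs0.le)) zero_le
    rw [lintegral_eq_zero_iff (Measure.measurable_rnDeriv _ _)] at hz
    have hD := ae_restrict_of_ae (s := s ∩ S) (Besicovitch.ae_tendsto_rnDeriv (volume : Measure ℝ) ν)
    have hFalse : ∀ᵐ x ∂ν.restrict (s ∩ S), False := by
      filter_upwards [hz, hD, ae_restrict_mem hsS] with x hx0 hx hxS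
      rw [hx0] at hx
      have h4 : Tendsto (fun r => ν (Metric.closedBall x r) / volume (Metric.closedBall x r))
          (𝓝[>] 0) (𝓝 ⊤) := by
        have h5 := ((continuous_inv (G := ℝ≥0∞)).tendsto _).comp hx
        rw [Pi.zero_apply, ENNReal.inv_zero] at h5
        refine h5.congr' ?_
        filter_upwards [self_mem_nhdsWithin] with r (hr : 0 < r)
        rw [Function.comp_apply, ENNReal.inv_div (Or.inl (measure_ne_top _ _))
          (Or.inr (by rw [Real.volume_closedBall]; simpa using hr))]
      exact ENNReal.ofReal_ne_top (hlim x hxS.2 _ h4).symm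
    rw [← Measure.restrict_eq_zero]
    exact ae_eq_bot.1 (eventually_false_iff_eq_bot.1 hFalse)
  rw [← Measure.withDensity_rnDeriv_eq _ _ hac, ← withDensity_indicator hS]
  refine withDensity_congr_ae ?_
  filter_upwards [Measure.rnDeriv_restrict ν volume hS,
    Besicovitch.ae_tendsto_rnDeriv ν (volume : Measure ℝ)] with x hx hD
  rw [hx]
  by_cases hxS : x ∈ S
  · rw [indicator_of_mem hxS, indicator_of_mem hxS]
    exact hlim x hxS _ hD
  · rw [indicator_of_notMem hxS, indicator_of_notMem hxS]

/-! ### Radial and vertical limits -/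

/-- The point `t e^{iθ}`. -/
def polarPoint (t θ : ℝ) : ℂ := t * Complex.exp (θ * Complex.I)

theorem norm_polarPoint {t : ℝ} (ht : 0 ≤ t) (θ : ℝ) : ‖polarPoint t θ‖ = t := by
  rw [polarPoint, norm_mul, Complex.norm_exp_ofReal_mul_I, mul_one, Complex.norm_real,
    Real.norm_of_nonneg ht]

theorem joukowski_polarPoint (t θ : ℝ) :
    polarPoint t θ + (polarPoint t θ)⁻¹ =
      (((t + t⁻¹) * Real.cos θ : ℝ) : ℂ) + (((t - t⁻¹) * Real.sin θ : ℝ) : ℂ) * Complex.I := by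
  rw [polarPoint, mul_inv, ← Complex.exp_neg, ← neg_mul, ← Complex.ofReal_neg, Complex.exp_mul_I,
    Complex.exp_mul_I, ← Complex.ofReal_cos, ← Complex.ofReal_sin, ← Complex.ofReal_cos,
    ← Complex.ofReal_sin, Real.cos_neg, Real.sin_neg]
  push_cast
  ring

theorem im_joukowski_polarPoint (t θ : ℝ) :
    (polarPoint t θ + (polarPoint t θ)⁻¹).im = (t - t⁻¹) * Real.sin θ := by
  rw [joukowski_polarPoint, Complex.add_im, Complex.ofReal_im, Complex.im_ofReal_mul,
    Complex.I_im, zero_add, mul_one]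

theorem im_inv_sub_joukowski {t θ : ℝ} (x : ℝ) :
    ((polarPoint t θ + (polarPoint t θ)⁻¹ - (x : ℂ))⁻¹).im =
      ((t⁻¹ - t) * Real.sin θ) / ((x - (t + t⁻¹) * Real.cos θ) ^ 2 +
        ((t⁻¹ - t) * Real.sin θ) ^ 2) := by
  rw [joukowski_polarPoint, ← neg_sub t, neg_mul]
  generalize (t + t⁻¹) * Real.cos θ = c
  generalize (t - t⁻¹) * Real.sin θ = d
  rw [Complex.inv_im, Complex.normSq_apply]
  simp
  ring

theorem integrable_inv_sub' (μ : Measure ℝ) [IsFiniteMeasure μ] {z : ℂ} (hz : z.im ≠ 0) :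
    Integrable (fun x : ℝ => (z - (x : ℂ))⁻¹) μ := by
  refine (integrable_inv_sub μ hz).neg.congr (Eventually.of_forall fun x => ?_)
  change -((x : ℂ) - z)⁻¹ = (z - x)⁻¹
  rw [← inv_neg, neg_sub]

theorem integrable_poisson (ν : Measure ℝ) [IsFiniteMeasure ν] (c : ℝ) {ε : ℝ} (hε : 0 < ε) :
    Integrable (fun x => ε / ((x - c) ^ 2 + ε ^ 2)) ν := by
  refine (integrable_const (ε / ε ^ 2)).mono' (Continuous.aestronglyMeasurable
      (Continuous.div (by fun_prop) (by fun_prop) fun y => by positivity))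
      (Eventually.of_forall fun y => ?_)
  rw [Real.norm_of_nonneg (by positivity)]
  gcongr
  nlinarith [sq_nonneg (y - c)]

/-- Moving the centre by a small multiple `η` of the width changes the kernel only by a factor close
to one, uniformly in `x`. -/
theorem poisson_compare {x c d ε η : ℝ} (hε : 0 < ε) (hη : 0 ≤ η) (hd : |c - d| ≤ η * ε) :
    (1 - (η + η ^ 2)) * (ε / ((x - d) ^ 2 + ε ^ 2)) ≤ ε / ((x - c) ^ 2 + ε ^ 2) ∧
      ε / ((x - c) ^ 2 + ε ^ 2) ≤ (1 + (η + η ^ 2)) * (ε / ((x - d) ^ 2 + ε ^ 2)) := by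
  have hb : 0 < (x - d) ^ 2 + ε ^ 2 := by positivity
  have ha : 0 < (x - c) ^ 2 + ε ^ 2 := by positivity
  have hsq : (c - d) ^ 2 ≤ η ^ 2 * ε ^ 2 := by
    rw [← mul_pow, ← sq_abs (c - d)]
    exact pow_le_pow_left₀ (abs_nonneg _) hd 2
  have hcross : |2 * (x - c) * (c - d)| ≤ η * ((x - c) ^ 2 + ε ^ 2) := by
    rw [abs_mul, abs_mul, abs_two]
    calc 2 * |x - c| * |c - d| ≤ 2 * |x - c| * (η * ε) := by gcongr
      _ = η * (2 * |x - c| * ε) := by ring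
      _ ≤ η * ((x - c) ^ 2 + ε ^ 2) := by
          gcongr
          rw [← sq_abs (x - c)]
          nlinarith [sq_nonneg (|x - c| - ε)]
  obtain ⟨h1, h2⟩ := abs_le.1 hcross
  have hexp : (x - d) ^ 2 = (x - c) ^ 2 + 2 * (x - c) * (c - d) + (c - d) ^ 2 := by ring
  have hη2 : 0 ≤ η ^ 2 * (x - c) ^ 2 := by positivity
  constructor
  · rw [mul_div_assoc', div_le_div_iff₀ hb ha]
    have : (1 - (η + η ^ 2)) * ((x - c) ^ 2 + ε ^ 2) ≤ (x - d) ^ 2 + ε ^ 2 := by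
      have := sq_nonneg (c - d)
      have h5 : 0 ≤ η ^ 2 * ε ^ 2 := by positivity
      nlinarith
    calc (1 - (η + η ^ 2)) * ε * ((x - c) ^ 2 + ε ^ 2)
        = ε * ((1 - (η + η ^ 2)) * ((x - c) ^ 2 + ε ^ 2)) := by ring
      _ ≤ ε * ((x - d) ^ 2 + ε ^ 2) := by gcongr
  · rw [mul_div_assoc', div_le_div_iff₀ ha hb]
    have : (x - d) ^ 2 + ε ^ 2 ≤ (1 + (η + η ^ 2)) * ((x - c) ^ 2 + ε ^ 2) := by nlinarith
    calc ε * ((x - d) ^ 2 + ε ^ 2) ≤ ε * ((1 + (η + η ^ 2)) * ((x - c) ^ 2 + ε ^ 2)) := by gcongr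
      _ = _ := by ring

/-- The image of the radius under `z ↦ z + z⁻¹` is a curve whose real part differs from `2 cos θ` by
`O(ε²)` at height `ε` in absolute value, so `poisson_compare` replaces it by the vertical line. -/
theorem tendsto_poisson_of_tendsto_radial {ν : Measure ℝ} [IsFiniteMeasure ν] {θ : ℝ}
    (hθ : 0 < Real.sin θ) {F : ℂ}
    (hF : Tendsto (fun t : ℝ => ∫ x, (polarPoint t θ + (polarPoint t θ)⁻¹ - (x : ℂ))⁻¹ ∂ν) (𝓝[<] 1)
      (𝓝 F)) :
    Tendsto (fun ε : ℝ => ∫ x, ε / ((x - 2 * Real.cos θ) ^ 2 + ε ^ 2) ∂ν) (𝓝[>] 0) (𝓝 F.im) := by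
  -- `τ ε` solves `t⁻¹ - t = 2 s ε`, which makes the width `(t⁻¹ - t) sin θ` exactly `ε` and gives
  -- `t + t⁻¹ = 2 √(1 + s²)`.
  let s : ℝ → ℝ := fun ε => ε / (2 * Real.sin θ)
  let τ : ℝ → ℝ := fun ε => Real.sqrt (1 + s ε ^ 2) - s ε
  have hτpos : ∀ ε, 0 < τ ε := by
    intro ε
    have h1 : |s ε| < Real.sqrt (1 + s ε ^ 2) := by
      rw [← Real.sqrt_sq_eq_abs]
      exact Real.sqrt_lt_sqrt (sq_nonneg _) (by linarith)
    have := le_abs_self (s ε)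
    simp only [τ]
    linarith
  have hτinv : ∀ ε, (τ ε)⁻¹ = Real.sqrt (1 + s ε ^ 2) + s ε := by
    intro ε
    refine inv_eq_of_mul_eq_one_right ?_
    have := Real.sq_sqrt (by positivity : 0 ≤ 1 + s ε ^ 2)
    simp only [τ]
    nlinarith
  have hτ : Tendsto τ (𝓝[>] 0) (𝓝[<] 1) := by
    refine tendsto_nhdsWithin_iff.2 ⟨?_, ?_⟩
    · have : Continuous τ := by simp only [τ, s]; fun_prop
      have h := this.tendsto 0
      simp only [τ, s, zero_div, ne_eq, OfNat.ofNat_ne_zero, not_false_eq_true, zero_pow, add_zero,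
        Real.sqrt_one, sub_zero] at h
      exact h.mono_left nhdsWithin_le_nhds
    · filter_upwards [self_mem_nhdsWithin] with ε (hε : 0 < ε)
      have hs : 0 < s ε := by positivity
      change Real.sqrt (1 + s ε ^ 2) - s ε < 1
      rw [sub_lt_iff_lt_add, Real.sqrt_lt' (by positivity)]
      nlinarith
  have h1 := (Complex.continuous_im.tendsto _).comp (hF.comp hτ)
  set Q : ℝ → ℝ := fun ε => ∫ x, ε / ((x - 2 * Real.sqrt (1 + s ε ^ 2) * Real.cos θ) ^ 2 + ε ^ 2) ∂ν
  have hQ : Tendsto Q (𝓝[>] 0) (𝓝 F.im) := by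
    refine h1.congr' ?_
    filter_upwards [self_mem_nhdsWithin] with ε (hε : 0 < ε)
    have e1 : (τ ε)⁻¹ - τ ε = 2 * s ε := by rw [hτinv]; simp only [τ]; ring
    have e2 : τ ε + (τ ε)⁻¹ = 2 * Real.sqrt (1 + s ε ^ 2) := by rw [hτinv]; simp only [τ]; ring
    have e3 : 2 * s ε * Real.sin θ = ε := by simp only [s]; field_simp
    have him : (polarPoint (τ ε) θ + (polarPoint (τ ε) θ)⁻¹).im ≠ 0 := by
      rw [im_joukowski_polarPoint, ← neg_sub, e1, neg_mul, e3]
      simpa using hε.ne'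
    have := integral_im (integrable_inv_sub' ν him)
    refine Eq.trans this.symm ?_
    refine integral_congr_ae (Eventually.of_forall fun x => ?_)
    change ((polarPoint (τ ε) θ + (polarPoint (τ ε) θ)⁻¹ - (x : ℂ))⁻¹).im = _
    rw [im_inv_sub_joukowski, e1, e2, e3]
  let η : ℝ → ℝ := fun ε => ε / (4 * Real.sin θ ^ 2)
  have hcmp : ∀ ε, 0 < ε → |2 * Real.cos θ - 2 * Real.sqrt (1 + s ε ^ 2) * Real.cos θ| ≤
      η ε * ε := by
    intro ε hε
    have e1 : 2 * Real.cos θ - 2 * Real.sqrt (1 + s ε ^ 2) * Real.cos θ =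
        -(2 * (Real.sqrt (1 + s ε ^ 2) - 1) * Real.cos θ) := by ring
    have e2 : 1 ≤ Real.sqrt (1 + s ε ^ 2) := Real.one_le_sqrt.2 (by nlinarith [sq_nonneg (s ε)])
    have e3 : Real.sqrt (1 + s ε ^ 2) ≤ 1 + s ε ^ 2 / 2 :=
      Real.sqrt_le_iff.2 ⟨by positivity, by nlinarith [sq_nonneg (s ε ^ 2)]⟩
    have e4 : η ε * ε = s ε ^ 2 := by simp only [η, s]; field_simp; ring
    rw [e1, abs_neg, abs_mul, e4, abs_of_nonneg (by linarith)]
    calc 2 * (Real.sqrt (1 + s ε ^ 2) - 1) * |Real.cos θ|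
        ≤ 2 * (Real.sqrt (1 + s ε ^ 2) - 1) * 1 := by
          exact mul_le_mul_of_nonneg_left (Real.abs_cos_le_one θ) (by linarith)
      _ ≤ s ε ^ 2 := by linarith
  have hη0 : Tendsto (fun ε => η ε + η ε ^ 2) (𝓝[>] 0) (𝓝 0) := by
    have : Continuous fun ε => η ε + η ε ^ 2 := by simp only [η]; fun_prop
    have h := this.tendsto 0
    simp only [η, zero_div, ne_eq, OfNat.ofNat_ne_zero, not_false_eq_true, zero_pow, add_zero] at h
    exact h.mono_left nhdsWithin_le_nhds
  have hlo := (hη0.const_sub 1).mul hQ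
  have hhi := (hη0.const_add 1).mul hQ
  rw [sub_zero, one_mul] at hlo
  rw [add_zero, one_mul] at hhi
  refine tendsto_of_tendsto_of_tendsto_of_le_of_le' hlo hhi ?_ ?_
  · filter_upwards [self_mem_nhdsWithin] with ε (hε : 0 < ε)
    simp only [Q]
    rw [← integral_const_mul]
    refine integral_mono ((integrable_poisson ν _ hε).const_mul _) (integrable_poisson ν _ hε)
      fun x => ?_
    exact (poisson_compare hε (by positivity) (hcmp ε hε)).1
  · filter_upwards [self_mem_nhdsWithin] with ε (hε : 0 < ε)
    simp only [Q]
    rw [← integral_const_mul]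
    refine integral_mono (integrable_poisson ν _ hε) ((integrable_poisson ν _ hε).const_mul _)
      fun x => ?_
    exact (poisson_compare hε (by positivity) (hcmp ε hε)).2


/-! ### The Cauchy transform of a density `√(4 - x²) w` -/

theorem one_sub_mul_expMono_ne_zero {z : ℂ} (hz : ‖z‖ < 1) (k : ℤ) (φ : ℝ) :
    1 - z * expMono k φ ≠ 0 := by
  intro h
  have h1 : ‖z * expMono k φ‖ = 1 := by rw [← sub_eq_zero.1 h, norm_one]
  rw [norm_mul, norm_expMono, mul_one] at h1
  linarith

theorem two_cos_eq_expMono (φ : ℝ) : ((2 * Real.cos φ : ℝ) : ℂ) = expMono 1 φ + expMono (-1) φ := by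
  push_cast
  rw [Complex.two_cos, expMono, expMono]
  congr 2 <;> push_cast <;> ring

theorem expMono_one_mul_neg_one (φ : ℝ) : expMono 1 φ * expMono (-1) φ = 1 := by
  rw [← expMono_add, add_neg_cancel, expMono_zero]

theorem joukowski_sub_ne_zero {z : ℂ} (hz0 : z ≠ 0) (hz : ‖z‖ < 1) (φ : ℝ) :
    z + z⁻¹ - ((2 * Real.cos φ : ℝ) : ℂ) ≠ 0 := by
  have h1 := one_sub_mul_expMono_ne_zero hz 1 φ
  have h2 := one_sub_mul_expMono_ne_zero hz (-1) φ
  have h3 := expMono_one_mul_neg_one φ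
  rw [two_cos_eq_expMono]
  have : z + z⁻¹ - (expMono 1 φ + expMono (-1) φ) =
      (1 - z * expMono 1 φ) * (1 - z * expMono (-1) φ) * z⁻¹ := by
    field_simp
    linear_combination (-z ^ 2) * h3
  rw [this]
  exact mul_ne_zero (mul_ne_zero h1 h2) (inv_ne_zero hz0)

/-- With `y = z + z⁻¹` and `x = 2 cos φ`, one has `4 - x² = (4 - y²) + (y + x)(y - x)` and `4 - y² =
-(z - z⁻¹)²`. Since `y - x = z⁻¹ (1 - z e^{iφ})(1 - z e^{-iφ})`, partial fractions of `(y - x)⁻¹`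
give the two geometric kernels. -/
theorem sq_sin_mul_inv_joukowski_sub {z : ℂ} (hz0 : z ≠ 0) (hz : ‖z‖ < 1) (φ : ℝ) :
    ((4 * Real.sin φ ^ 2 : ℝ) : ℂ) * (z + z⁻¹ - ((2 * Real.cos φ : ℝ) : ℂ))⁻¹ =
      (z - z⁻¹) * ((1 - z * expMono 1 φ)⁻¹ + (1 - z * expMono (-1) φ)⁻¹ - 1) +
        ((2 * Real.cos φ : ℝ) : ℂ) + (z + z⁻¹) := by
  have h0 := joukowski_sub_ne_zero hz0 hz φ
  have hs : ((4 * Real.sin φ ^ 2 : ℝ) : ℂ) = 4 - ((2 * Real.cos φ : ℝ) : ℂ) ^ 2 := by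
    rw [Real.sin_sq]; push_cast; ring
  rw [hs]
  rw [two_cos_eq_expMono] at h0 ⊢
  have h1 := one_sub_mul_expMono_ne_zero hz 1 φ
  have h2 := one_sub_mul_expMono_ne_zero hz (-1) φ
  have h3 := expMono_one_mul_neg_one φ
  generalize expMono 1 φ = a at *
  generalize expMono (-1) φ = b at *
  have h4 : z + z⁻¹ - (a + b) = (1 - z * a) * (1 - z * b) * z⁻¹ := by
    field_simp
    linear_combination (-z ^ 2) * h3
  have h5 : (1 - z * a)⁻¹ + (1 - z * b)⁻¹ - 1 = (z⁻¹ - z) * (z + z⁻¹ - (a + b))⁻¹ := by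
    rw [h4]
    field_simp
    linear_combination (-z ^ 2) * h3
  have h6 : z * z⁻¹ = 1 := mul_inv_cancel₀ hz0
  rw [h5]
  generalize hY : z + z⁻¹ - (a + b) = Y at *
  have h7 : Y * Y⁻¹ = 1 := mul_inv_cancel₀ h0
  have h8 : 4 - (a + b) ^ 2 = (z - z⁻¹) * (z⁻¹ - z) + (a + b + (z + z⁻¹)) * Y := by
    rw [← hY]
    linear_combination (-4 : ℂ) * h6
  rw [h8]
  linear_combination (a + b + (z + z⁻¹)) * h7

theorem intervalIntegral_two_pi_of_even {w : ℝ → ℂ} (hw : Continuous w)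
    (hp : Function.Periodic w (2 * Real.pi)) (he : ∀ φ, w (-φ) = w φ) (k : ℤ) :
    ∫ φ in (0 : ℝ)..2 * Real.pi, expMono (-k) φ * w φ =
      ∫ φ in (0 : ℝ)..Real.pi, w φ * (expMono k φ + expMono (-k) φ) := by
  have hc : ∀ k : ℤ, Continuous fun φ => expMono k φ * w φ := fun k =>
    (continuous_expMono k).mul hw
  have h1 : ∫ φ in Real.pi..2 * Real.pi, expMono (-k) φ * w φ =
      ∫ φ in (0 : ℝ)..Real.pi, expMono k φ * w φ := by
    have := intervalIntegral.integral_comp_sub_left (a := 0) (b := Real.pi)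
      (fun φ => expMono (-k) φ * w φ) (2 * Real.pi)
    rw [sub_zero, show 2 * Real.pi - Real.pi = Real.pi by ring] at this
    rw [← this]
    refine intervalIntegral.integral_congr fun φ _ => ?_
    have e1 : w (2 * Real.pi - φ) = w φ := by
      rw [← he φ, sub_eq_neg_add, hp]
    have e2 : expMono (-k) (2 * Real.pi - φ) = expMono k φ := by
      rw [sub_eq_neg_add, periodic_expMono]
      simp [expMono]
    rw [e1, e2]
  rw [← intervalIntegral.integral_add_adjacent_intervals ((hc (-k)).intervalIntegrable 0 Real.pi)
    ((hc (-k)).intervalIntegrable _ _), h1, ← intervalIntegral.integral_add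
    ((hc (-k)).intervalIntegrable _ _) ((hc k).intervalIntegrable _ _)]
  refine intervalIntegral.integral_congr fun φ _ => ?_
  ring

theorem HasFourier.two_pi_mul_coeff {β : ℤ → ℂ} {w : ℝ → ℂ} (hw : HasFourier β w)
    (he : ∀ φ, w (-φ) = w φ) (k : ℤ) :
    ∫ φ in (0 : ℝ)..Real.pi, w φ * (expMono k φ + expMono (-k) φ) = 2 * Real.pi * β k := by
  rw [← intervalIntegral_two_pi_of_even hw.continuous hw.periodic he]
  have := congrFun hw.fourierCoeffOn_eq k
  rw [fourierCoeffOn_two_pi] at this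
  rw [← this, Complex.real_smul]
  have hπ : (Real.pi : ℂ) ≠ 0 := by exact_mod_cast Real.pi_ne_zero
  push_cast
  field_simp

theorem expMono_natCast (n : ℕ) (φ : ℝ) : expMono n φ = expMono 1 φ ^ n := by
  simp only [expMono, ← Complex.exp_nat_mul]
  congr 1
  push_cast
  ring

theorem expMono_neg_natCast (n : ℕ) (φ : ℝ) : expMono (-n) φ = expMono (-1) φ ^ n := by
  simp only [expMono, ← Complex.exp_nat_mul]
  congr 1
  push_cast
  ring

/-- Both kernels are geometric series in `z`, and for an even weight the half-period integral of
`e^{inφ} + e^{-inφ}` is the full Fourier integral. -/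
theorem HasFourier.hasSum_half_integral {β : ℤ → ℂ} {w : ℝ → ℂ} (hw : HasFourier β w)
    (he : ∀ φ, w (-φ) = w φ) {z : ℂ} (hz : ‖z‖ < 1) :
    HasSum (fun n : ℕ => 2 * Real.pi * β n * z ^ n)
      (∫ φ in (0 : ℝ)..Real.pi, w φ * ((1 - z * expMono 1 φ)⁻¹ + (1 - z * expMono (-1) φ)⁻¹)) := by
  have hwc := hw.continuous
  obtain ⟨K, hK⟩ := (isCompact_Icc (a := (0 : ℝ)) (b := Real.pi)).exists_bound_of_continuousOn
    hwc.continuousOn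
  have hK0 : 0 ≤ K := (norm_nonneg _).trans (hK 0 ⟨le_rfl, Real.pi_pos.le⟩)
  have h := intervalIntegral.hasSum_integral_of_dominated_convergence (μ := volume)
    (a := 0) (b := Real.pi) (F := fun (n : ℕ) φ => w φ * (expMono n φ + expMono (-n) φ) * z ^ n)
    (f := fun φ => w φ * ((1 - z * expMono 1 φ)⁻¹ + (1 - z * expMono (-1) φ)⁻¹))
    (fun n _ => K * 2 * ‖z‖ ^ n) (fun n => ?_) (fun n => ?_) ?_ ?_ ?_
  · refine h.congr_fun fun n => ?_
    rw [intervalIntegral.integral_mul_const, hw.two_pi_mul_coeff he]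
  · refine Continuous.aestronglyMeasurable ?_
    exact (hwc.mul ((continuous_expMono _).add (continuous_expMono _))).mul continuous_const
  · refine Eventually.of_forall fun φ hφ => ?_
    rw [uIoc_of_le Real.pi_pos.le] at hφ
    rw [norm_mul, norm_mul, norm_pow]
    gcongr
    · exact hK φ ⟨hφ.1.le, hφ.2⟩
    · refine (norm_add_le _ _).trans ?_
      rw [norm_expMono, norm_expMono]
      norm_num
  · exact Eventually.of_forall fun φ _ =>
      (summable_geometric_of_lt_one (norm_nonneg z) hz).mul_left _
  · exact intervalIntegrable_const
  · refine Eventually.of_forall fun φ _ => ?_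
    have g : ∀ k : ℤ, HasSum (fun n : ℕ => (z * expMono k φ) ^ n) (1 - z * expMono k φ)⁻¹ :=
      fun k => hasSum_geometric_of_norm_lt_one (by rwa [norm_mul, norm_expMono, mul_one])
    refine (((g 1).add (g (-1))).mul_left (w φ)).congr_fun fun n => ?_
    rw [expMono_natCast, expMono_neg_natCast, mul_pow, mul_pow]
    ring

/-- The power series `2π ∑_{k ≥ 1} β_k z^k + π β_0`. -/
def halfSeries (β : ℤ → ℂ) (z : ℂ) : ℂ := 2 * Real.pi * (∑' n : ℕ, β n * z ^ n) - Real.pi * β 0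

theorem continuousOn_halfSeries {β : ℤ → ℂ} (hβ : Summable fun n => ‖β n‖) :
    ContinuousOn (halfSeries β) (Metric.closedBall 0 1) := by
  have hs : Summable fun n : ℕ => ‖β n‖ := hβ.comp_injective Nat.cast_injective
  refine (continuousOn_const.mul ?_).sub continuousOn_const
  refine continuousOn_tsum (fun n => by fun_prop) hs fun n z hz => ?_
  rw [mem_closedBall_zero_iff] at hz
  rw [norm_mul, norm_pow]
  exact mul_le_of_le_one_right (norm_nonneg _) (pow_le_one₀ (norm_nonneg _) hz)

/-- The coefficients of the boundary values of `halfSeries`. -/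
def halfCoeff (β : ℤ → ℂ) (n : ℤ) : ℂ :=
  if n < 0 then 0 else 2 * Real.pi * β n - if n = 0 then Real.pi * β 0 else 0

theorem hasFourier_halfSeries {β : ℤ → ℂ} (hβ : Summable fun n => ‖β n‖) :
    HasFourier (halfCoeff β) fun θ => halfSeries β (polarPoint 1 θ) := by
  have hz : ∀ θ, polarPoint 1 θ = expMono 1 θ := fun θ => by simp [polarPoint, expMono]
  have hle : ∀ n, ‖halfCoeff β n‖ ≤ 3 * Real.pi * ‖β n‖ := by
    intro n
    have hπ := Real.pi_pos
    simp only [halfCoeff]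
    split_ifs with h1 h2
    · rw [norm_zero]; positivity
    · rw [h2]
      refine (norm_sub_le _ _).trans ?_
      simp only [norm_mul, Complex.norm_ofNat, Complex.norm_real, Real.norm_of_nonneg hπ.le]
      exact le_of_eq (by ring)
    · rw [sub_zero]
      simp only [norm_mul, Complex.norm_ofNat, Complex.norm_real, Real.norm_of_nonneg hπ.le]
      gcongr
      norm_num
  refine ⟨Summable.of_nonneg_of_le (fun n => norm_nonneg _) hle (hβ.mul_left _), fun θ => ?_⟩
  have hs : Summable fun n : ℕ => β n * expMono 1 θ ^ n := by
    refine Summable.of_norm ?_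
    simp only [norm_mul, norm_pow, norm_expMono, one_pow, mul_one]
    exact hβ.comp_injective Nat.cast_injective
  have h1 := hs.hasSum.mul_left (2 * Real.pi : ℂ)
  have h2 : HasSum (fun n : ℕ => if n = 0 then (Real.pi : ℂ) * β 0 else 0) (Real.pi * β 0) :=
    hasSum_ite_eq 0 _
  have h3 := h1.sub h2
  change HasSum _ (halfSeries β (polarPoint 1 θ))
  rw [hz, halfSeries, ← (Nat.cast_injective (R := ℤ)).hasSum_iff]
  · refine h3.congr_fun fun n => ?_
    simp only [Function.comp_apply, halfCoeff, expMono_natCast]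
    rw [if_neg (by omega)]
    rcases Nat.eq_zero_or_pos n with rfl | hn
    · simp
    · simp [hn.ne']
      ring
  · intro n hn
    have : n < 0 := by
      by_contra h
      exact hn ⟨n.toNat, by simp; omega⟩
    simp [halfCoeff, this]

theorem InAlg.halfSeries {Ahat : Set (ℤ → ℂ)} {N : (ℤ → ℂ) → ℝ≥0∞} (hN : IsAlgNorm Ahat N)
    {β : ℤ → ℂ} {w : ℝ → ℂ} (hw : InAlg Ahat w) (hβ : HasFourier β w) :
    InAlg Ahat fun θ => _root_.halfSeries β (polarPoint 1 θ) := by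
  refine hw.of_coeff_le hN hβ (hasFourier_halfSeries hβ.1) (C := 3 * Real.pi) fun n => ?_
  have hπ := Real.pi_pos
  simp only [halfCoeff]
  split_ifs with h1 h2
  · rw [norm_zero]; positivity
  · rw [h2]
    refine (norm_sub_le _ _).trans ?_
    simp only [norm_mul, Complex.norm_ofNat, Complex.norm_real, Real.norm_of_nonneg hπ.le]
    exact le_of_eq (by ring)
  · rw [sub_zero]
    simp only [norm_mul, Complex.norm_ofNat, Complex.norm_real, Real.norm_of_nonneg hπ.le]
    gcongr
    norm_num

/-- For real `w` the coefficients satisfy `β (-n) = conj (β n)`, so the half series plus its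
conjugate is `2π w`; taking only half of `β 0` avoids counting it twice. -/
theorem HasFourier.re_halfSeries {β : ℤ → ℂ} {w : ℝ → ℝ} (hβ : HasFourier β fun θ => (w θ : ℂ))
    (θ : ℝ) : (_root_.halfSeries β (polarPoint 1 θ)).re = Real.pi * w θ := by
  have hconj : ∀ n, starRingEnd ℂ (β (-n)) = β n := by
    intro n
    have h1 := hβ.conj
    simp only [Complex.conj_ofReal] at h1
    exact congrFun (h1.fourierCoeffOn_eq.symm.trans hβ.fourierCoeffOn_eq) n
  have hH := hasFourier_halfSeries hβ.1
  have hsum := (hH.add hH.conj).2 θ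
  have hw := (hβ.const_mul (2 * Real.pi)).2 θ
  have heq : ∀ n, 2 * Real.pi * β n = halfCoeff β n + starRingEnd ℂ (halfCoeff β (-n)) := by
    intro n
    rcases lt_trichotomy n 0 with h | h | h
    · have h1 : ¬ (-n < 0) := by omega
      have h2 : ¬ (-n = 0) := by omega
      rw [halfCoeff, halfCoeff, if_pos h, if_neg h1, if_neg h2, sub_zero, zero_add, map_mul, map_mul,
        hconj, Complex.conj_ofReal, Complex.conj_ofNat]
    · subst h
      have := hconj 0
      rw [neg_zero] at this
      simp only [halfCoeff, lt_irrefl, if_false, if_true, neg_zero, map_sub, map_mul, this,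
        Complex.conj_ofReal, Complex.conj_ofNat]
      ring
    · have h1 : ¬ (n < 0) := by omega
      have h2 : ¬ (n = 0) := by omega
      simp [halfCoeff, h, h1, h2]
  have h4 := hsum.unique (hw.congr_fun fun n => by
    rw [Pi.add_apply, ← heq])
  change _root_.halfSeries β (polarPoint 1 θ) + starRingEnd ℂ (_root_.halfSeries β (polarPoint 1 θ)) =
    2 * Real.pi * w θ at h4
  rw [Complex.add_conj] at h4
  have h5 : (2 * (_root_.halfSeries β (polarPoint 1 θ)).re : ℝ) = 2 * Real.pi * w θ := by
    exact_mod_cast h4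
  linarith

/-- The Cauchy transform of `√(4 - x²) w(x) dx` in the variable `z`. -/
theorem HasFourier.integral_sq_sin_mul_inv {β : ℤ → ℂ} {w : ℝ → ℝ}
    (hβ : HasFourier β fun θ => (w θ : ℂ)) (he : ∀ φ, w (-φ) = w φ) {z : ℂ} (hz0 : z ≠ 0)
    (hz : ‖z‖ < 1) :
    ∫ φ in (0 : ℝ)..Real.pi, ((4 * Real.sin φ ^ 2 * w φ : ℝ) : ℂ) *
        (z + z⁻¹ - ((2 * Real.cos φ : ℝ) : ℂ))⁻¹ =
      (z - z⁻¹) * _root_.halfSeries β z +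
        ((∫ φ in (0 : ℝ)..Real.pi, w φ * (2 * Real.cos φ) : ℝ) : ℂ) +
        (z + z⁻¹) * ((∫ φ in (0 : ℝ)..Real.pi, w φ : ℝ) : ℂ) := by
  have he' : ∀ φ, ((w (-φ) : ℝ) : ℂ) = w φ := fun φ => by rw [he]
  have hwc := hβ.continuous
  have h0 : ((∫ φ in (0 : ℝ)..Real.pi, w φ : ℝ) : ℂ) = Real.pi * β 0 := by
    have := hβ.two_pi_mul_coeff he' 0
    simp only [neg_zero, expMono_zero, intervalIntegral.integral_mul_const] at this
    rw [← intervalIntegral.integral_ofReal]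
    linear_combination this / 2
  rw [← intervalIntegral.integral_ofReal]
  have hser := (hβ.hasSum_half_integral he' hz).tsum_eq
  set S : ℝ → ℂ := fun φ => (1 - z * expMono 1 φ)⁻¹ + (1 - z * expMono (-1) φ)⁻¹
  have hSc : Continuous S :=
    ((continuous_const.sub (continuous_const.mul (continuous_expMono 1))).inv₀
      (one_sub_mul_expMono_ne_zero hz 1)).add
    ((continuous_const.sub (continuous_const.mul (continuous_expMono (-1)))).inv₀
      (one_sub_mul_expMono_ne_zero hz (-1)))
  have hpt : ∀ φ, ((4 * Real.sin φ ^ 2 * w φ : ℝ) : ℂ) *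
        (z + z⁻¹ - ((2 * Real.cos φ : ℝ) : ℂ))⁻¹ =
      ((z - z⁻¹) * (w φ * S φ) + ((w φ * (2 * Real.cos φ) : ℝ) : ℂ)) + (2 * z⁻¹) * (w φ : ℂ) := by
    intro φ
    have := sq_sin_mul_inv_joukowski_sub hz0 hz φ
    rw [Complex.ofReal_mul, mul_right_comm, this, Complex.ofReal_mul (w φ)]
    simp only [S]
    ring
  simp only [hpt]
  have i1 : Continuous fun φ => (z - z⁻¹) * (w φ * S φ) := continuous_const.mul (hwc.mul hSc)
  have i2 : Continuous fun φ => ((w φ * (2 * Real.cos φ) : ℝ) : ℂ) := by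
    push_cast
    exact hwc.mul (by fun_prop)
  have i3 : Continuous fun φ => (2 * z⁻¹) * (w φ : ℂ) := continuous_const.mul hwc
  have i12 : Continuous fun φ => (z - z⁻¹) * (w φ * S φ) + ((w φ * (2 * Real.cos φ) : ℝ) : ℂ) :=
    i1.add i2
  rw [intervalIntegral.integral_add (i12.intervalIntegrable _ _)
      (i3.intervalIntegrable _ _), intervalIntegral.integral_add (i1.intervalIntegrable _ _)
      (i2.intervalIntegrable _ _), intervalIntegral.integral_const_mul,
    intervalIntegral.integral_const_mul, intervalIntegral.integral_ofReal (f := w), ← hser, h0,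
    _root_.halfSeries]
  simp only [mul_assoc]
  rw [tsum_mul_left, tsum_mul_left]
  ring

theorem continuousOn_band_density {w : ℝ → ℝ} (hw : Continuous w) {h : ℝ → ℂ}
    (hh : ContinuousOn h (Icc (-2) 2)) :
    ContinuousOn (fun x : ℝ => ((√(4 - x ^ 2) * w (Real.arccos (x / 2)) : ℝ) : ℂ) * h x)
      (Icc (-2) 2) := by
  refine ContinuousOn.mul (Continuous.continuousOn ?_) hh
  refine Complex.continuous_ofReal.comp ?_
  exact (by fun_prop : Continuous fun x : ℝ => √(4 - x ^ 2)).mul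
    (hw.comp (Real.continuous_arccos.comp (by fun_prop)))

theorem sqrt_four_sub_sq_two_cos {φ : ℝ} (h0 : 0 ≤ φ) (hπ : φ ≤ Real.pi) :
    √(4 - (2 * Real.cos φ) ^ 2) = 2 * Real.sin φ := by
  have hs := Real.sin_nonneg_of_nonneg_of_le_pi h0 hπ
  rw [show 4 - (2 * Real.cos φ) ^ 2 = (2 * Real.sin φ) ^ 2 by
    rw [mul_pow, mul_pow, Real.cos_sq']; ring]
  exact Real.sqrt_sq (by linarith)

theorem two_cos_arccos_div {x : ℝ} (hx : x ∈ Icc (-2 : ℝ) 2) :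
    2 * Real.cos (Real.arccos (x / 2)) = x := by
  rw [Real.cos_arccos (by linarith [hx.1]) (by linarith [hx.2])]
  ring

theorem two_cos_mem_Icc (φ : ℝ) : 2 * Real.cos φ ∈ Icc (-2 : ℝ) 2 :=
  ⟨by linarith [Real.neg_one_le_cos φ], by linarith [Real.cos_le_one φ]⟩

theorem integral_band_substitution {w : ℝ → ℝ} (hw : Continuous w) {h : ℝ → ℂ}
    (hh : ContinuousOn h (Icc (-2) 2)) :
    ∫ x in Ioo (-2 : ℝ) 2, ((√(4 - x ^ 2) * w (Real.arccos (x / 2)) : ℝ) : ℂ) * h x =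
      ∫ φ in (0 : ℝ)..Real.pi, ((4 * Real.sin φ ^ 2 * w φ : ℝ) : ℂ) * h (2 * Real.cos φ) := by
  have hc := continuousOn_band_density hw hh
  rw [← integral_Ioc_eq_integral_Ioo, ← intervalIntegral.integral_of_le (by norm_num)]
  have himg : (fun φ : ℝ => 2 * Real.cos φ) '' uIcc 0 Real.pi ⊆ Icc (-2) 2 := by
    rintro _ ⟨φ, -, rfl⟩
    exact two_cos_mem_Icc φ
  have key := intervalIntegral.integral_deriv_smul_comp' (a := 0) (b := Real.pi)
    (f := fun φ : ℝ => 2 * Real.cos φ) (f' := fun φ => 2 * -Real.sin φ)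
    (g := fun x : ℝ => ((√(4 - x ^ 2) * w (Real.arccos (x / 2)) : ℝ) : ℂ) * h x)
    (fun φ _ => (Real.hasDerivAt_cos φ).const_mul 2) (by fun_prop) (hc.mono himg)
  simp only [Real.cos_zero, Real.cos_pi, mul_one, mul_neg] at key
  rw [intervalIntegral.integral_symm, ← key, ← intervalIntegral.integral_neg]
  refine intervalIntegral.integral_congr fun φ hφ => ?_
  rw [uIcc_of_le Real.pi_pos.le] at hφ
  simp only [Function.comp_apply, Complex.real_smul]
  rw [sqrt_four_sub_sq_two_cos hφ.1 hφ.2, mul_div_cancel_left₀ _ (two_ne_zero' ℝ),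
    Real.arccos_cos hφ.1 hφ.2]
  push_cast
  ring

/-! ### Cauchy transforms of measures with a band density -/

/-- A finite measure which on `(-2, 2)` has density `√(4 - x²) w / q` with a quadratic polynomial
`q`, and which outside `[-2, 2]` consists of finitely many atoms. -/
structure BandModel (ν : Measure ℝ) where
  /-- constant coefficient -/
  q0 : ℝ
  /-- linear coefficient -/
  q1 : ℝ
  /-- quadratic coefficient -/
  q2 : ℝ
  /-- the weight as a function of the angle -/
  w : ℝ → ℝ
  /-- the Fourier coefficients of the weight -/
  β : ℤ → ℂ
  /-- the positions of the atoms -/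
  E : Finset ℝ
  hasFourier : HasFourier β fun θ => (w θ : ℂ)
  even : ∀ θ, w (-θ) = w θ
  nonneg : ∀ θ, 0 ≤ w θ
  q_pos : ∀ x ∈ Ioo (-2 : ℝ) 2, 0 < q0 + q1 * x + q2 * x ^ 2
  density : ν.restrict (Ioo (-2) 2) = (volume.restrict (Ioo (-2) 2)).withDensity fun x =>
    ENNReal.ofReal (√(4 - x ^ 2) * w (Real.arccos (x / 2)) / (q0 + q1 * x + q2 * x ^ 2))
  -- Either alternative removes the endpoints from integrals of `q * h`. For `𝒱 → ℳ` there are no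
  -- edge atoms; for `ℳ → 𝒱` they are not yet excluded, and `q` is chosen to vanish there.
  edge : ∀ x, x = 2 ∨ x = -2 → q0 + q1 * x + q2 * x ^ 2 = 0 ∨ ν {x} = 0
  atoms_outside : ∀ e ∈ E, e ∉ Icc (-2 : ℝ) 2
  compl : ν (Icc (-2) 2 ∪ ↑E)ᶜ = 0

namespace BandModel

variable {ν : Measure ℝ} (D : BandModel ν)

/-- The quadratic polynomial on the real line. -/
def q (x : ℝ) : ℝ := D.q0 + D.q1 * x + D.q2 * x ^ 2

/-- The quadratic polynomial on the complex plane. -/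
def qC (y : ℂ) : ℂ := D.q0 + D.q1 * y + D.q2 * y ^ 2

theorem qC_ofReal (x : ℝ) : D.qC x = (D.q x : ℂ) := by
  simp [q, qC]

theorem continuous : Continuous D.w := by
  have := Complex.continuous_re.comp D.hasFourier.continuous
  exact this

theorem setIntegral_q_mul {h : ℝ → ℂ} (hh : ContinuousOn h (Icc (-2) 2)) :
    ∫ x in Icc (-2 : ℝ) 2, (D.q x : ℂ) * h x ∂ν =
      ∫ φ in (0 : ℝ)..Real.pi, ((4 * Real.sin φ ^ 2 * D.w φ : ℝ) : ℂ) * h (2 * Real.cos φ) := by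
  have h1 : ∫ x in Icc (-2 : ℝ) 2, (D.q x : ℂ) * h x ∂ν =
      ∫ x in Ioo (-2 : ℝ) 2, (D.q x : ℂ) * h x ∂ν := by
    refine setIntegral_eq_of_subset_of_ae_sdiff_eq_zero measurableSet_Icc.nullMeasurableSet
      Ioo_subset_Icc_self ?_
    have hp : ∀ p, p = 2 ∨ p = -2 → ∀ᵐ x ∂ν, x = p → (D.q x : ℂ) * h x = 0 := by
      intro p hp
      rcases D.edge p hp with h0 | h0
      · refine Eventually.of_forall fun x hx => ?_
        have : D.q p = 0 := h0
        rw [hx, this, Complex.ofReal_zero, zero_mul]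
      · have : ∀ᵐ x ∂ν, x ∉ ({p} : Set ℝ) := measure_eq_zero_iff_ae_notMem.1 h0
        filter_upwards [this] with x hx hxp
        exact absurd hxp hx
    filter_upwards [hp 2 (Or.inl rfl), hp (-2) (Or.inr rfl)] with x h2 h3 hx
    by_cases hx2 : x = 2
    · exact h2 hx2
    · by_cases hx3 : x = -2
      · exact h3 hx3
      · exact absurd ⟨lt_of_le_of_ne hx.1.1 (Ne.symm hx3), lt_of_le_of_ne hx.1.2 hx2⟩ hx.2
  rw [h1, ← integral_band_substitution D.continuous hh, D.density,
    integral_withDensity_eq_integral_toReal_smul₀]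
  · refine setIntegral_congr_fun measurableSet_Ioo fun x hx => ?_
    have hq : 0 < D.q x := D.q_pos x hx
    have hq' : (D.q x : ℂ) ≠ 0 := by exact_mod_cast hq.ne'
    change (ENNReal.ofReal (_ / D.q x)).toReal • _ = _
    rw [ENNReal.toReal_ofReal (div_nonneg (mul_nonneg (Real.sqrt_nonneg _) (D.nonneg _)) hq.le),
      Complex.real_smul, Complex.ofReal_div, ← mul_assoc, div_mul_cancel₀ _ hq']
  · refine Measurable.aemeasurable ?_
    have hw := D.continuous
    have : Measurable fun x : ℝ => √(4 - x ^ 2) * D.w (Real.arccos (x / 2)) :=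
      ((by fun_prop : Continuous fun x : ℝ => √(4 - x ^ 2)).mul
        (hw.comp (Real.continuous_arccos.comp (by fun_prop)))).measurable
    exact (this.div (by fun_prop)).ennreal_ofReal
  · exact Eventually.of_forall fun x => ENNReal.ofReal_lt_top

/-- The constant coefficient of the rational part of the Cauchy transform. -/
def A : ℝ := ∫ x in Icc (-2 : ℝ) 2, (D.q1 + D.q2 * x) ∂ν + ∑ e ∈ D.E, ν.real {e} * (D.q1 + D.q2 * e) +
  ∫ φ in (0 : ℝ)..Real.pi, D.w φ * (2 * Real.cos φ)

/-- The linear coefficient of the rational part of the Cauchy transform. -/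
def B : ℝ := D.q2 * (ν.real (Icc (-2) 2) + ∑ e ∈ D.E, ν.real {e}) + ∫ φ in (0 : ℝ)..Real.pi, D.w φ

/-- The rational part of the Cauchy transform multiplied by `q`. -/
def R (y : ℂ) : ℂ := D.A + D.B * y + ∑ e ∈ D.E, ((ν.real {e} * D.q e : ℝ) : ℂ) * (y - e)⁻¹

/-- Polynomial division of `q(y) - q(x)` by `y - x` trades `q(y)` for `q(x)` up to an affine
function of `y`. On the band `q(x)` cancels the denominator of the density; at the atoms it leaves
simple poles. -/
theorem cauchy_eq [IsFiniteMeasure ν] {z : ℂ} (hz0 : z ≠ 0) (hz : ‖z‖ < 1)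
    (hE : ∀ e ∈ D.E, z + z⁻¹ ≠ (e : ℂ)) :
    D.qC (z + z⁻¹) * ∫ x, (z + z⁻¹ - (x : ℂ))⁻¹ ∂ν =
      D.R (z + z⁻¹) + (z - z⁻¹) * halfSeries D.β z := by
  have hne : ∀ x ∈ Icc (-2 : ℝ) 2, z + z⁻¹ - (x : ℂ) ≠ 0 := by
    intro x hx
    have := joukowski_sub_ne_zero hz0 hz (Real.arccos (x / 2))
    rwa [two_cos_arccos_div hx] at this
  have hint := D.hasFourier.integral_sq_sin_mul_inv D.even hz0 hz
  set y := z + z⁻¹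
  have hc : ContinuousOn (fun x : ℝ => (y - (x : ℂ))⁻¹) (Icc (-2) 2) :=
    ContinuousOn.inv₀ (by fun_prop) hne
  have hci : ∀ {g : ℝ → ℂ}, ContinuousOn g (Icc (-2) 2) → IntegrableOn g (Icc (-2) 2) ν :=
    fun hg => hg.integrableOn_compact isCompact_Icc
  have hqc : ContinuousOn (fun x : ℝ => (D.q x : ℂ) * (y - (x : ℂ))⁻¹) (Icc (-2) 2) := by
    refine ContinuousOn.mul ?_ hc
    unfold q
    fun_prop
  have hdiv : ∀ x : ℝ, y - (x : ℂ) ≠ 0 → D.qC y * (y - (x : ℂ))⁻¹ =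
      (D.q x : ℂ) * (y - (x : ℂ))⁻¹ + (((D.q1 + D.q2 * x : ℝ) : ℂ) + D.q2 * y) := by
    intro x hx
    have hx' : (y - (x : ℂ)) * (y - (x : ℂ))⁻¹ = 1 := mul_inv_cancel₀ hx
    simp only [q, qC]
    push_cast
    linear_combination (D.q1 + D.q2 * (y + x)) * hx'
  rw [integral_eq_band_add_atoms D.atoms_outside D.compl (hci hc), mul_add]
  have hband : D.qC y * ∫ x in Icc (-2 : ℝ) 2, (y - (x : ℂ))⁻¹ ∂ν =
      ∫ x in Icc (-2 : ℝ) 2, (D.q x : ℂ) * (y - (x : ℂ))⁻¹ ∂ν +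
        ((∫ x in Icc (-2 : ℝ) 2, (D.q1 + D.q2 * x) ∂ν : ℝ) : ℂ) +
        ν.real (Icc (-2) 2) * (D.q2 * y) := by
    rw [← integral_const_mul, setIntegral_congr_fun measurableSet_Icc fun x hx => hdiv x (hne x hx),
      integral_add (hci hqc) (hci (by fun_prop)), integral_add (hci (by fun_prop)) (hci (by fun_prop)),
      integral_complex_ofReal, setIntegral_const, add_assoc, Complex.real_smul]
  have hatoms : D.qC y * ∑ e ∈ D.E, (ν.real {e} : ℂ) * (y - (e : ℂ))⁻¹ =
      ∑ e ∈ D.E, ((ν.real {e} * D.q e : ℝ) : ℂ) * (y - e)⁻¹ +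
        ((∑ e ∈ D.E, ν.real {e} * (D.q1 + D.q2 * e) : ℝ) : ℂ) +
        ((∑ e ∈ D.E, ν.real {e} : ℝ) : ℂ) * (D.q2 * y) := by
    push_cast
    rw [Finset.mul_sum, Finset.sum_mul, ← Finset.sum_add_distrib, ← Finset.sum_add_distrib]
    refine Finset.sum_congr rfl fun e he => ?_
    have := hdiv e (sub_ne_zero.2 (hE e he))
    push_cast at this
    linear_combination (ν.real {e} : ℂ) * this
  rw [hband, hatoms, D.setIntegral_q_mul hc, hint]
  simp only [R, A, B]
  push_cast
  ring

end BandModel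

/-! ### Boundary values on the unit circle -/

theorem polarPoint_one_sub_inv (θ : ℝ) :
    polarPoint 1 θ - (polarPoint 1 θ)⁻¹ = 2 * Real.sin θ * Complex.I := by
  rw [polarPoint, Complex.ofReal_one, one_mul, ← Complex.exp_neg, Complex.ofReal_sin, Complex.two_sin]
  rw [mul_assoc, Complex.I_mul_I, neg_mul]
  ring

theorem polarPoint_one_add_inv (θ : ℝ) :
    polarPoint 1 θ + (polarPoint 1 θ)⁻¹ = ((2 * Real.cos θ : ℝ) : ℂ) := by
  rw [polarPoint, Complex.ofReal_one, one_mul, ← Complex.exp_neg]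
  push_cast
  rw [Complex.two_cos, neg_mul]

theorem continuous_polarPoint (θ : ℝ) : Continuous fun t => polarPoint t θ := by
  unfold polarPoint
  fun_prop

theorem polarPoint_one_ne_zero (θ : ℝ) : polarPoint 1 θ ≠ 0 := by
  simp [polarPoint]

theorem tendsto_joukowski_polarPoint (θ : ℝ) :
    Tendsto (fun t => polarPoint t θ + (polarPoint t θ)⁻¹) (𝓝[<] 1)
      (𝓝 ((2 * Real.cos θ : ℝ) : ℂ)) := by
  have h : ContinuousAt (fun t => polarPoint t θ + (polarPoint t θ)⁻¹) 1 :=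
    (continuous_polarPoint θ).continuousAt.add
      ((continuous_polarPoint θ).continuousAt.inv₀ (polarPoint_one_ne_zero θ))
  have := h.tendsto
  rw [polarPoint_one_add_inv] at this
  exact this.mono_left nhdsWithin_le_nhds

theorem tendsto_sub_inv_polarPoint (θ : ℝ) :
    Tendsto (fun t => polarPoint t θ - (polarPoint t θ)⁻¹) (𝓝[<] 1)
      (𝓝 (2 * Real.sin θ * Complex.I)) := by
  have h : ContinuousAt (fun t => polarPoint t θ - (polarPoint t θ)⁻¹) 1 :=
    (continuous_polarPoint θ).continuousAt.sub
      ((continuous_polarPoint θ).continuousAt.inv₀ (polarPoint_one_ne_zero θ))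
  have := h.tendsto
  rw [polarPoint_one_sub_inv] at this
  exact this.mono_left nhdsWithin_le_nhds

theorem tendsto_halfSeries_polarPoint {β : ℤ → ℂ} (hβ : Summable fun n => ‖β n‖) (θ : ℝ) :
    Tendsto (fun t => halfSeries β (polarPoint t θ)) (𝓝[<] 1)
      (𝓝 (halfSeries β (polarPoint 1 θ))) := by
  have hmem : ∀ t ∈ Ioc (0 : ℝ) 1, polarPoint t θ ∈ Metric.closedBall (0 : ℂ) 1 := fun t ht => by
    rw [mem_closedBall_zero_iff, norm_polarPoint ht.1.le]
    exact ht.2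
  have h := (continuousOn_halfSeries hβ) _ (hmem 1 ⟨one_pos, le_rfl⟩)
  refine h.tendsto.comp (tendsto_nhdsWithin_iff.2
    ⟨(continuous_polarPoint θ).continuousAt.tendsto.mono_left nhdsWithin_le_nhds, ?_⟩)
  filter_upwards [Ioo_mem_nhdsLT one_pos] with t ht
  exact hmem t ⟨ht.1, ht.2.le⟩

namespace BandModel

variable {ν : Measure ℝ} (D : BandModel ν)

/-- The rational part of the Cauchy transform on the real line. -/
def r (x : ℝ) : ℝ := D.A + D.B * x + ∑ e ∈ D.E, ν.real {e} * D.q e * (x - e)⁻¹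

theorem R_ofReal (x : ℝ) : D.R x = (D.r x : ℂ) := by
  simp [R, r]

theorem tendsto_R {x : ℝ} (hx : x ∈ Icc (-2 : ℝ) 2) : Tendsto D.R (𝓝 (x : ℂ)) (𝓝 (D.r x : ℂ)) := by
  rw [← R_ofReal]
  have : ContinuousAt D.R (x : ℂ) := by
    unfold R
    refine ContinuousAt.add (by fun_prop) ?_
    refine tendsto_finsetSum _ fun e he => ?_
    refine (continuousAt_const.mul (ContinuousAt.inv₀ (by fun_prop) ?_))
    rw [← Complex.ofReal_sub, Complex.ofReal_ne_zero, sub_ne_zero]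
    rintro rfl
    exact D.atoms_outside _ he hx
  exact this

/-- The boundary values of the half series. -/
def C (θ : ℝ) : ℂ := halfSeries D.β (polarPoint 1 θ)

theorem re_C (θ : ℝ) : (D.C θ).re = Real.pi * D.w θ := D.hasFourier.re_halfSeries θ

theorem eventually_ne_atom (θ : ℝ) :
    ∀ᶠ t in 𝓝[<] (1 : ℝ), ∀ e ∈ D.E, polarPoint t θ + (polarPoint t θ)⁻¹ ≠ (e : ℂ) := by
  rw [Filter.eventually_all_finset]
  intro e he
  refine (tendsto_joukowski_polarPoint θ).eventually_ne ?_
  rw [Ne, Complex.ofReal_inj]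
  rintro rfl
  exact D.atoms_outside _ he (two_cos_mem_Icc θ)

theorem tendsto_q_mul_cauchy [IsFiniteMeasure ν] (θ : ℝ) :
    Tendsto (fun t => D.qC (polarPoint t θ + (polarPoint t θ)⁻¹) *
      ∫ x, (polarPoint t θ + (polarPoint t θ)⁻¹ - (x : ℂ))⁻¹ ∂ν) (𝓝[<] 1)
      (𝓝 (D.r (2 * Real.cos θ) + 2 * Real.sin θ * Complex.I * D.C θ)) := by
  refine (((D.tendsto_R (two_cos_mem_Icc θ)).comp (tendsto_joukowski_polarPoint θ)).add
    ((tendsto_sub_inv_polarPoint θ).mul (tendsto_halfSeries_polarPoint D.hasFourier.1 θ))).congr' ?_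
  filter_upwards [Ioo_mem_nhdsLT one_pos, D.eventually_ne_atom θ] with t ht hE
  have hn := norm_polarPoint (θ := θ) ht.1.le
  refine (D.cauchy_eq ?_ ?_ hE).symm
  · rw [← norm_pos_iff, hn]
    exact ht.1
  · rw [hn]
    exact ht.2

theorem tendsto_qC (θ : ℝ) : Tendsto (fun t => D.qC (polarPoint t θ + (polarPoint t θ)⁻¹)) (𝓝[<] 1)
    (𝓝 (D.q (2 * Real.cos θ) : ℂ)) := by
  rw [← qC_ofReal]
  have : Continuous D.qC := by
    unfold qC
    fun_prop
  exact this.continuousAt.tendsto.comp (tendsto_joukowski_polarPoint θ)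

theorem two_cos_mem_Ioo {θ : ℝ} (hθ : Real.sin θ ≠ 0) : 2 * Real.cos θ ∈ Ioo (-2 : ℝ) 2 := by
  have h := Real.sin_sq_add_cos_sq θ
  have h1 : 0 < Real.sin θ ^ 2 := by positivity
  constructor <;> nlinarith

theorem q_two_cos_pos {θ : ℝ} (hθ : Real.sin θ ≠ 0) : 0 < D.q (2 * Real.cos θ) :=
  D.q_pos _ (two_cos_mem_Ioo hθ)

/-- The boundary value of the Cauchy transform. -/
def F (θ : ℝ) : ℂ :=
  (D.r (2 * Real.cos θ) + 2 * Real.sin θ * Complex.I * D.C θ) / D.q (2 * Real.cos θ)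

theorem tendsto_cauchy [IsFiniteMeasure ν] {θ : ℝ} (hθ : Real.sin θ ≠ 0) :
    Tendsto (fun t => ∫ x, (polarPoint t θ + (polarPoint t θ)⁻¹ - (x : ℂ))⁻¹ ∂ν) (𝓝[<] 1)
      (𝓝 (D.F θ)) := by
  have hq : (D.q (2 * Real.cos θ) : ℂ) ≠ 0 := by exact_mod_cast (D.q_two_cos_pos hθ).ne'
  refine ((D.tendsto_q_mul_cauchy θ).div (D.tendsto_qC θ) hq).congr' ?_
  filter_upwards [(D.tendsto_qC θ).eventually_ne hq] with t ht
  exact mul_div_cancel_left₀ _ ht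

theorem im_F (θ : ℝ) : (D.F θ).im = 2 * Real.sin θ * (Real.pi * D.w θ) / D.q (2 * Real.cos θ) := by
  rw [F, Complex.div_ofReal_im, Complex.add_im, Complex.ofReal_im, zero_add, ← re_C]
  congr 1
  rw [mul_right_comm, Complex.mul_I_im]
  have : (2 : ℂ) * Real.sin θ = ((2 * Real.sin θ : ℝ) : ℂ) := by push_cast; ring
  rw [this, Complex.re_ofReal_mul]

/-- As a real point `s` tends to an edge from outside the band, `(s - 2ε) / (s - x)` is bounded by
one on the band and tends to the indicator of the edge; the remaining atoms stay away from `2ε` and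
contribute zero. -/
theorem tendsto_sub_mul_cauchy [IsFiniteMeasure ν] {ε : ℝ} (hε : ε = 1 ∨ ε = -1)
    {E : Finset ℝ} (hE : ∀ e ∈ E, e ∉ Icc (-2 : ℝ) 2) (h0 : ν (Icc (-2) 2 ∪ ↑E)ᶜ = 0)
    {s : ℝ → ℝ} (hs : Tendsto s (𝓝[<] 1) (𝓝 (2 * ε))) (hs' : ∀ᶠ t in 𝓝[<] 1, 2 < ε * s t) :
    Tendsto (fun t => ((s t : ℂ) - (2 * ε : ℝ)) * ∫ x, ((s t : ℂ) - (x : ℂ))⁻¹ ∂ν) (𝓝[<] 1)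
      (𝓝 (ν.real {2 * ε} : ℂ)) := by
  have hε2 : ε * ε = 1 := by rcases hε with rfl | rfl <;> norm_num
  have hmem : 2 * ε ∈ Icc (-2 : ℝ) 2 := by rcases hε with rfl | rfl <;> norm_num
  have hεx : ∀ x ∈ Icc (-2 : ℝ) 2, ε * x ≤ 2 := by
    intro x hx
    rcases hε with rfl | rfl <;> linarith [hx.1, hx.2]
  have hlim : ∫ x in Icc (-2 : ℝ) 2, ({2 * ε} : Set ℝ).indicator (fun _ => (1 : ℂ)) x ∂ν =
      (ν.real {2 * ε} : ℂ) := by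
    rw [integral_indicator_const _ (measurableSet_singleton _), measureReal_restrict_apply
      (measurableSet_singleton _), inter_eq_left.2 (singleton_subset_iff.2 hmem), Complex.real_smul,
      mul_one]
  have hband : Tendsto (fun t => ∫ x in Icc (-2 : ℝ) 2,
      ((s t : ℂ) - (2 * ε : ℝ)) * ((s t : ℂ) - (x : ℂ))⁻¹ ∂ν) (𝓝[<] 1)
      (𝓝 (ν.real {2 * ε} : ℂ)) := by
    rw [← hlim]
    refine tendsto_integral_filter_of_dominated_convergence (fun _ => (1 : ℝ)) ?_ ?_
      (integrable_const _) ?_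
    · refine Eventually.of_forall fun t => Measurable.aestronglyMeasurable ?_
      fun_prop
    · filter_upwards [hs'] with t ht
      filter_upwards [ae_restrict_mem measurableSet_Icc] with x hx
      have hx' := hεx x hx
      have hpos : 0 < |s t - x| := abs_pos.2 fun h => by
        have : s t = x := by linarith
        rw [this] at ht
        linarith
      rw [← Complex.ofReal_sub, ← Complex.ofReal_sub, ← Complex.ofReal_inv, norm_mul,
        Complex.norm_real, Complex.norm_real, norm_inv, Real.norm_eq_abs, Real.norm_eq_abs,
        ← div_eq_mul_inv, div_le_one hpos]
      rcases hε with rfl | rfl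
      · rw [abs_of_nonneg (by linarith), abs_of_nonneg (by linarith)]
        linarith
      · rw [abs_of_nonpos (by linarith), abs_of_nonpos (by linarith)]
        linarith
    · filter_upwards [ae_restrict_mem measurableSet_Icc] with x hx
      have hsC : Tendsto (fun t => (s t : ℂ)) (𝓝[<] 1) (𝓝 ((2 * ε : ℝ) : ℂ)) :=
        (Complex.continuous_ofReal.tendsto _).comp hs
      by_cases hxe : x = 2 * ε
      · rw [indicator_of_mem (mem_singleton_iff.2 hxe)]
        refine tendsto_const_nhds.congr' ?_
        filter_upwards [hs'] with t ht
        rw [hxe, mul_inv_cancel₀]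
        rw [← Complex.ofReal_sub, Complex.ofReal_ne_zero]
        intro h
        have : s t = 2 * ε := by linarith
        rw [this] at ht
        nlinarith
      · rw [indicator_of_notMem (by simpa using hxe)]
        have h1 := (hsC.sub_const ((2 * ε : ℝ) : ℂ)).mul ((hsC.sub_const (x : ℂ)).inv₀ (by
          rw [← Complex.ofReal_sub, Complex.ofReal_ne_zero, sub_ne_zero]
          exact Ne.symm hxe))
        rwa [sub_self, zero_mul] at h1
  have hsC : Tendsto (fun t => (s t : ℂ)) (𝓝[<] 1) (𝓝 ((2 * ε : ℝ) : ℂ)) :=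
    (Complex.continuous_ofReal.tendsto _).comp hs
  have hatoms : Tendsto (fun t => ∑ e ∈ E, ((s t : ℂ) - (2 * ε : ℝ)) *
      ((ν.real {e} : ℂ) * ((s t : ℂ) - (e : ℂ))⁻¹)) (𝓝[<] 1) (𝓝 0) := by
    rw [show 𝓝 (0 : ℂ) = 𝓝 (∑ _e ∈ E, (0 : ℂ)) by rw [Finset.sum_const_zero]]
    refine tendsto_finsetSum _ fun e he => ?_
    have h1 := (hsC.sub_const ((2 * ε : ℝ) : ℂ)).mul (((hsC.sub_const (e : ℂ)).inv₀ (by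
      rw [← Complex.ofReal_sub, Complex.ofReal_ne_zero, sub_ne_zero]
      rintro rfl
      exact hE _ he hmem)).const_mul (ν.real {e} : ℂ))
    rwa [sub_self, zero_mul] at h1
  have := hband.add hatoms
  rw [add_zero] at this
  refine this.congr' ?_
  filter_upwards [hs'] with t ht
  have hg : IntegrableOn (fun x : ℝ => ((s t : ℂ) - (x : ℂ))⁻¹) (Icc (-2) 2) ν := by
    refine ContinuousOn.integrableOn_compact isCompact_Icc (ContinuousOn.inv₀ (by fun_prop) ?_)
    intro x hx
    rw [← Complex.ofReal_sub, Complex.ofReal_ne_zero]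
    intro h
    have : s t = x := by linarith
    rw [this] at ht
    linarith [hεx x hx]
  rw [integral_eq_band_add_atoms hE h0 hg, mul_add, Finset.mul_sum, integral_const_mul]

/-- The limit of `q` times the Cauchy transform along the real radius to `ε` is computed twice. The
boundary formula gives `r (2ε)`, as `sin` vanishes; the factorization `q(y) = (y - 2ε)(q1 + q2 (y +
2ε))` gives `q'(2ε)` times the mass of the edge. -/
theorem r_edge [IsFiniteMeasure ν] {ε : ℝ} (hε : ε = 1 ∨ ε = -1) (hq : D.q (2 * ε) = 0) :
    D.r (2 * ε) = (D.q1 + 4 * ε * D.q2) * ν.real {2 * ε} := by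
  have hε2 : ε * ε = 1 := by rcases hε with rfl | rfl <;> norm_num
  obtain ⟨θ, hθ⟩ : ∃ θ : ℝ, Real.cos θ = ε ∧ Real.sin θ = 0 := by
    rcases hε with rfl | rfl
    · exact ⟨0, by simp⟩
    · exact ⟨Real.pi, by simp⟩
  have hp : ∀ t, polarPoint t θ = (t * ε : ℝ) := by
    intro t
    rw [polarPoint, Complex.exp_mul_I, ← Complex.ofReal_cos, ← Complex.ofReal_sin, hθ.1, hθ.2]
    simp
  have hj : ∀ t, polarPoint t θ + (polarPoint t θ)⁻¹ = ((t * ε + (t * ε)⁻¹ : ℝ) : ℂ) := by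
    intro t
    rw [hp]
    push_cast
    ring
  have h1 := D.tendsto_q_mul_cauchy θ
  have hs := tendsto_joukowski_polarPoint θ
  simp only [hj, hθ.1, hθ.2] at h1 hs
  have hsr : Tendsto (fun t : ℝ => t * ε + (t * ε)⁻¹) (𝓝[<] 1) (𝓝 (2 * ε)) := by
    have := (Complex.continuous_re.tendsto _).comp hs
    simpa only [Function.comp_def, Complex.ofReal_re] using this
  have hs' : ∀ᶠ t in 𝓝[<] (1 : ℝ), 2 < ε * (t * ε + (t * ε)⁻¹) := by
    filter_upwards [Ioo_mem_nhdsLT one_pos] with t ht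
    have hεi : ε⁻¹ = ε := by rcases hε with rfl | rfl <;> norm_num
    have ht0 : t * t⁻¹ = 1 := mul_inv_cancel₀ ht.1.ne'
    have e : ε * (t * ε + (t * ε)⁻¹) = t + t⁻¹ := by
      rw [mul_inv, hεi]
      linear_combination (t + t⁻¹) * hε2
    rw [e]
    have h1 : 1 < t⁻¹ := (one_lt_inv₀ ht.1).2 ht.2
    nlinarith [ht.1, ht.2]
  have h2 := tendsto_sub_mul_cauchy hε D.atoms_outside D.compl hsr hs'
  have h3 : Tendsto (fun t : ℝ => (D.q1 + D.q2 * (((t * ε + (t * ε)⁻¹ : ℝ) : ℂ) + (2 * ε : ℝ)) : ℂ))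
      (𝓝[<] 1) (𝓝 (D.q1 + D.q2 * ((2 * ε : ℝ) + (2 * ε : ℝ)))) :=
    ((((Complex.continuous_ofReal.tendsto _).comp hsr).add_const _).const_mul _).const_add _
  have h4 := tendsto_nhds_unique h1 ((h3.mul h2).congr fun t => ?_)
  · have h5 : (D.r (2 * ε) : ℂ) = (((D.q1 + 4 * ε * D.q2) * ν.real {2 * ε} : ℝ) : ℂ) := by
      rw [Complex.ofReal_zero, mul_zero, zero_mul, zero_mul, add_zero] at h4
      rw [h4]
      push_cast
      ring
    exact_mod_cast h5
  · have hq' : D.qC ((2 * ε : ℝ) : ℂ) = 0 := by rw [qC_ofReal, hq, Complex.ofReal_zero]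
    rw [← mul_assoc]
    congr 1
    simp only [qC] at hq' ⊢
    linear_combination -hq'

end BandModel

/-! ### Smooth cutoffs and the edge points of the circle -/

/-- Smoothness of `g` is required only where `f ≥ 0`, because the cutoff vanishes on the open set `f
< 0`. This permits quotients whose denominators vanish away from the point of interest. -/
theorem contDiff_smoothTransition_mul {f g : ℝ → ℝ} (hf : ContDiff ℝ ∞ f)
    (hg : ∀ θ, 0 ≤ f θ → ContDiffAt ℝ ∞ g θ) :
    ContDiff ℝ ∞ fun θ => Real.smoothTransition (f θ) * g θ := by
  rw [contDiff_iff_contDiffAt]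
  intro θ
  by_cases h : 0 ≤ f θ
  · exact ((Real.smoothTransition.contDiff.comp hf).contDiffAt).mul (hg θ h)
  · refine contDiffAt_const (c := (0 : ℝ)) |>.congr_of_eventuallyEq ?_
    filter_upwards [hf.continuous.continuousAt.eventually_lt continuousAt_const (not_le.1 h)] with
      φ hφ
    rw [Real.smoothTransition.zero_of_nonpos hφ.le, zero_mul]

theorem isCircleBump_smoothTransition {f : ℝ → ℝ} (hf : ContDiff ℝ ∞ f)
    (hp : Function.Periodic f (2 * Real.pi)) :
    IsCircleBump fun θ => Real.smoothTransition (f θ) :=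
  ⟨Real.smoothTransition.contDiff.comp hf, fun θ => congrArg _ (hp θ), fun _ =>
    ⟨Real.smoothTransition.nonneg _, Real.smoothTransition.le_one _⟩⟩

theorem eventually_smoothTransition_eq_one {f : ℝ → ℝ} (hf : ContDiff ℝ ∞ f) {θ₀ : ℝ}
    (h : 1 < f θ₀) : ∀ᶠ θ in 𝓝 θ₀, Real.smoothTransition (f θ) = 1 := by
  filter_upwards [continuousAt_const.eventually_lt hf.continuous.continuousAt h] with θ hθ
  exact Real.smoothTransition.one_of_one_le hθ.le

theorem smoothTransition_ne_zero {x : ℝ} (h : Real.smoothTransition x ≠ 0) : 0 < x := by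
  by_contra h'
  exact h (Real.smoothTransition.zero_of_nonpos (not_lt.1 h'))

theorem exists_int_mem_Ioo_of_cos_pos {θ : ℝ} (h : 0 < Real.cos θ) :
    ∃ k : ℤ, θ + k * (2 * Real.pi) ∈ Ioo (-(Real.pi / 2)) (Real.pi / 2) := by
  obtain ⟨k, hk, -⟩ := existsUnique_add_zsmul_mem_Ico Real.two_pi_pos θ (-Real.pi)
  rw [zsmul_eq_mul] at hk
  refine ⟨k, ?_⟩
  have hc : 0 < Real.cos (θ + k * (2 * Real.pi)) := by rwa [Real.cos_add_int_mul_two_pi]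
  generalize θ + k * (2 * Real.pi) = φ at *
  have hpi := Real.pi_pos
  constructor
  · by_contra h1
    rw [← Real.cos_neg] at hc
    linarith [Real.cos_nonpos_of_pi_div_two_le_of_le (x := -φ) (by linarith) (by linarith [hk.1])]
  · by_contra h1
    linarith [Real.cos_nonpos_of_pi_div_two_le_of_le (x := φ) (by linarith) (by linarith [hk.2])]

/-- The points `0` and `π`, which correspond to the edges `2ε` of the band. -/
def IsEdge (ε θ₀ : ℝ) : Prop := ε = 1 ∧ θ₀ = 0 ∨ ε = -1 ∧ θ₀ = Real.pi

namespace IsEdge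

variable {ε θ₀ : ℝ}

theorem eps (h : IsEdge ε θ₀) : ε = 1 ∨ ε = -1 := h.imp And.left And.left

theorem eps_mul_self (h : IsEdge ε θ₀) : ε * ε = 1 := by rcases h.eps with rfl | rfl <;> norm_num

theorem cos (h : IsEdge ε θ₀) : Real.cos θ₀ = ε := by
  rcases h with ⟨rfl, rfl⟩ | ⟨rfl, rfl⟩ <;> simp

theorem sin (h : IsEdge ε θ₀) : Real.sin θ₀ = 0 := by
  rcases h with ⟨rfl, rfl⟩ | ⟨rfl, rfl⟩ <;> simp

theorem exists_int (h : IsEdge ε θ₀) {θ : ℝ} (hθ : 0 < ε * Real.cos θ) :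
    ∃ k : ℤ, θ + k * (2 * Real.pi) ∈ Ioo (θ₀ - Real.pi / 2) (θ₀ + Real.pi / 2) := by
  rcases h with ⟨rfl, rfl⟩ | ⟨rfl, rfl⟩
  · obtain ⟨k, hk⟩ := exists_int_mem_Ioo_of_cos_pos (θ := θ) (by linarith)
    exact ⟨k, by simpa using hk⟩
  · obtain ⟨k, hk⟩ := exists_int_mem_Ioo_of_cos_pos (θ := θ - Real.pi) (by
      rw [Real.cos_sub_pi]; linarith)
    exact ⟨k, by linarith [hk.1], by linarith [hk.2]⟩

theorem eps_mul_cos_pos (h : IsEdge ε θ₀) {θ : ℝ} (hθ : θ ∈ Ioo (θ₀ - Real.pi / 2) (θ₀ + Real.pi / 2)) :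
    0 < ε * Real.cos θ := by
  rcases h with ⟨rfl, rfl⟩ | ⟨rfl, rfl⟩
  · rw [one_mul]
    exact Real.cos_pos_of_mem_Ioo ⟨by linarith [hθ.1], by linarith [hθ.2]⟩
  · have := Real.cos_neg_of_pi_div_two_lt_of_lt (x := θ) (by linarith [hθ.1]) (by linarith [hθ.2])
    linarith

/-- The spectral variable is a double function of the angle at an edge: `x - 2ε` equals `sin² θ` up
to a factor that is smooth and nonzero there. -/
theorem two_cos_sub (h : IsEdge ε θ₀) {θ : ℝ} (hθ : 1 + ε * Real.cos θ ≠ 0) :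
    2 * Real.cos θ - 2 * ε = -2 * ε * Real.sin θ ^ 2 / (1 + ε * Real.cos θ) := by
  rw [eq_div_iff hθ, Real.sin_sq]
  linear_combination (-2 * Real.cos θ) * h.eps_mul_self

end IsEdge

/-! ### Local forms of the boundary values of a band model -/

namespace BandModel

variable {ν : Measure ℝ} (D : BandModel ν)

theorem contDiff_r : ContDiff ℝ ∞ fun θ => D.r (2 * Real.cos θ) := by
  unfold r
  refine ContDiff.add (by fun_prop) (ContDiff.sum fun e he => contDiff_const.mul ?_)
  refine ContDiff.inv (by fun_prop) fun θ => ?_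
  rw [sub_ne_zero]
  rintro rfl
  exact D.atoms_outside _ he (two_cos_mem_Icc θ)

theorem contDiff_q : ContDiff ℝ ∞ fun θ => D.q (2 * Real.cos θ) := by
  unfold q
  fun_prop

/-- The difference quotient of `r` at `p`. -/
def slopeR (p x : ℝ) : ℝ := D.B - ∑ e ∈ D.E, ν.real {e} * D.q e * ((x - e)⁻¹ * (p - e)⁻¹)

theorem r_eq {p x : ℝ} (hp : p ∈ Icc (-2 : ℝ) 2) (hx : x ∈ Icc (-2 : ℝ) 2) :
    D.r x = D.r p + (x - p) * D.slopeR p x := by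
  simp only [r, slopeR]
  rw [mul_sub, Finset.mul_sum]
  have : ∑ e ∈ D.E, ν.real {e} * D.q e * (x - e)⁻¹ = ∑ e ∈ D.E, ν.real {e} * D.q e * (p - e)⁻¹ -
      ∑ e ∈ D.E, (x - p) * (ν.real {e} * D.q e * ((x - e)⁻¹ * (p - e)⁻¹)) := by
    rw [← Finset.sum_sub_distrib]
    refine Finset.sum_congr rfl fun e he => ?_
    have h1 : x - e ≠ 0 := by
      rw [sub_ne_zero]
      rintro rfl
      exact D.atoms_outside _ he hx
    have h2 : p - e ≠ 0 := by
      rw [sub_ne_zero]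
      rintro rfl
      exact D.atoms_outside _ he hp
    have h1' : (x - e) * (x - e)⁻¹ = 1 := mul_inv_cancel₀ h1
    have h2' : (p - e) * (p - e)⁻¹ = 1 := mul_inv_cancel₀ h2
    linear_combination (ν.real {e} * D.q e) * ((p - e)⁻¹ * h1' - (x - e)⁻¹ * h2')
  rw [this]
  ring

theorem contDiff_slopeR (p : ℝ) : ContDiff ℝ ∞ fun θ => D.slopeR p (2 * Real.cos θ) := by
  unfold slopeR
  refine ContDiff.sub (by fun_prop) (ContDiff.sum fun e he => contDiff_const.mul (ContDiff.mul ?_ ?_))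
  · refine ContDiff.inv (by fun_prop) fun θ => ?_
    rw [sub_ne_zero]
    rintro rfl
    exact D.atoms_outside _ he (two_cos_mem_Icc θ)
  · exact contDiff_const

variable {Ahat : Set (ℤ → ℂ)} {N : (ℤ → ℂ) → ENNReal}

theorem re_two_mul_C (θ : ℝ) : (2 * D.C θ).re = 2 * (Real.pi * D.w θ) := by
  rw [← re_C]
  simp

theorem inAlg_C (hN : IsAlgNorm Ahat N) (hw : InAlg Ahat fun θ => (D.w θ : ℂ)) : InAlg Ahat D.C :=
  hw.halfSeries hN D.hasFourier

/-- Common shape of all local forms. Since `g₁` and `g₂` are real, the imaginary part comes from `g₁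
* Re C = g₁ * π w` alone. -/
theorem inAlg_smooth_mul_C_add (hN : IsAlgNorm Ahat N) (hw : InAlg Ahat fun θ => (D.w θ : ℂ))
    {f g₁ g₂ : ℝ → ℝ} (hf : ContDiff ℝ ∞ f) (hp : Function.Periodic f (2 * Real.pi))
    (h₁ : ∀ θ, 0 ≤ f θ → ContDiffAt ℝ ∞ g₁ θ) (h₂ : ∀ θ, 0 ≤ f θ → ContDiffAt ℝ ∞ g₂ θ)
    (hp₁ : Function.Periodic g₁ (2 * Real.pi)) (hp₂ : Function.Periodic g₂ (2 * Real.pi)) :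
    InAlg Ahat fun θ => (Real.smoothTransition (f θ) : ℂ) *
      (g₁ θ * (2 * Complex.I * D.C θ) + g₂ θ) := by
  have e1 := InAlg.smooth_mul hN (contDiff_smoothTransition_mul hf h₁)
    (fun θ => by change _ * g₁ (_ + _) = _; rw [hp, hp₁]) ((D.inAlg_C hN hw).const_mul hN (2 * Complex.I))
  have e2 := hN.smooth (f := fun θ => ((Real.smoothTransition (f θ) * g₂ θ : ℝ) : ℂ))
    (Complex.ofRealCLM.contDiff.comp (contDiff_smoothTransition_mul hf h₂))
    (fun θ => by change ((_ * g₂ (_ + _) : ℝ) : ℂ) = _; rw [hp, hp₂])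
  convert e1.add hN e2 using 2
  push_cast
  ring

theorem inAlgLoc_F (hN : IsAlgNorm Ahat N) (hw : InAlg Ahat fun θ => (D.w θ : ℂ)) {θ₀ : ℝ}
    (h : Real.sin θ₀ ≠ 0) : InAlgLoc Ahat D.F θ₀ := by
  have hs : 0 < Real.sin θ₀ ^ 2 := by positivity
  -- `f` is `3` at `θ₀` and `-1` at the zeros of `sin`, so the cutoff is one near `θ₀` and its
  -- support avoids the edges.
  set f : ℝ → ℝ := fun θ => 4 / Real.sin θ₀ ^ 2 * Real.sin θ ^ 2 - 1
  have hf : ContDiff ℝ ∞ f := by fun_prop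
  have hp : Function.Periodic f (2 * Real.pi) := fun θ => by simp only [f, Real.sin_add_two_pi]
  have hsin : ∀ θ, 0 ≤ f θ → Real.sin θ ≠ 0 := by
    intro θ h1 h2
    simp only [f, h2] at h1
    norm_num at h1
  have hq : ∀ θ, 0 ≤ f θ → D.q (2 * Real.cos θ) ≠ 0 := fun θ h1 => (D.q_two_cos_pos (hsin θ h1)).ne'
  refine ⟨_, isCircleBump_smoothTransition hf hp, eventually_smoothTransition_eq_one hf ?_, ?_⟩
  · simp only [f]
    rw [div_mul_cancel₀ _ hs.ne']
    norm_num
  · have := D.inAlg_smooth_mul_C_add hN hw hf hp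
      (g₁ := fun θ => Real.sin θ / D.q (2 * Real.cos θ))
      (g₂ := fun θ => D.r (2 * Real.cos θ) / D.q (2 * Real.cos θ))
      (fun θ h1 => (Real.contDiff_sin.contDiffAt).div D.contDiff_q.contDiffAt (hq θ h1))
      (fun θ h1 => D.contDiff_r.contDiffAt.div D.contDiff_q.contDiffAt (hq θ h1))
      (fun θ => by simp only [Real.sin_add_two_pi, Real.cos_add_two_pi])
      (fun θ => by simp only [Real.cos_add_two_pi])
    convert this using 2
    simp only [F]
    push_cast
    ring

theorem q_two_cos_ne_zero {ε θ₀ : ℝ} (he : IsEdge ε θ₀) (hq : D.q (2 * ε) ≠ 0) {θ : ℝ}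
    (h : 0 < 1 + ε * Real.cos θ) : D.q (2 * Real.cos θ) ≠ 0 := by
  by_cases hs : Real.sin θ = 0
  · rcases Real.sin_eq_zero_iff_cos_eq.1 hs with hc | hc <;> rcases he.eps with rfl | rfl <;>
      rw [hc] at h ⊢ <;> first | exact hq | norm_num at h
  · exact (D.q_two_cos_pos hs).ne'

/-- Both `r` and `q` differ from their edge values by multiples of `sin² θ`. Subtracting `r(2ε) /
q(2ε)` leaves a numerator divisible by `sin θ`, and the quotient has imaginary part `2π w / q ≠ 0`.
-/
theorem edgeForm_of_ne_zero (hN : IsAlgNorm Ahat N) (hw : InAlg Ahat fun θ => (D.w θ : ℂ))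
    (hpos : ∀ θ, 0 < D.w θ) {ε θ₀ : ℝ} (he : IsEdge ε θ₀) (hq : D.q (2 * ε) ≠ 0) :
    EdgeForm Ahat D.F θ₀ := by
  have hmem : 2 * ε ∈ Icc (-2 : ℝ) 2 := he.cos ▸ two_cos_mem_Icc θ₀
  -- The wider cutoff `f₁ = f + 1` builds `G`: it equals one on the whole arc `ε cos θ > 0`, which
  -- carries the bump from `f`, while `1 + ε cos θ` stays positive on its support.
  set f₁ : ℝ → ℝ := fun θ => 2 * (ε * Real.cos θ) + 1
  set f : ℝ → ℝ := fun θ => 2 * (ε * Real.cos θ)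
  have hf₁ : ContDiff ℝ ∞ f₁ := by fun_prop
  have hf : ContDiff ℝ ∞ f := by fun_prop
  have hp₁ : Function.Periodic f₁ (2 * Real.pi) := fun θ => by simp only [f₁, Real.cos_add_two_pi]
  have hp : Function.Periodic f (2 * Real.pi) := fun θ => by simp only [f, Real.cos_add_two_pi]
  have hd : ∀ θ, 0 ≤ f₁ θ → 0 < 1 + ε * Real.cos θ := fun θ h => by
    simp only [f₁] at h
    linarith
  have hq' : ∀ θ, 0 ≤ f₁ θ → D.q (2 * Real.cos θ) ≠ 0 := fun θ h =>
    D.q_two_cos_ne_zero he hq (hd θ h)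
  have hdc : ContDiff ℝ ∞ fun θ => 1 + ε * Real.cos θ := by fun_prop
  have hG := D.inAlg_smooth_mul_C_add hN hw hf₁ hp₁
    (g₁ := fun θ => 1 / D.q (2 * Real.cos θ))
    (g₂ := fun θ => -2 * ε * Real.sin θ * D.slopeR (2 * ε) (2 * Real.cos θ) /
        (1 + ε * Real.cos θ) / D.q (2 * Real.cos θ) +
      D.r (2 * ε) * Real.sin θ * (2 * ε * (D.q1 + D.q2 * (2 * Real.cos θ + 2 * ε))) /
        (1 + ε * Real.cos θ) / D.q (2 * Real.cos θ) / D.q (2 * ε))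
    (fun θ h => contDiffAt_const.div D.contDiff_q.contDiffAt (hq' θ h))
    (fun θ h => by
      have hs := D.contDiff_slopeR (2 * ε)
      refine ContDiffAt.add (((ContDiff.contDiffAt (by fun_prop)).div hdc.contDiffAt
        (hd θ h).ne').div D.contDiff_q.contDiffAt (hq' θ h)) ?_
      exact (((ContDiff.contDiffAt (by fun_prop)).div hdc.contDiffAt
        (hd θ h).ne').div D.contDiff_q.contDiffAt (hq' θ h)).div contDiffAt_const hq)
    (fun θ => by simp only [Real.cos_add_two_pi])
    (fun θ => by simp only [Real.cos_add_two_pi, Real.sin_add_two_pi])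
  refine ⟨_, _, _, ?_, isCircleBump_smoothTransition hf hp, eventually_smoothTransition_eq_one hf ?_,
    fun θ h => he.exists_int (by
      have := smoothTransition_ne_zero h
      simp only [f] at this
      linarith), _, hG, fun θ h => ?_, Or.inr ⟨D.r (2 * ε) / D.q (2 * ε), fun θ hs => ?_⟩⟩
  · constructor <;> linarith [Real.pi_pos]
  · simp only [f]
    rw [he.cos, he.eps_mul_self]
    norm_num
  · have h1 := he.eps_mul_cos_pos h
    have h2 : f₁ θ = 2 * (ε * Real.cos θ) + 1 := rfl
    have h3 := hq' θ (by linarith)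
    rw [Real.smoothTransition.one_of_one_le (by linarith), Complex.ofReal_one, one_mul,
      Complex.add_im, Complex.ofReal_im, add_zero, Complex.im_ofReal_mul, mul_right_comm,
      Complex.mul_I_im, re_two_mul_C]
    have := hpos θ
    have := Real.pi_pos
    positivity
  · by_cases h0 : f θ ≤ 0
    · rw [Real.smoothTransition.zero_of_nonpos h0]
      simp
    · have h1 : 1 ≤ f₁ θ := by
        have : f₁ θ = f θ + 1 := rfl
        linarith
      rw [Real.smoothTransition.one_of_one_le h1]
      congr 1
      have h2 := D.r_eq hmem (two_cos_mem_Icc θ)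
      have h3 := (hd θ (by linarith)).ne'
      have h4 := hq' θ (by linarith)
      have h5 := he.two_cos_sub h3
      have h6 : D.q (2 * Real.cos θ) * (1 + ε * Real.cos θ) = D.q (2 * ε) * (1 + ε * Real.cos θ) -
          2 * ε * Real.sin θ ^ 2 * (D.q1 + D.q2 * (2 * Real.cos θ + 2 * ε)) := by
        rw [eq_div_iff h3] at h5
        simp only [q]
        linear_combination (D.q1 + D.q2 * (2 * Real.cos θ + 2 * ε)) * h5
      rw [F, h2, h5]
      generalize D.q1 + D.q2 * (2 * Real.cos θ + 2 * ε) = P at *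
      generalize D.q (2 * Real.cos θ) = Q at *
      generalize D.q (2 * ε) = Q₀ at *
      generalize 1 + ε * Real.cos θ = d at *
      generalize Real.sin θ = s at *
      have h3' : (d : ℂ) ≠ 0 := by exact_mod_cast h3
      have h4' : (Q : ℂ) ≠ 0 := by exact_mod_cast h4
      have h7 : (Q₀ : ℂ) ≠ 0 := by exact_mod_cast hq
      have h6' : (Q : ℂ) * d = Q₀ * d - 2 * ε * s ^ 2 * P := by exact_mod_cast h6
      push_cast
      field_simp
      linear_combination (-D.r (2 * ε) : ℂ) * h6'

/-- Here `r` and `q` both contain the factor `x - 2ε`, a multiple of `sin² θ`. In the quotient the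
term `sin θ C` dominates, leaving `1 / sin θ`. The condition on `q1` and `q2` says that the zero of
`q` is simple. -/
theorem edgeForm_of_eq_zero (hN : IsAlgNorm Ahat N) (hw : InAlg Ahat fun θ => (D.w θ : ℂ))
    (hpos : ∀ θ, 0 < D.w θ) {ε θ₀ : ℝ} (he : IsEdge ε θ₀) (hq : D.q (2 * ε) = 0)
    (hr : D.r (2 * ε) = 0) (hq1 : D.q1 + 4 * ε * D.q2 ≠ 0) : EdgeForm Ahat D.F θ₀ := by
  have hmem : 2 * ε ∈ Icc (-2 : ℝ) 2 := he.cos ▸ two_cos_mem_Icc θ₀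
  have hε0 : ε ≠ 0 := by rcases he.eps with rfl | rfl <;> norm_num
  set f₁ : ℝ → ℝ := fun θ => 2 * (ε * Real.cos θ) + 1
  set f : ℝ → ℝ := fun θ => 2 * (ε * Real.cos θ)
  have hf₁ : ContDiff ℝ ∞ f₁ := by fun_prop
  have hf : ContDiff ℝ ∞ f := by fun_prop
  have hp₁ : Function.Periodic f₁ (2 * Real.pi) := fun θ => by simp only [f₁, Real.cos_add_two_pi]
  have hp : Function.Periodic f (2 * Real.pi) := fun θ => by simp only [f, Real.cos_add_two_pi]
  have hd : ∀ θ, 0 ≤ f₁ θ → 0 < 1 + ε * Real.cos θ := fun θ h => by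
    simp only [f₁] at h
    linarith
  have hfac : ∀ θ, D.q (2 * Real.cos θ) =
      (2 * Real.cos θ - 2 * ε) * (D.q1 + D.q2 * (2 * Real.cos θ + 2 * ε)) := fun θ => by
    simp only [q] at hq ⊢
    linear_combination hq
  have hP : ∀ θ, 0 ≤ f₁ θ → D.q1 + D.q2 * (2 * Real.cos θ + 2 * ε) ≠ 0 := by
    intro θ h h1
    by_cases hs : Real.sin θ = 0
    · have hc : Real.cos θ = ε := by
        have h2 := hd θ h
        rcases Real.sin_eq_zero_iff_cos_eq.1 hs with hc | hc <;> rcases he.eps with rfl | rfl <;>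
          rw [hc] at h2 ⊢ <;> norm_num at h2
      rw [hc] at h1
      exact hq1 (by linear_combination h1)
    · have h2 := D.q_two_cos_pos hs
      rw [hfac, h1, mul_zero] at h2
      exact lt_irrefl _ h2
  have hPc : ContDiff ℝ ∞ fun θ => D.q1 + D.q2 * (2 * Real.cos θ + 2 * ε) := by fun_prop
  have hG := D.inAlg_smooth_mul_C_add hN hw hf₁ hp₁
    (g₁ := fun θ => (1 + ε * Real.cos θ) / (-2 * ε) / (D.q1 + D.q2 * (2 * Real.cos θ + 2 * ε)))
    (g₂ := fun θ => Real.sin θ * D.slopeR (2 * ε) (2 * Real.cos θ) /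
      (D.q1 + D.q2 * (2 * Real.cos θ + 2 * ε)))
    (fun θ h => (ContDiff.contDiffAt (by fun_prop)).div hPc.contDiffAt (hP θ h))
    (fun θ h => by
      have hs := D.contDiff_slopeR (2 * ε)
      exact (ContDiff.contDiffAt (by fun_prop)).div hPc.contDiffAt (hP θ h))
    (fun θ => by simp only [Real.cos_add_two_pi])
    (fun θ => by simp only [Real.cos_add_two_pi, Real.sin_add_two_pi])
  refine ⟨_, _, _, ?_, isCircleBump_smoothTransition hf hp, eventually_smoothTransition_eq_one hf ?_,
    fun θ h => he.exists_int (by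
      have := smoothTransition_ne_zero h
      simp only [f] at this
      linarith), _, hG, fun θ h => ?_, Or.inl fun θ hs => ?_⟩
  · constructor <;> linarith [Real.pi_pos]
  · simp only [f]
    rw [he.cos, he.eps_mul_self]
    norm_num
  · have h1 := he.eps_mul_cos_pos h
    have h2 : f₁ θ = 2 * (ε * Real.cos θ) + 1 := rfl
    have h3 := hP θ (by linarith)
    have h4 := hd θ (by linarith)
    rw [Real.smoothTransition.one_of_one_le (by linarith), Complex.ofReal_one, one_mul,
      Complex.add_im, Complex.ofReal_im, add_zero, Complex.im_ofReal_mul, mul_right_comm,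
      Complex.mul_I_im, re_two_mul_C]
    have := hpos θ
    have := Real.pi_pos
    positivity
  · by_cases h0 : f θ ≤ 0
    · rw [Real.smoothTransition.zero_of_nonpos h0]
      simp
    · have h1 : 1 ≤ f₁ θ := by
        have : f₁ θ = f θ + 1 := rfl
        linarith
      rw [Real.smoothTransition.one_of_one_le h1]
      congr 1
      have h2 := D.r_eq hmem (two_cos_mem_Icc θ)
      have h3 := (hd θ (by linarith)).ne'
      have h4 := hP θ (by linarith)
      rw [F, h2, hr, zero_add, hfac, he.two_cos_sub h3]
      generalize D.q1 + D.q2 * (2 * Real.cos θ + 2 * ε) = P at *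
      generalize 1 + ε * Real.cos θ = d at *
      generalize Real.sin θ = s at *
      have h3' : (d : ℂ) ≠ 0 := by exact_mod_cast h3
      have h4' : (P : ℂ) ≠ 0 := by exact_mod_cast h4
      have h5 : (s : ℂ) ≠ 0 := by exact_mod_cast hs
      have h6 : (ε : ℂ) ≠ 0 := by exact_mod_cast hε0
      push_cast
      field_simp
      ring

end BandModel

/-! ### From the class `𝒱` to the class `ℳ` -/

theorem JacobiMatrix.MFunction_polarPoint (J : JacobiMatrix) {t θ : ℝ} (ht : t ∈ Ioo (0 : ℝ) 1)
    (hθ : Real.sin θ ≠ 0) : J.MFunction (polarPoint t θ) =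
      ∫ x, (polarPoint t θ + (polarPoint t θ)⁻¹ - (x : ℂ))⁻¹ ∂J.spectralMeasure := by
  refine J.MFunction_eq_integral ?_
  rw [im_joukowski_polarPoint]
  have : 1 < t⁻¹ := (one_lt_inv₀ ht.1).2 ht.2
  exact mul_ne_zero (by linarith [ht.2]) hθ

/-- At an edge where `q` vanishes, the absence of an atom forces `r` to vanish too; this is exactly
what separates the `G / sin θ` form from a worse singularity. -/
theorem JacobiMatrix.memM_of_bandModel (J : JacobiMatrix) {Ahat : Set (ℤ → ℂ)}
    {N : (ℤ → ℂ) → ENNReal} (hN : IsAlgNorm Ahat N) (D : BandModel J.spectralMeasure)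
    (hw : InAlg Ahat fun θ => (D.w θ : ℂ)) (hpos : ∀ θ, 0 < D.w θ)
    (hedge : ∀ ε : ℝ, ε = 1 ∨ ε = -1 → D.q (2 * ε) = 0 →
      J.spectralMeasure {2 * ε} = 0 ∧ D.q1 + 4 * ε * D.q2 ≠ 0) : MemM Ahat J.MFunction := by
  have he : ∀ {ε θ₀ : ℝ}, IsEdge ε θ₀ → EdgeForm Ahat D.F θ₀ := by
    intro ε θ₀ h
    by_cases hq : D.q (2 * ε) = 0
    · obtain ⟨h1, h2⟩ := hedge ε h.eps hq
      refine D.edgeForm_of_eq_zero hN hw hpos h hq ?_ h2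
      rw [D.r_edge h.eps hq, measureReal_def, h1, ENNReal.toReal_zero, mul_zero]
    · exact D.edgeForm_of_ne_zero hN hw hpos h hq
  refine ⟨D.F, fun θ hθ => ?_, fun α β h θ hθ => ⟨D.inAlgLoc_F hN hw (h θ hθ), ?_⟩,
    he (Or.inl ⟨rfl, rfl⟩), he (Or.inr ⟨rfl, rfl⟩)⟩
  · refine (D.tendsto_cauchy hθ).congr' ?_
    filter_upwards [Ioo_mem_nhdsLT one_pos] with t ht
    exact (J.MFunction_polarPoint ht hθ).symm
  · rw [D.im_F]
    have := hpos θ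
    have := Real.pi_pos
    have := D.q_two_cos_pos (h θ hθ)
    have := h θ hθ
    positivity

/-- The linear factor `1` or `2 + x` which turns `√(2 + x)^l` into `√(2 + x)`. -/
theorem exists_sqrt_zpow_eq {l : ℤ} (hl : l = 1 ∨ l = -1) :
    ∃ c d : ℝ, (c = 1 ∧ d = 0 ∨ c = 2 ∧ d = 1) ∧ ∀ x, 0 < 2 + x → 0 < c + d * x ∧
      √(2 + x) ^ l = √(2 + x) / (c + d * x) := by
  rcases hl with rfl | rfl
  · exact ⟨1, 0, Or.inl ⟨rfl, rfl⟩, fun x hx => by simp⟩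
  · refine ⟨2, 1, Or.inr ⟨rfl, rfl⟩, fun x hx => ⟨by linarith, ?_⟩⟩
    rw [one_mul, zpow_neg_one, Real.sqrt_div_self]

theorem restrict_Ioo_eq_withDensity {ν : Measure ℝ} {f g : ℝ → ENNReal} {a b : ℝ}
    (h : ν.restrict (Icc a b) = (volume.restrict (Icc a b)).withDensity f)
    (hfg : ∀ x ∈ Ioo a b, f x = g x) :
    ν.restrict (Ioo a b) = (volume.restrict (Ioo a b)).withDensity g := by
  have h1 : ∀ μ : Measure ℝ, (μ.restrict (Icc a b)).restrict (Ioo a b) = μ.restrict (Ioo a b) :=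
    fun μ => Measure.restrict_restrict_of_subset Ioo_subset_Icc_self
  rw [← h1 ν, h, restrict_withDensity measurableSet_Ioo, h1]
  refine withDensity_congr_ae ?_
  filter_upwards [ae_restrict_mem measurableSet_Ioo] with x hx
  exact hfg x hx

theorem JacobiMatrix.memM_of_memV (J : JacobiMatrix) {Ahat : Set (ℤ → ℂ)}
    {N : (ℤ → ℂ) → ENNReal} (hN : IsAlgNorm Ahat N) (h : J.MemV Ahat) : MemM Ahat J.MFunction := by
  obtain ⟨⟨hfin, -⟩, l, r, v₀, hl, hr, hv, hlog, hd⟩ := h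
  obtain ⟨E, hE, hE'⟩ := J.exists_finset_compl_band (hfin.subset sdiff_subset)
  have hvpos : ∀ θ, 0 < v₀ (2 * Real.cos θ) := fun θ => hv _ (two_cos_mem_Icc θ)
  have hw : InAlg Ahat fun θ => (v₀ (2 * Real.cos θ) : ℂ) := by
    have := hlog.exp hN
    simpa only [← Complex.ofReal_exp, Real.exp_log (hvpos _)] using this
  obtain ⟨c₁, d₁, hcd₁, h₁⟩ := exists_sqrt_zpow_eq hl
  obtain ⟨c₂, d₂, hcd₂, h₂⟩ := exists_sqrt_zpow_eq hr
  -- `q` is the product of the linear factors `2 ± x` belonging to the exponents `-1`.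
  have hqf : ∀ x, c₁ * c₂ + (d₁ * c₂ - c₁ * d₂) * x + (-(d₁ * d₂)) * x ^ 2 =
      (c₁ + d₁ * x) * (c₂ + d₂ * -x) := fun x => by ring
  have hatom : ∀ x, x = 2 ∨ x = -2 → J.spectralMeasure {x} = 0 := by
    intro x hx
    have hx' : x ∈ Icc (-2 : ℝ) 2 := by rcases hx with rfl | rfl <;> norm_num
    rw [← Measure.restrict_eq_self _ (singleton_subset_iff.2 hx'), hd]
    refine withDensity_absolutelyContinuous _ _ ?_
    exact measure_mono_null subset_rfl (Measure.restrict_le_self.absolutelyContinuous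
      (Real.volume_singleton (a := x)))
  let D : BandModel J.spectralMeasure :=
    { q0 := c₁ * c₂
      q1 := d₁ * c₂ - c₁ * d₂
      q2 := -(d₁ * d₂)
      w := fun θ => v₀ (2 * Real.cos θ)
      β := _
      E := E
      hasFourier := hN.hasFourier_of_inAlg hw
      even := fun θ => by rw [Real.cos_neg]
      nonneg := fun θ => (hvpos θ).le
      q_pos := fun x hx => by
        rw [hqf]
        exact mul_pos (h₁ x (by linarith [hx.1])).1 (h₂ (-x) (by linarith [hx.2])).1
      density := restrict_Ioo_eq_withDensity hd fun x hx => by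
        have e1 := h₁ x (by linarith [hx.1])
        have e2 := h₂ (-x) (by linarith [hx.2])
        rw [hqf, two_cos_arccos_div ⟨hx.1.le, hx.2.le⟩, e1.2, sub_eq_add_neg 2 x, e2.2,
          show (4 : ℝ) - x ^ 2 = (2 + x) * (2 + -x) by ring,
          Real.sqrt_mul (by linarith [hx.1])]
        congr 1
        field_simp
      edge := fun x hx => Or.inr (hatom x hx)
      atoms_outside := hE
      compl := hE' }
  refine J.memM_of_bandModel hN D hw hvpos fun ε hε hq => ⟨hatom _ ?_, ?_⟩
  · rcases hε with rfl | rfl <;> norm_num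
  · change c₁ * c₂ + (d₁ * c₂ - c₁ * d₂) * (2 * ε) + (-(d₁ * d₂)) * (2 * ε) ^ 2 = 0 at hq
    change d₁ * c₂ - c₁ * d₂ + 4 * ε * (-(d₁ * d₂)) ≠ 0
    -- In each choice of exponents either `q` is nonzero at the edge, contradicting `hq`, or its
    -- zero there is simple.
    rcases hε with rfl | rfl <;> rcases hcd₁ with ⟨rfl, rfl⟩ | ⟨rfl, rfl⟩ <;>
      rcases hcd₂ with ⟨rfl, rfl⟩ | ⟨rfl, rfl⟩ <;>
      first | (norm_num; done) | (exfalso; norm_num at hq)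

/-! ### From the class `ℳ` to the class `𝒱`: the global weight -/

theorem eventually_sin_ne_zero {θ : ℝ} (h : Real.sin θ = 0) :
    ∀ᶠ φ in 𝓝[≠] θ, Real.sin φ ≠ 0 := by
  refine (Real.hasDerivAt_sin θ).eventually_ne fun hc => ?_
  have := Real.sin_sq_add_cos_sq θ
  rw [h, hc] at this
  norm_num at this

/-- The weight extracted from an edge form. -/
theorem EdgeForm.exists_weight {Ahat : Set (ℤ → ℂ)} {N : (ℤ → ℂ) → ENNReal}
    (hN : IsAlgNorm Ahat N) {F : ℝ → ℂ} {ε θ₀ : ℝ} (he : IsEdge ε θ₀) (h : EdgeForm Ahat F θ₀) :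
    ∃ (c d : ℝ) (H χ : ℝ → ℝ), (c = 1 ∧ d = 0 ∨ c = 2 ∧ d = 1) ∧ IsCircleBump χ ∧
      (∀ᶠ θ in 𝓝 θ₀, χ θ = 1) ∧ (∀ θ, χ θ ≠ 0 → 0 < ε * Real.cos θ) ∧
      InAlg Ahat (fun θ => (H θ : ℂ)) ∧ H θ₀ ≠ 0 ∧
      (∀ θ, χ θ ≠ 0 → Real.sin θ ≠ 0 →
        (F θ).im * (c - d * (ε * (2 * Real.cos θ))) = 2 * Real.pi * Real.sin θ * H θ) ∧
      Tendsto (fun θ => (Real.sin θ ^ 2 : ℝ) * F θ) (𝓝[≠] θ₀) (𝓝 0) := by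
  obtain ⟨α, β, χ, hmem, hχ, hχ1, -, G, hG, hGim, hF⟩ := h
  have hpi := Real.pi_pos
  have hpi' : (Real.pi : ℂ) ≠ 0 := by exact_mod_cast hpi.ne'
  have hGi := hG.im hN
  have hG0 := hGim θ₀ hmem
  set f : ℝ → ℝ := fun θ => 2 * (ε * Real.cos θ)
  set f₁ : ℝ → ℝ := fun θ => 2 * (ε * Real.cos θ) + 1
  have hf : ContDiff ℝ ∞ f := by fun_prop
  have hf₁ : ContDiff ℝ ∞ f₁ := by fun_prop
  have hp : Function.Periodic f (2 * Real.pi) := fun θ => by simp only [f, Real.cos_add_two_pi]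
  have hp₁ : Function.Periodic f₁ (2 * Real.pi) := fun θ => by simp only [f₁, Real.cos_add_two_pi]
  have hf0 : f θ₀ = 2 := by simp only [f, he.cos, he.eps_mul_self, mul_one]
  have hcut := isCircleBump_smoothTransition hf hp
  have hbump : IsCircleBump fun θ => χ θ * Real.smoothTransition (f θ) :=
    ⟨hχ.1.mul hcut.1, hχ.2.1.mul hcut.2.1, fun θ =>
      ⟨mul_nonneg (hχ.2.2 θ).1 (hcut.2.2 θ).1, mul_le_one₀ (hχ.2.2 θ).2 (hcut.2.2 θ).1
        (hcut.2.2 θ).2⟩⟩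
  have hone : ∀ᶠ θ in 𝓝 θ₀, χ θ * Real.smoothTransition (f θ) = 1 := by
    filter_upwards [hχ1, eventually_smoothTransition_eq_one hf (by rw [hf0]; norm_num)] with θ h1 h2
    rw [h1, h2, mul_one]
  have hpos : ∀ θ, χ θ * Real.smoothTransition (f θ) ≠ 0 → 0 < ε * Real.cos θ := fun θ h => by
    have : 0 < f θ := smoothTransition_ne_zero (right_ne_zero_of_mul h)
    simp only [f] at this
    linarith
  have hsin : Tendsto (fun θ => (Real.sin θ : ℂ)) (𝓝[≠] θ₀) (𝓝 0) := by
    have : Continuous fun θ : ℝ => (Real.sin θ : ℂ) :=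
      Complex.continuous_ofReal.comp Real.continuous_sin
    have h1 := this.tendsto θ₀
    rw [he.sin, Complex.ofReal_zero] at h1
    exact h1.mono_left nhdsWithin_le_nhds
  have hGt : Tendsto G (𝓝[≠] θ₀) (𝓝 (G θ₀)) := (hG.1.tendsto θ₀).mono_left nhdsWithin_le_nhds
  rcases hF with hF | ⟨c, hF⟩
  · have hd : ∀ θ, 0 ≤ f₁ θ → 1 + ε * Real.cos θ ≠ 0 := fun θ h => by
      simp only [f₁] at h
      linarith
    -- In this case the factor `2 - 2ε cos θ = 2 sin² θ / (1 + ε cos θ)` turns `Im G / sin θ` into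
    -- `2π sin θ` times a weight, which dictates the denominator `π (1 + ε cos θ)`.
    refine ⟨2, 1, fun θ => Real.smoothTransition (f₁ θ) * (1 / (Real.pi * (1 + ε * Real.cos θ))) *
      (G θ).im, _, Or.inr ⟨rfl, rfl⟩, hbump, hone, hpos, ?_, ?_, fun θ h1 h2 => ?_, ?_⟩
    · have := InAlg.smooth_mul hN (contDiff_smoothTransition_mul (f := f₁)
        (g := fun θ => 1 / (Real.pi * (1 + ε * Real.cos θ))) hf₁ fun θ h =>
          contDiffAt_const.div (ContDiff.contDiffAt (by fun_prop)) (mul_ne_zero hpi.ne' (hd θ h)))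
        (fun θ => by simp only [f₁, Real.cos_add_two_pi]) hGi
      simpa only [Complex.ofReal_mul] using this
    · have h1 : f₁ θ₀ = f θ₀ + 1 := rfl
      have h2 := hd θ₀ (by linarith)
      beta_reduce
      rw [Real.smoothTransition.one_of_one_le (by linarith)]
      positivity
    · have h3 := hpos θ h1
      have h4 : f₁ θ = 2 * (ε * Real.cos θ) + 1 := rfl
      have h5 := hd θ (by linarith)
      have h6 : F θ = G θ / (Real.sin θ : ℂ) :=
        mul_left_cancel₀ (by exact_mod_cast left_ne_zero_of_mul h1) (hF θ h2)
      beta_reduce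
      rw [Real.smoothTransition.one_of_one_le (by linarith), h6, Complex.div_ofReal_im]
      have h7 : Real.sin θ ^ 2 = (1 + ε * Real.cos θ) * (1 - ε * Real.cos θ) := by
        rw [Real.sin_sq]
        linear_combination Real.cos θ ^ 2 * he.eps_mul_self
      field_simp
      linear_combination -(G θ).im * h7
    -- The singularity is at most `1 / sin θ`, too weak to survive multiplication by `sin² θ`; an
    -- edge atom would have left a nonzero limit.
    · have h1 := hsin.mul hGt
      rw [zero_mul] at h1
      refine h1.congr' ?_
      filter_upwards [eventually_sin_ne_zero he.sin, nhdsWithin_le_nhds hχ1] with θ h2 h3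
      have h4 := hF θ h2
      have h5 : (Real.sin θ : ℂ) ≠ 0 := by exact_mod_cast h2
      rw [h3, Complex.ofReal_one, one_mul, one_mul] at h4
      rw [h4]
      push_cast
      push_cast at h5
      field_simp
  · refine ⟨1, 0, fun θ => 1 / (2 * Real.pi) * (G θ).im, _, Or.inl ⟨rfl, rfl⟩, hbump, hone, hpos,
      ?_, ?_, fun θ h1 h2 => ?_, ?_⟩
    · simpa only [Complex.ofReal_mul] using hGi.const_mul hN ((1 / (2 * Real.pi) : ℝ) : ℂ)
    · beta_reduce
      positivity
    · have h6 : F θ = c + (Real.sin θ : ℂ) * G θ :=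
        mul_left_cancel₀ (by exact_mod_cast left_ne_zero_of_mul h1) (hF θ h2)
      rw [h6, Complex.add_im, Complex.ofReal_im, Complex.im_ofReal_mul]
      field_simp
      ring
    · have h1 := (hsin.pow 2).mul ((hsin.mul hGt).const_add (c : ℂ))
      rw [zero_pow two_ne_zero, zero_mul] at h1
      refine h1.congr' ?_
      filter_upwards [eventually_sin_ne_zero he.sin, nhdsWithin_le_nhds hχ1] with θ h2 h3
      have h4 := hF θ h2
      rw [h3, Complex.ofReal_one, one_mul, one_mul] at h4
      rw [h4]
      push_cast
      ring

theorem InAlgLoc.add_int_mul {Ahat : Set (ℤ → ℂ)} {f : ℝ → ℂ} {θ : ℝ} (h : InAlgLoc Ahat f θ)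
    (k : ℤ) : InAlgLoc Ahat f (θ + k * (2 * Real.pi)) := by
  obtain ⟨χ, h1, h2, h3⟩ := h
  refine ⟨χ, h1, ?_, h3⟩
  have : Tendsto (fun φ => φ - k * (2 * Real.pi)) (𝓝 (θ + k * (2 * Real.pi))) (𝓝 θ) := by
    have := (continuous_sub_right ((k : ℝ) * (2 * Real.pi))).tendsto (θ + k * (2 * Real.pi))
    rwa [add_sub_cancel_right] at this
  filter_upwards [this.eventually h2] with φ hφ
  rwa [h1.2.1.sub_int_mul_eq] at hφ

theorem MemM.regular {Ahat : Set (ℤ → ℂ)} {F : ℝ → ℂ}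
    (h : ∀ α β : ℝ, (∀ θ ∈ Ioo α β, Real.sin θ ≠ 0) → RegularOnArc Ahat F α β) {θ : ℝ}
    (hθ : Real.sin θ ≠ 0) : InAlgLoc Ahat F θ ∧ (F θ).im ≠ 0 := by
  have hop : IsOpen {θ : ℝ | Real.sin θ ≠ 0} := isOpen_ne_fun Real.continuous_sin continuous_const
  obtain ⟨α, β, h1, h2⟩ := mem_nhds_iff_exists_Ioo_subset.1 (hop.mem_nhds hθ)
  exact h α β (fun θ hθ => h2 hθ) θ h1

theorem InAlgLoc.im {Ahat : Set (ℤ → ℂ)} {N : (ℤ → ℂ) → ENNReal} (hN : IsAlgNorm Ahat N)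
    {f : ℝ → ℂ} {θ : ℝ} (h : InAlgLoc Ahat f θ) : InAlgLoc Ahat (fun θ => ((f θ).im : ℂ)) θ := by
  obtain ⟨χ, h1, h2, h3⟩ := h
  refine ⟨χ, h1, h2, ?_⟩
  simpa only [Complex.im_ofReal_mul, Complex.ofReal_mul] using h3.im hN

theorem sin_eq_zero_cases {θ : ℝ} (h : Real.sin θ = 0) :
    ∃ k : ℤ, θ = 0 + k * (2 * Real.pi) ∨ θ = Real.pi + k * (2 * Real.pi) := by
  obtain ⟨n, rfl⟩ := Real.sin_eq_zero_iff.1 h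
  obtain ⟨k, rfl | rfl⟩ := Int.even_or_odd' n
  · exact ⟨k, Or.inl (by push_cast; ring)⟩
  · exact ⟨k, Or.inr (by push_cast; ring)⟩

theorem inAlgLoc_of_bump_mul {Ahat : Set (ℤ → ℂ)} {N : (ℤ → ℂ) → ENNReal}
    (hN : IsAlgNorm Ahat N) {W χ H g : ℝ → ℝ} {θ₀ : ℝ} (hχ : IsCircleBump χ)
    (hone : ∀ᶠ θ in 𝓝 θ₀, χ θ = 1) (hH : InAlg Ahat fun θ => (H θ : ℂ)) (hg : ContDiff ℝ ∞ g)
    (hp : Function.Periodic g (2 * Real.pi)) (h : ∀ θ, χ θ ≠ 0 → W θ = g θ * H θ) :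
    InAlgLoc Ahat (fun θ => (W θ : ℂ)) θ₀ := by
  refine ⟨χ, hχ, hone, ?_⟩
  have h1 := InAlg.smooth_mul hN (hχ.1.mul hg) (hχ.2.1.mul hp) hH
  convert h1 using 2 with θ
  by_cases h0 : χ θ = 0
  · simp [h0]
  · beta_reduce
    rw [h θ h0]
    push_cast
    ring

/-- Shrinking the bump keeps its support off the zeros of `sin`, where the multiplier `g` may be
singular. -/
theorem InAlgLoc.mul_of_sin_ne_zero {Ahat : Set (ℤ → ℂ)} {N : (ℤ → ℂ) → ENNReal}
    (hN : IsAlgNorm Ahat N) {f g W : ℝ → ℝ} {θ₀ : ℝ} (hf : InAlgLoc Ahat (fun θ => (f θ : ℂ)) θ₀)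
    (hθ : Real.sin θ₀ ≠ 0) (hg : ∀ θ, Real.sin θ ≠ 0 → ContDiffAt ℝ ∞ g θ)
    (hp : Function.Periodic g (2 * Real.pi)) (h : ∀ θ, Real.sin θ ≠ 0 → W θ = g θ * f θ) :
    InAlgLoc Ahat (fun θ => (W θ : ℂ)) θ₀ := by
  have hs : 0 < Real.sin θ₀ ^ 2 := by positivity
  obtain ⟨χ, hχ, hone, hχf⟩ := hf
  set b : ℝ → ℝ := fun θ => 4 / Real.sin θ₀ ^ 2 * Real.sin θ ^ 2 - 1
  have hb : ContDiff ℝ ∞ b := by fun_prop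
  have hbp : Function.Periodic b (2 * Real.pi) := fun θ => by simp only [b, Real.sin_add_two_pi]
  have hsin : ∀ θ, 0 ≤ b θ → Real.sin θ ≠ 0 := by
    intro θ h1 h2
    simp only [b, h2] at h1
    norm_num at h1
  have hcut := isCircleBump_smoothTransition hb hbp
  refine ⟨fun θ => χ θ * Real.smoothTransition (b θ), ⟨hχ.1.mul hcut.1, hχ.2.1.mul hcut.2.1, fun θ =>
      ⟨mul_nonneg (hχ.2.2 θ).1 (hcut.2.2 θ).1, mul_le_one₀ (hχ.2.2 θ).2 (hcut.2.2 θ).1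
        (hcut.2.2 θ).2⟩⟩, ?_, ?_⟩
  · filter_upwards [hone, eventually_smoothTransition_eq_one hb (θ₀ := θ₀) (by
      simp only [b]
      rw [div_mul_cancel₀ _ hs.ne']
      norm_num)] with θ h1 h2
    rw [h1, h2, mul_one]
  · have h1 := InAlg.smooth_mul hN (contDiff_smoothTransition_mul hb fun θ h => hg θ (hsin θ h))
      (hcut.2.1.mul hp) hχf
    convert h1 using 2 with θ
    by_cases h0 : b θ ≤ 0
    · simp [Real.smoothTransition.zero_of_nonpos h0]
    · beta_reduce
      rw [h θ (hsin θ (not_le.1 h0).le)]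
      push_cast
      ring

theorem edge_factor_pos {c d x : ℝ} (h : c = 1 ∧ d = 0 ∨ c = 2 ∧ d = 1) (hx : -2 < x) :
    0 < c + d * x := by
  rcases h with ⟨rfl, rfl⟩ | ⟨rfl, rfl⟩ <;> linarith

/-- The global weight of a function in the class `ℳ`. -/
theorem exists_weight_of_edgeForm {Ahat : Set (ℤ → ℂ)} {N : (ℤ → ℂ) → ENNReal}
    (hN : IsAlgNorm Ahat N) {F : ℝ → ℂ}
    (hreg : ∀ θ, Real.sin θ ≠ 0 → InAlgLoc Ahat F θ ∧ (F θ).im ≠ 0)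
    (hpos : ∀ θ, Real.sin θ ≠ 0 → 0 < Real.sin θ * (F θ).im)
    (hodd : ∀ θ, Real.sin θ ≠ 0 → (F (-θ)).im = -(F θ).im)
    (h0 : EdgeForm Ahat F 0) (hπ : EdgeForm Ahat F Real.pi) :
    ∃ (c₁ d₁ c₂ d₂ : ℝ) (W : ℝ → ℝ), (c₁ = 1 ∧ d₁ = 0 ∨ c₁ = 2 ∧ d₁ = 1) ∧
      (c₂ = 1 ∧ d₂ = 0 ∨ c₂ = 2 ∧ d₂ = 1) ∧ InAlg Ahat (fun θ => (W θ : ℂ)) ∧ (∀ θ, 0 < W θ) ∧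
      (∀ θ, W (-θ) = W θ) ∧ ∀ θ, Real.sin θ ≠ 0 →
        (F θ).im * ((c₁ + d₁ * (2 * Real.cos θ)) * (c₂ + d₂ * -(2 * Real.cos θ))) =
          2 * Real.pi * Real.sin θ * W θ := by
  have hpi := Real.pi_pos
  obtain ⟨c₂, d₂, H₂, χ₂, hcd₂, hχ₂, hone₂, hcos₂, hH₂, hH₂0, hW₂, -⟩ :=
    h0.exists_weight hN (Or.inl ⟨rfl, rfl⟩)
  obtain ⟨c₁, d₁, H₁, χ₁, hcd₁, hχ₁, hone₁, hcos₁, hH₁, hH₁0, hW₁, -⟩ :=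
    hπ.exists_weight hN (Or.inr ⟨rfl, rfl⟩)
  set q : ℝ → ℝ := fun θ => (c₁ + d₁ * (2 * Real.cos θ)) * (c₂ + d₂ * -(2 * Real.cos θ))
  have hqc : ContDiff ℝ ∞ q := by fun_prop
  have hqp : ∀ θ, Real.sin θ ≠ 0 → 0 < q θ := fun θ h => by
    have := BandModel.two_cos_mem_Ioo h
    exact mul_pos (edge_factor_pos hcd₁ this.1) (edge_factor_pos hcd₂ (by linarith [this.2]))
  -- `W` is forced by the required identity where `sin θ ≠ 0`; at the edge points it takes the value
  -- of the weight from the edge form. It then agrees with the edge weights on the supports of both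
  -- bumps, so it is locally in the algebra everywhere.
  set W : ℝ → ℝ := fun θ => if Real.sin θ ≠ 0 then (F θ).im * q θ / (2 * Real.pi * Real.sin θ) else
    if 0 < Real.cos θ then (c₁ + d₁ * (2 * Real.cos θ)) * H₂ θ
      else (c₂ + d₂ * -(2 * Real.cos θ)) * H₁ θ
  have hWs : ∀ θ, Real.sin θ ≠ 0 → W θ = (F θ).im * q θ / (2 * Real.pi * Real.sin θ) :=
    fun θ h => if_pos h
  have hE₂ : ∀ θ, χ₂ θ ≠ 0 → W θ = (c₁ + d₁ * (2 * Real.cos θ)) * H₂ θ := by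
    intro θ h
    have h1 : 0 < Real.cos θ := by linarith [hcos₂ θ h]
    by_cases hs : Real.sin θ = 0
    · simp only [W, hs, h1, ne_eq, not_true_eq_false, if_false, if_true]
    · rw [hWs θ hs, div_eq_iff (by positivity)]
      have := hW₂ θ h hs
      simp only [q]
      linear_combination (c₁ + d₁ * (2 * Real.cos θ)) * this
  have hE₁ : ∀ θ, χ₁ θ ≠ 0 → W θ = (c₂ + d₂ * -(2 * Real.cos θ)) * H₁ θ := by
    intro θ h
    have h1 : ¬ 0 < Real.cos θ := by linarith [hcos₁ θ h]
    by_cases hs : Real.sin θ = 0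
    · simp only [W, hs, h1, ne_eq, not_true_eq_false, if_false]
    · rw [hWs θ hs, div_eq_iff (by positivity)]
      have := hW₁ θ h hs
      simp only [q]
      linear_combination (c₂ + d₂ * -(2 * Real.cos θ)) * this
  have hloc : ∀ θ, InAlgLoc Ahat (fun θ => (W θ : ℂ)) θ := by
    intro θ
    by_cases hs : Real.sin θ = 0
    · obtain ⟨k, rfl | rfl⟩ := sin_eq_zero_cases hs
      · exact (inAlgLoc_of_bump_mul hN hχ₂ hone₂ hH₂ (by fun_prop)
          (fun θ => by simp only [Real.cos_add_two_pi]) hE₂).add_int_mul k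
      · exact (inAlgLoc_of_bump_mul hN hχ₁ hone₁ hH₁ (by fun_prop)
          (fun θ => by simp only [Real.cos_add_two_pi]) hE₁).add_int_mul k
    · refine InAlgLoc.mul_of_sin_ne_zero hN ((hreg θ hs).1.im hN) hs
        (g := fun θ => q θ / (2 * Real.pi * Real.sin θ))
        (fun φ hφ => hqc.contDiffAt.div (ContDiff.contDiffAt (by fun_prop)) (by positivity))
        (fun φ => by simp only [q, Real.cos_add_two_pi, Real.sin_add_two_pi]) fun φ hφ => ?_
      rw [hWs φ hφ]
      ring
  have hWA := inAlg_of_inAlgLoc hN hloc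
  have hWc : Continuous W := by
    have := Complex.continuous_re.comp hWA.1
    exact this
  have hWp : Function.Periodic W (2 * Real.pi) := fun θ => Complex.ofReal_injective (hWA.2.1 θ)
  have hWpos : ∀ θ, Real.sin θ ≠ 0 → 0 < W θ := by
    intro θ hs
    have e : W θ = Real.sin θ * (F θ).im * q θ / (2 * Real.pi * Real.sin θ ^ 2) := by
      rw [hWs θ hs]
      field_simp
    rw [e]
    exact div_pos (mul_pos (hpos θ hs) (hqp θ hs)) (by positivity)
  -- At an edge continuity gives `W ≥ 0` as a limit of positive values, and the edge form gives `W ≠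
  -- 0`.
  have hWpos' : ∀ θ, Real.sin θ = 0 → W θ ≠ 0 → 0 < W θ := by
    intro θ hs h
    refine lt_of_le_of_ne ?_ (Ne.symm h)
    refine ge_of_tendsto ((hWc.tendsto θ).mono_left (nhdsWithin_le_nhds (s := {θ}ᶜ))) ?_
    filter_upwards [eventually_sin_ne_zero hs] with φ hφ
    exact (hWpos φ hφ).le
  refine ⟨c₁, d₁, c₂, d₂, W, hcd₁, hcd₂, hWA, fun θ => ?_, fun θ => ?_, fun θ hs => ?_⟩
  · by_cases hs : Real.sin θ = 0
    · obtain ⟨k, rfl | rfl⟩ := sin_eq_zero_cases hs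
      · rw [hWp.int_mul k]
        refine hWpos' 0 Real.sin_zero ?_
        rw [hE₂ 0 (by rw [hone₂.self_of_nhds]; exact one_ne_zero), Real.cos_zero]
        exact mul_ne_zero (edge_factor_pos hcd₁ (by norm_num)).ne' hH₂0
      · rw [hWp.int_mul k]
        refine hWpos' Real.pi Real.sin_pi ?_
        rw [hE₁ Real.pi (by rw [hone₁.self_of_nhds]; exact one_ne_zero), Real.cos_pi]
        exact mul_ne_zero (edge_factor_pos hcd₂ (by norm_num)).ne' hH₁0
    · exact hWpos θ hs
  · by_cases hs : Real.sin θ = 0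
    · obtain ⟨k, rfl | rfl⟩ := sin_eq_zero_cases hs
      · rw [hWp.int_mul k, show -(0 + (k : ℝ) * (2 * Real.pi)) = 0 + (-k : ℤ) * (2 * Real.pi) by
          push_cast; ring, hWp.int_mul]
      · rw [hWp.int_mul k, show -(Real.pi + (k : ℝ) * (2 * Real.pi)) =
          Real.pi + (-1 - k : ℤ) * (2 * Real.pi) by push_cast; ring, hWp.int_mul]
    · rw [hWs θ hs, hWs (-θ) (by rwa [Real.sin_neg, neg_ne_zero]), hodd θ hs, Real.sin_neg]
      simp only [q, Real.cos_neg]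
      rw [neg_mul, mul_neg (2 * Real.pi), neg_div_neg_eq]
  · rw [hWs θ hs, mul_div_cancel₀]
    positivity

/-- An even `2π`-periodic function depends on `cos θ` only, so the angular weight descends to a
function on the band. -/
theorem two_cos_comp_arccos {W : ℝ → ℝ} (hp : Function.Periodic W (2 * Real.pi))
    (he : ∀ θ, W (-θ) = W θ) (θ : ℝ) : W (Real.arccos (2 * Real.cos θ / 2)) = W θ := by
  rw [mul_div_cancel_left₀ _ (two_ne_zero' ℝ)]
  have h : Real.cos θ = Real.cos (Real.arccos (Real.cos θ)) :=
    (Real.cos_arccos (Real.neg_one_le_cos θ) (Real.cos_le_one θ)).symm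
  obtain ⟨k, hk | hk⟩ := Real.cos_eq_cos_iff.1 h
  · rw [hk, show 2 * (k : ℝ) * Real.pi + θ = θ + k * (2 * Real.pi) by ring, hp.int_mul]
  · rw [hk, show 2 * (k : ℝ) * Real.pi - θ = -θ + k * (2 * Real.pi) by ring, hp.int_mul, he]

/-! ### From the class `ℳ` to the class `𝒱`: the spectral measure -/

theorem polarPoint_neg (t θ : ℝ) : polarPoint t (-θ) = starRingEnd ℂ (polarPoint t θ) := by
  rw [polarPoint, polarPoint, map_mul, Complex.conj_ofReal, ← Complex.exp_conj, map_mul,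
    Complex.conj_ofReal, Complex.conj_I]
  push_cast
  rw [neg_mul, mul_neg]

theorem integral_inv_sub_conj (ν : Measure ℝ) (y : ℂ) :
    ∫ x, (starRingEnd ℂ y - (x : ℂ))⁻¹ ∂ν = starRingEnd ℂ (∫ x, (y - (x : ℂ))⁻¹ ∂ν) := by
  rw [← integral_conj]
  refine integral_congr_ae (Eventually.of_forall fun x => ?_)
  simp

theorem radial_limit_neg {ν : Measure ℝ} {F : ℝ → ℂ}
    (hF : ∀ θ, Real.sin θ ≠ 0 → Tendsto
      (fun t => ∫ x, (polarPoint t θ + (polarPoint t θ)⁻¹ - (x : ℂ))⁻¹ ∂ν) (𝓝[<] 1) (𝓝 (F θ)))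
    {θ : ℝ} (hθ : Real.sin θ ≠ 0) : F (-θ) = starRingEnd ℂ (F θ) := by
  refine tendsto_nhds_unique (hF (-θ) (by rwa [Real.sin_neg, neg_ne_zero])) ?_
  refine ((Complex.continuous_conj.tendsto _).comp (hF θ hθ)).congr fun t => ?_
  rw [Function.comp_apply, ← integral_inv_sub_conj, polarPoint_neg, map_add, map_inv₀]

/-- The imaginary part is a limit of Poisson integrals of a positive measure. Together with the
condition `Im M ≠ 0` this fixes its sign. -/
theorem radial_limit_im_nonneg {ν : Measure ℝ} [IsFiniteMeasure ν] {θ : ℝ} (hθ : 0 < Real.sin θ)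
    {F : ℂ} (hF : Tendsto (fun t => ∫ x, (polarPoint t θ + (polarPoint t θ)⁻¹ - (x : ℂ))⁻¹ ∂ν)
      (𝓝[<] 1) (𝓝 F)) : 0 ≤ F.im := by
  refine ge_of_tendsto (tendsto_poisson_of_tendsto_radial hθ hF) ?_
  filter_upwards [self_mem_nhdsWithin] with ε hε
  have : 0 < ε := hε
  exact integral_nonneg fun x => by positivity

theorem sin_arccos_div_pos {x : ℝ} (hx : x ∈ Ioo (-2 : ℝ) 2) : 0 < Real.sin (Real.arccos (x / 2)) := by
  rw [Real.sin_arccos]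
  exact Real.sqrt_pos.2 (by nlinarith [hx.1, hx.2])

theorem two_mul_sin_arccos_div (x : ℝ) : 2 * Real.sin (Real.arccos (x / 2)) = √(4 - x ^ 2) := by
  rw [Real.sin_arccos, show 4 - x ^ 2 = 2 ^ 2 * (1 - (x / 2) ^ 2) by ring,
    Real.sqrt_mul (by norm_num), Real.sqrt_sq (by norm_num)]

theorem restrict_Ioo_of_radial_limit {ν : Measure ℝ} [IsFiniteMeasure ν] {F : ℝ → ℂ}
    (hF : ∀ θ, Real.sin θ ≠ 0 → Tendsto
      (fun t => ∫ x, (polarPoint t θ + (polarPoint t θ)⁻¹ - (x : ℂ))⁻¹ ∂ν) (𝓝[<] 1) (𝓝 (F θ))) :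
    ν.restrict (Ioo (-2) 2) = (volume.restrict (Ioo (-2) 2)).withDensity fun x =>
      ENNReal.ofReal ((F (Real.arccos (x / 2))).im / Real.pi) := by
  refine restrict_eq_withDensity_of_tendsto_poisson measurableSet_Ioo fun x hx => ?_
  have hs := sin_arccos_div_pos hx
  have h := tendsto_poisson_of_tendsto_radial hs (hF _ hs.ne')
  rwa [two_cos_arccos_div ⟨hx.1.le, hx.2.le⟩, ← mul_div_cancel₀ (F _).im Real.pi_ne_zero] at h

theorem withDensity_Ioo_congr {f g : ℝ → ENNReal} {a b : ℝ} (h : ∀ x ∈ Ioo a b, f x = g x) :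
    (volume.restrict (Ioo a b)).withDensity f = (volume.restrict (Ioo a b)).withDensity g := by
  refine withDensity_congr_ae ?_
  filter_upwards [ae_restrict_mem measurableSet_Ioo] with x hx
  exact h x hx

/-- An edge form excludes an atom at the edge. -/
theorem BandModel.edge_atom_eq_zero {ν : Measure ℝ} [IsFiniteMeasure ν] (D : BandModel ν)
    {Ahat : Set (ℤ → ℂ)} {N : (ℤ → ℂ) → ENNReal} (hN : IsAlgNorm Ahat N)
    (hw : InAlg Ahat fun θ => (D.w θ : ℂ)) {F : ℝ → ℂ}
    (hF : ∀ θ, Real.sin θ ≠ 0 → Tendsto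
      (fun t => ∫ x, (polarPoint t θ + (polarPoint t θ)⁻¹ - (x : ℂ))⁻¹ ∂ν) (𝓝[<] 1) (𝓝 (F θ)))
    (hq : ∀ x, D.q x = 4 - x ^ 2) (hq2 : D.q1 = 0 ∧ D.q2 = -1) {ε θ₀ : ℝ} (he : IsEdge ε θ₀)
    (h : EdgeForm Ahat F θ₀) : ν {2 * ε} = 0 := by
  have hq0 : D.q (2 * ε) = 0 := by
    rw [hq]
    linear_combination (-4 : ℝ) * he.eps_mul_self
  obtain ⟨-, -, -, -, -, -, -, -, -, -, -, hlim⟩ := h.exists_weight hN he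
  have h1 : Tendsto (fun θ => (D.r (2 * Real.cos θ) + 2 * Real.sin θ * Complex.I * D.C θ : ℂ))
      (𝓝[≠] θ₀) (𝓝 (D.r (2 * ε))) := by
    have hC := (D.inAlg_C hN hw).1
    have hr := D.contDiff_r.continuous
    have hc : Continuous fun θ => (D.r (2 * Real.cos θ) + 2 * Real.sin θ * Complex.I * D.C θ : ℂ) := by
      refine (Complex.continuous_ofReal.comp hr).add (Continuous.mul ?_ hC)
      exact (continuous_const.mul (Complex.continuous_ofReal.comp Real.continuous_sin)).mul
        continuous_const
    have h2 := hc.tendsto θ₀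
    rw [he.cos, he.sin, Complex.ofReal_zero, mul_zero, zero_mul, zero_mul, add_zero] at h2
    exact h2.mono_left nhdsWithin_le_nhds
  have h2 : Tendsto (fun θ => (D.r (2 * Real.cos θ) + 2 * Real.sin θ * Complex.I * D.C θ : ℂ))
      (𝓝[≠] θ₀) (𝓝 0) := by
    -- The factor `4` makes `4 sin² θ = 4 - (2 cos θ)²` the value of `q`, so the limit zero from the
    -- edge form applies to `q F`, the numerator of the boundary formula.
    have h3 := hlim.const_mul (4 : ℂ)
    rw [mul_zero] at h3
    refine h3.congr' ?_
    filter_upwards [eventually_sin_ne_zero he.sin] with θ hθ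
    have hqn : (D.q (2 * Real.cos θ) : ℂ) ≠ 0 := by exact_mod_cast (D.q_two_cos_pos hθ).ne'
    rw [tendsto_nhds_unique (hF θ hθ) (D.tendsto_cauchy hθ), BandModel.F, ← mul_assoc,
      show (4 : ℂ) * (Real.sin θ ^ 2 : ℝ) = D.q (2 * Real.cos θ) by
        rw [hq, Real.sin_sq]
        push_cast
        ring]
    exact mul_div_cancel₀ _ hqn
  have h3 : D.r (2 * ε) = 0 := by exact_mod_cast tendsto_nhds_unique h1 h2
  -- For `q = 4 - x²` the edge value is `r (2ε) = -4ε ν{2ε}`, with a nonzero factor.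
  rw [D.r_edge he.eps hq0, hq2.1, hq2.2, zero_add, mul_eq_zero] at h3
  rcases h3 with h3 | h3
  · rcases he.eps with rfl | rfl <;> norm_num at h3
  · exact (measureReal_eq_zero_iff).1 h3

theorem JacobiMatrix.memV_of_memM (J : JacobiMatrix) {Ahat : Set (ℤ → ℂ)}
    {N : (ℤ → ℂ) → ENNReal} (hN : IsAlgNorm Ahat N) (hfin : (J.eigenvalues \ bandSet).Finite)
    (h : MemM Ahat J.MFunction) : J.MemV Ahat := by
  obtain ⟨F, hbd, hreg, h0, hπ⟩ := h
  have hpi := Real.pi_pos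
  obtain ⟨E, hE, hE'⟩ := J.exists_finset_compl_band hfin
  have hF : ∀ θ, Real.sin θ ≠ 0 → Tendsto (fun t => ∫ x, (polarPoint t θ + (polarPoint t θ)⁻¹ -
      (x : ℂ))⁻¹ ∂J.spectralMeasure) (𝓝[<] 1) (𝓝 (F θ)) := by
    intro θ hθ
    refine (hbd θ hθ).congr' ?_
    filter_upwards [Ioo_mem_nhdsLT one_pos] with t ht
    exact J.MFunction_polarPoint ht hθ
  have hreg' : ∀ θ, Real.sin θ ≠ 0 → InAlgLoc Ahat F θ ∧ (F θ).im ≠ 0 := fun θ => MemM.regular hreg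
  have hodd : ∀ θ, Real.sin θ ≠ 0 → (F (-θ)).im = -(F θ).im := fun θ hθ => by
    rw [radial_limit_neg hF hθ, Complex.conj_im]
  have hpos' : ∀ θ, 0 < Real.sin θ → 0 < (F θ).im := fun θ hθ =>
    lt_of_le_of_ne (radial_limit_im_nonneg hθ (hF θ hθ.ne')) (hreg' θ hθ.ne').2.symm
  have hpos : ∀ θ, Real.sin θ ≠ 0 → 0 < Real.sin θ * (F θ).im := by
    intro θ hθ
    rcases lt_or_gt_of_ne hθ with hlt | hlt
    · have h1 := hpos' (-θ) (by rw [Real.sin_neg]; linarith)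
      rw [hodd θ hθ] at h1
      exact mul_pos_of_neg_of_neg hlt (by linarith)
    · exact mul_pos hlt (hpos' θ hlt)
  obtain ⟨c₁, d₁, c₂, d₂, W, hcd₁, hcd₂, hWA, hWpos, hWeven, hWF⟩ :=
    exists_weight_of_edgeForm hN hreg' hpos hodd h0 hπ
  have hWp : Function.Periodic W (2 * Real.pi) := fun θ => Complex.ofReal_injective (hWA.2.1 θ)
  have hdens := restrict_Ioo_of_radial_limit hF
  have hdensW : ∀ x ∈ Ioo (-2 : ℝ) 2, (F (Real.arccos (x / 2))).im / Real.pi =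
      √(4 - x ^ 2) * W (Real.arccos (x / 2)) / ((c₁ + d₁ * x) * (c₂ + d₂ * -x)) := by
    intro x hx
    have h1 := hWF _ (sin_arccos_div_pos hx).ne'
    rw [two_cos_arccos_div ⟨hx.1.le, hx.2.le⟩] at h1
    have h2 := edge_factor_pos hcd₁ hx.1
    have h3 := edge_factor_pos hcd₂ (x := -x) (by linarith [hx.2])
    rw [div_eq_div_iff hpi.ne' (mul_pos h2 h3).ne', h1, ← two_mul_sin_arccos_div]
    ring
  -- `k` is the complementary product of linear factors. Rewriting the density with the denominator
  -- `4 - x²` at both edges gives a band model before edge atoms are excluded; its weight `k W` may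
  -- vanish at the edges, which the model allows.
  set k : ℝ → ℝ := fun x => (3 - c₁ + (1 - d₁) * x) * (3 - c₂ + (1 - d₂) * -x)
  have hk : ∀ x, k x * ((c₁ + d₁ * x) * (c₂ + d₂ * -x)) = 4 - x ^ 2 := by
    intro x
    simp only [k]
    rcases hcd₁ with ⟨rfl, rfl⟩ | ⟨rfl, rfl⟩ <;> rcases hcd₂ with ⟨rfl, rfl⟩ | ⟨rfl, rfl⟩ <;> ring
  have hk0 : ∀ x ∈ Icc (-2 : ℝ) 2, 0 ≤ k x := by
    intro x hx
    refine mul_nonneg ?_ ?_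
    · rcases hcd₁ with ⟨rfl, rfl⟩ | ⟨rfl, rfl⟩ <;> linarith [hx.1]
    · rcases hcd₂ with ⟨rfl, rfl⟩ | ⟨rfl, rfl⟩ <;> linarith [hx.2]
  have hwA : InAlg Ahat fun θ => ((k (2 * Real.cos θ) * W θ : ℝ) : ℂ) := by
    have := InAlg.smooth_mul hN (χ := fun θ => k (2 * Real.cos θ)) (by fun_prop)
      (fun θ => by simp only [Real.cos_add_two_pi]) hWA
    simpa only [Complex.ofReal_mul] using this
  let D : BandModel J.spectralMeasure :=
    { q0 := 4
      q1 := 0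
      q2 := -1
      w := fun θ => k (2 * Real.cos θ) * W θ
      β := _
      E := E
      hasFourier := hN.hasFourier_of_inAlg hwA
      even := fun θ => by rw [Real.cos_neg, hWeven]
      nonneg := fun θ => mul_nonneg (hk0 _ (two_cos_mem_Icc θ)) (hWpos θ).le
      q_pos := fun x hx => by nlinarith [hx.1, hx.2]
      density := by
        rw [hdens]
        refine withDensity_Ioo_congr fun x hx => ?_
        rw [hdensW x hx, two_cos_arccos_div ⟨hx.1.le, hx.2.le⟩]
        have h2 := edge_factor_pos hcd₁ hx.1
        have h3 := edge_factor_pos hcd₂ (x := -x) (by linarith [hx.2])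
        have h4 : 0 < 4 - x ^ 2 := by nlinarith [hx.1, hx.2]
        congr 1
        rw [show 4 + 0 * x + -1 * x ^ 2 = 4 - x ^ 2 by ring,
          div_eq_div_iff (mul_pos h2 h3).ne' h4.ne']
        linear_combination (-√(4 - x ^ 2) * W (Real.arccos (x / 2))) * hk x
      edge := fun x hx => Or.inl (by rcases hx with rfl | rfl <;> norm_num)
      atoms_outside := hE
      compl := hE' }
  have hDq : ∀ x, D.q x = 4 - x ^ 2 := fun x => by
    change 4 + 0 * x + -1 * x ^ 2 = _
    ring
  have hatom2 : J.spectralMeasure {2} = 0 := by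
    simpa using D.edge_atom_eq_zero hN hwA hF hDq ⟨rfl, rfl⟩ (Or.inl ⟨rfl, rfl⟩) h0
  have hatom2' : J.spectralMeasure {-2} = 0 := by
    simpa using D.edge_atom_eq_zero hN hwA hF hDq ⟨rfl, rfl⟩ (Or.inr ⟨rfl, rfl⟩) hπ
  have hatom : ∀ x ∈ Icc (-2 : ℝ) 2, J.spectralMeasure {x} = 0 := by
    intro x hx
    by_cases h2 : x = 2
    · rwa [h2]
    by_cases h3 : x = -2
    · rwa [h3]
    have hx' : x ∈ Ioo (-2 : ℝ) 2 := ⟨lt_of_le_of_ne hx.1 (Ne.symm h3), lt_of_le_of_ne hx.2 h2⟩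
    rw [← Measure.restrict_eq_self _ (singleton_subset_iff.2 hx'), hdens]
    refine withDensity_absolutelyContinuous _ _ ?_
    exact Measure.restrict_le_self.absolutelyContinuous (Real.volume_singleton (a := x))
  -- An eigenvalue in the band would be an atom of the spectral measure, and none exist there;
  -- finiteness outside the band then becomes finiteness of all eigenvalues.
  have hev : ∀ z ∈ J.eigenvalues, ∃ x : ℝ, z = x ∧ x ∉ Icc (-2 : ℝ) 2 := by
    intro z hz
    obtain ⟨x, rfl⟩ := J.eigenvalue_real hz
    exact ⟨x, rfl, fun hx => J.spectralMeasure_singleton_ne_zero hz (hatom x hx)⟩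
  refine ⟨⟨hfin.subset fun z hz => ⟨hz, ?_⟩, hev⟩, ?_⟩
  · rintro ⟨x, hx, rfl⟩
    obtain ⟨y, hxy, hy⟩ := hev _ hz
    rw [Complex.ofReal_inj.1 hxy] at hx
    exact hy hx
  -- A linear factor in the denominator means exponent `-1`. At the endpoint itself the identity
  -- survives through the convention that division by zero is zero.
  have hsq : ∀ {c d : ℝ}, (c = 1 ∧ d = 0 ∨ c = 2 ∧ d = 1) → ∃ l : ℤ, (l = 1 ∨ l = -1) ∧
      ∀ x, √(2 + x) ^ l = √(2 + x) / (c + d * x) := by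
    rintro c d (⟨rfl, rfl⟩ | ⟨rfl, rfl⟩)
    · exact ⟨1, Or.inl rfl, fun x => by simp⟩
    · exact ⟨-1, Or.inr rfl, fun x => by rw [one_mul, zpow_neg_one, Real.sqrt_div_self]⟩
  obtain ⟨l, hl, hl'⟩ := hsq hcd₁
  obtain ⟨r, hr, hr'⟩ := hsq hcd₂
  refine ⟨l, r, fun x => W (Real.arccos (x / 2)), hl, hr, fun x _ => hWpos _, ?_, ?_⟩
  · simp only [two_cos_comp_arccos hWp hWeven]
    exact hWA.log hN hWpos
  -- Without edge atoms the open and the closed band agree up to null sets for the spectral measure,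
  -- as they do for Lebesgue measure.
  · have hae : (Ioo (-2 : ℝ) 2 : Set ℝ) =ᵐ[J.spectralMeasure] (Icc (-2 : ℝ) 2 : Set ℝ) :=
      Ioo_ae_eq_Icc' hatom2' hatom2
    rw [← Measure.restrict_congr_set hae, hdens,
      ← Measure.restrict_congr_set (μ := volume) Ioo_ae_eq_Icc]
    refine withDensity_Ioo_congr fun x hx => ?_
    rw [hdensW x hx, hl' x, sub_eq_add_neg 2 x, hr' (-x),
      show (4 : ℝ) - x ^ 2 = (2 + x) * (2 + -x) by ring, Real.sqrt_mul (by linarith [hx.1])]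
    congr 1
    have h2 := (edge_factor_pos hcd₁ hx.1).ne'
    have h3 := (edge_factor_pos hcd₂ (x := -x) (by linarith [hx.2])).ne'
    rw [div_mul_div_comm, div_mul_eq_mul_div]

end

theorem mainTheorem2 (Ahat : Set (ℤ → ℂ)) (hA : IsAdmissibleAlgebra Ahat) (J : JacobiMatrix) :
    J.MemV Ahat ↔ (J.eigenvalues \ bandSet).Finite ∧ MemM Ahat J.MFunction := by
  obtain ⟨N, hN⟩ := hA.exists_isAlgNorm
  exact ⟨fun h => ⟨h.1.1.subset sdiff_subset, J.memM_of_memV hN h⟩,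
    fun h => J.memV_of_memM hN h.1 h.2⟩
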